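/- Let $n\ge 0$, let $S_n$ be the symmetric group on $[n]$ with $s_a=(a,a{+}1)$, $t_{ij}=(i,j)$ and Coxeter length $\ell$, and write $v\lessdot w$ if $w=vt_{ij}$ for some $i\ne j$ and $\ell(w)=\ell(v)+1$. Let $\circ$ be the $0$-Hecke product on $S_n$, so $w\circ s_a=ws_a$ if $\ell(ws_a)>\ell(w)$ and $w\circ s_a=w$ otherwise, and similarly for $s_a\circ w$. Let $\mu=(\mu_1,\dots,\mu_k)$ be a composition of $n$ and $m_b=\mu_1+\dots+\mu_{b-1}$. The $b$-th block of $\pi\in S_n$ is the word $B_b=\pi(m_b{+}1)\cdots\pi(m_b{+}\mu_b)$, and $\operatorname{std}(B_b)\in S_{\mu_b}$ is the permutation with the same relative order. Call $\pi$ a $\mu$-involution, $\pi\in\mathcal I_\mu$, if $\operatorname{std}(B_b)^2=1$ for all $b$. In that case $y_\pi\in S_n$ is the involution that sends the $p$-th letter of each block $B_b$ to its $\operatorname{std}(B_b)(p)$-th letter. For $\pi\in\mathcal I_\mu$ and $1\le a<n$ put $\pi\circ_\mu s_a=s_a\circ\pi$ if the values $a,a{+}1$ lie in different blocks of $\pi$,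 and $\pi\circ_\mu s_a=s_a\circ\pi\circ s_{m_b+r}$ if both lie in $B_b$ and $a$ is the $r$-th smallest letter of $B_b$. A word $\mathbf a=(a_1,\dots,a_p)$ in $[n-1]$ is a $\mu$-word for $\pi=e\circ_\mu s_{a_1}\circ_\mu\dots\circ_\mu s_{a_p}$ (computed from left to right). It is $\mu$-reduced if no shorter word is a $\mu$-word for the same $\pi$, and $\mathcal R_\mu(\pi)$ is the set of $\mu$-reduced $\mu$-words for $\pi$. The set $\mathcal A_\mu(\pi)$ of $\mu$-atoms of $\pi\in\mathcal I_\mu$ consists of the $w\in S_n$ all of whose reduced words lie in $\mathcal R_\mu(\pi)$; a $\mu$-atom is an element of some $\mathcal A_\mu(\pi)$ with $\pi\in\mathcal I_\mu$. For $\tau\in\mathcal I_\mu$, call $(\mathbf a,m)$, where $\mathbf a=(a_1,\dots,a_p)$ and $1\le m\le p$, nearly $\mu$-reduced for $\tau$ if $\mathbf a$ is not $\mu$-reduced but $(a_1,\dots,\widehat{a_m},\dots,a_p)\in\mathcal R_\mu(\tau)$. **Theorem.** Let $\tau\in\mathcal I_\mu$. 1. If $(\mathbf a,m)$ is nearly $\mu$-reduced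 for $\tau$, then there is a unique $k\ne m$ such that $(\mathbf a,k)$ is nearly $\mu$-reduced for $\tau$. 2. Let $v\in\mathcal A_\mu(\tau)$ and $i<j$ be such that $v\lessdot w=vt_{ij}$ and $w$ is not a $\mu$-atom. Then the values $i,j$ lie in the same block of $\tau$, and there is a pair $i'<j'$ with $(i',j')\ne(i,j)$, $wt_{i'j'}\in\mathcal A_\mu(\tau)$, $i'\in\{j,y_\tau(j)\}$ and $j'\in\{i,y_\tau(i)\}$. This pair is unique in both senses: it is the only pair $p<q$ with $(p,q)\ne(i,j)$ and $wt_{pq}\in\mathcal A_\mu(\tau)$, and it is the only pair $p<q$ with $wt_{pq}\in\mathcal A_\mu(\tau)$, $p\in\{j,y_\tau(j)\}$ and $q\in\{i,y_\tau(i)\}$. -/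

import Mathlib

/-! Conventions: `[n] = {1, …, n}` is modelled by `Fin n = {0, …, n - 1}`, so every position, value,
letter and block number is shifted down by one.  A permutation `π : Equiv.Perm (Fin n)` has
one-line notation `π 0, π 1, …`, and products are compositions of functions. -/

namespace MuInv

open Equiv

/-! ### Permutations and the 0-Hecke operations -/

/-- The simple transposition `s_a = (a, a+1)` of `Fin n`.  (Only letters with `a + 1 < n` are ever
used; for other `a` the value is the identity.) -/
def simple (n a : ℕ) : Perm (Fin n) :=
  if h : a + 1 < n then swap ⟨a, Nat.lt_of_succ_lt h⟩ ⟨a + 1, h⟩ else 1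

/-- Words in the `n - 1` letters indexing the simple transpositions of `Fin n`. -/
abbrev Word (n : ℕ) : Type := List (Fin (n - 1))

/-- The product `s_{a_1} ⋯ s_{a_p}` in the symmetric group. -/
def wordProd {n : ℕ} (a : Word n) : Perm (Fin n) :=
  (a.map fun x => simple n x).prod

/-- The length `ℓ(w)`: the least length of an expression of `w` in simple transpositions. -/
noncomputable def len {n : ℕ} (w : Perm (Fin n)) : ℕ :=
  sInf {k | ∃ a : Word n, wordProd a = w ∧ a.length = k}

/-- `𝓡(w)`: the reduced words of the permutation `w`. -/
def reducedWords {n : ℕ} (w : Perm (Fin n)) : Set (Word n) :=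
  {a | wordProd a = w ∧ a.length = len w}

/-- `v ⋖ w` in (strong) Bruhat order: `w = v t_{ij}` and `ℓ(w) = ℓ(v) + 1`. -/
def BruhatCover {n : ℕ} (v w : Perm (Fin n)) : Prop :=
  (∃ i j : Fin n, i ≠ j ∧ w = v * swap i j) ∧ len w = len v + 1

/-- The 0-Hecke product `w ∘ s_a`. -/
noncomputable def heckeRight {n : ℕ} (w : Perm (Fin n)) (a : ℕ) : Perm (Fin n) :=
  if len w < len (w * simple n a) then w * simple n a else w

/-- The 0-Hecke product `s_a ∘ w`. -/
noncomputable def heckeLeft {n : ℕ} (a : ℕ) (w : Perm (Fin n)) : Perm (Fin n) :=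
  if len w < len (simple n a * w) then simple n a * w else w

/-! ### `μ`-involutions -/

/-- The standardization of a word `Q` with distinct entries: the permutation with the same relative
order (`Tuple.sort Q` sends `r` to the position of the `r`-th smallest entry, so its inverse
sends a position to the rank of the entry there). -/
def std {k n : ℕ} (Q : Fin k → Fin n) : Perm (Fin k) :=
  (Tuple.sort Q)⁻¹

theorem std_lt_std_iff {k n : ℕ} {Q : Fin k → Fin n} (hQ : Function.Injective Q) (p q : Fin k) :
    std Q p < std Q q ↔ Q p < Q q := by
  have h : StrictMono (Q ∘ Tuple.sort Q) :=
    (Tuple.monotone_sort Q).strictMono_of_injective (hQ.comp (Tuple.sort Q).injective)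
  have := h.lt_iff_lt (a := std Q p) (b := std Q q)
  simpa [std] using this.symm

/-- The `b`-th block `B_b` of `(π, μ)`, as the word of the values of `π` in the `b`-th interval of
positions cut out by `μ`. -/
def block {n : ℕ} (μ : Composition n) (π : Perm (Fin n)) (b : Fin μ.length) :
    Fin (μ.blocksFun b) → Fin n :=
  fun p => π (μ.embedding b p)

/-- The set `𝓘_μ` of `μ`-involutions: every block standardizes to an involution. -/
def muInvolutions {n : ℕ} (μ : Composition n) : Set (Perm (Fin n)) :=
  {π | ∀ b : Fin μ.length, (std (block μ π b))⁻¹ = std (block μ π b)}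

/-- The number of the block of `(π, μ)` that contains the value `x`. -/
def blockOf {n : ℕ} (μ : Composition n) (π : Perm (Fin n)) (x : Fin n) : Fin μ.length :=
  μ.index (π⁻¹ x)

/-- The permutations `std(B_1), …, std(B_k)` placed side by side on the consecutive intervals of
positions cut out by `μ`, so position `m_b + p` goes to position `m_b + std(B_b)(p)`. -/
def blockStd {n : ℕ} (μ : Composition n) (π : Perm (Fin n)) : Perm (Fin n) :=
  μ.blocksFinEquiv.permCongr (Equiv.sigmaCongrRight fun b => std (block μ π b))

/-- The involution `y_π` whose cycles are the block cycles of the `μ`-involution `π`: within a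
block `B`, the value `B(p)` is exchanged with the value `B(std(B)(p))`. -/
def assocInvolution {n : ℕ} (μ : Composition n) (π : Perm (Fin n)) : Perm (Fin n) :=
  π * blockStd μ π * π⁻¹

/-- The 0-Hecke action `π ∘_μ s_a`.  If the values `a, a+1` lie in different blocks it is `s_a ∘ π`.
If they lie in the same block `B_b` it is `s_a ∘ π ∘ s_c`, where the simple transposition `s_c`
acts on the positions of that block, `c = m_b + r_B(a)` being the relative value of `a` in `B_b`
shifted by the number `m_b` of positions before the block; this is
`std(B) ↦ s_r ∘ std(B) ∘ s_r` with `r = r_B(a)`. -/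
noncomputable def muAct {n : ℕ} (μ : Composition n) (π : Perm (Fin n)) (a : Fin (n - 1)) :
    Perm (Fin n) :=
  let x : Fin n := ⟨a, by omega⟩
  let x' : Fin n := ⟨a + 1, by omega⟩
  if blockOf μ π x = blockOf μ π x' then
    heckeRight (heckeLeft a π) (blockStd μ π (π⁻¹ x))
  else heckeLeft a π

/-- `e ∘_μ s_{a_1} ∘_μ ⋯ ∘_μ s_{a_p}`, computed from left to right; `a` is a `μ`-word for `π` if this
equals `π`. -/
noncomputable def muEval {n : ℕ} (μ : Composition n) (a : Word n) : Perm (Fin n) :=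
  a.foldl (muAct μ) 1

/-- `𝓡_μ(π)`: the reduced `μ`-words for `π`, i.e. those of minimal length. -/
def muReducedWords {n : ℕ} (μ : Composition n) (π : Perm (Fin n)) : Set (Word n) :=
  {a | muEval μ a = π ∧ ∀ b : Word n, muEval μ b = π → a.length ≤ b.length}

/-- The word `a` is `μ`-reduced: it is a reduced `μ`-word for the element it represents. -/
def IsMuReduced {n : ℕ} (μ : Composition n) (a : Word n) : Prop :=
  a ∈ muReducedWords μ (muEval μ a)

/-- `𝓐_μ(π)`: the `μ`-atoms of `π`, the permutations whose reduced words are reduced `μ`-words for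
`π` (so that `𝓡_μ(π)` is the disjoint union of the sets `𝓡(w)` for `w ∈ 𝓐_μ(π)`). -/
def muAtoms {n : ℕ} (μ : Composition n) (π : Perm (Fin n)) : Set (Perm (Fin n)) :=
  {w | reducedWords w ⊆ muReducedWords μ π}

/-- `w` is a `μ`-atom, i.e. a `μ`-atom of some `μ`-involution. -/
def IsMuAtom {n : ℕ} (μ : Composition n) (w : Perm (Fin n)) : Prop :=
  ∃ π ∈ muInvolutions μ, w ∈ muAtoms μ π

/-- `(a, m)` is nearly `μ`-reduced for `τ`: the word `a` is not `μ`-reduced, but deleting its `m`-th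
letter gives a reduced `μ`-word for `τ`. -/
def NearlyMuReduced {n : ℕ} (μ : Composition n) (τ : Perm (Fin n)) (a : Word n)
    (m : Fin a.length) : Prop :=
  ¬ IsMuReduced μ a ∧ a.eraseIdx m ∈ muReducedWords μ τ

end MuInv

/-! The proof rests on a local description of atoms. Cut the word `w⁻¹(0), w⁻¹(1), …` into blocks by
`μ`. Then `w` is a `μ`-atom of `π` exactly when its blocks have the same contents as those of `π`
and, for the cycles `a ≤ b` of `y_π`: a larger letter `b` precedes its partner `a`; no letter of
value between `a` and `b` stands between them; and `a < c`, `b < d` for cycles `(a, b)`, `(c, d)` in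
one block force `a` to precede `d`. These conditions are `Pat` and `Good`, and the description is
`mem_muAtoms`. It is proved by induction on words. Every effective letter of the action joins two
fixed points of `y_π` or conjugates `y_π` by a simple transposition, the conditions survive such a
step (`Good.up`), and a descent of `w` can be undone (`Good.down`). The statistic `rank4`, which
grows by 4 at each effective letter, identifies the reduced `μ`-words.

Part 2 becomes a statement about two cycles. A Bruhat cover of an atom exchanges letters `i < j`
with no intermediate letter standing between them. If `i` and `j` lie in different blocks, each
block merely has one letter replaced, and the result is again an atom. In one block, almost every
relative order of `i, j, y i, y j` yields an atom, possibly of another involution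
(`Good.isMuAtom_or`). The exceptions have `y j < y i` with either `y j < i`, `y i < j` or `i < y j`,
`j < y i`. There an explicit second exchange restores the cycles of `τ` in new positions
(`Good.exists_swap`). It is unique because in the exceptional cover a letter sits inside a cycle
that must not enclose it, and only one exchange repairs this (`unique_pair`, `Good.swap_unique`).
The two exceptional families are mirror images under reversing both values and positions.

Part 1 splits according to whether the word is reduced in the symmetric group. If it is, its product
is a Bruhat cover of an atom without being an atom, and strong exchange translates pairs of letters
into deleted positions, so part 2 applies. If it is not, the claim is the exchange property of
Coxeter groups: exactly two deletions give a reduced word, and both give the same product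
(`existsUnique_eraseIdx`). -/

namespace MuInv
-- Relations between two cycles in the word of an atom
/-- A cycle with letters `a ≤ b` at the positions `x` and `X`, the larger letter first. -/
def Cyc (a b x X : ℕ) : Prop := (a = b ∧ x = X) ∨ (a < b ∧ X < x)

/-- Relations in the word of an atom between the cycles `(a, b)` and `(c, d)`, whose letters are at
the positions `x, X` and `y, Y`. -/
def Half (a b x X c d y Y : ℕ) : Prop :=
  (a < c → b < d → x < Y) ∧ (a < c → c < b → X < y → y < x → False) ∧
  (a < d → d < b → X < Y → Y < x → False)

/-- Two cycles are disjoint and satisfy the relations in both directions. -/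
def Ok (a b x X c d y Y : ℕ) : Prop :=
  Half a b x X c d y Y ∧ Half c d y Y a b x X ∧
  (a ≠ c ∧ a ≠ d ∧ b ≠ c ∧ b ≠ d) ∧ (x ≠ y ∧ x ≠ Y ∧ X ≠ y ∧ X ≠ Y)

theorem Ok.symm {a b x X c d y Y : ℕ} (h : Ok a b x X c d y Y) : Ok c d y Y a b x X := by
  simp only [Ok] at *; tauto

theorem Cyc.refl (a x : ℕ) : Cyc a a x x := Or.inl ⟨rfl, rfl⟩

/-! ### Changing two cycles of the word of an atom

Each lemma changes one or two cycles and gives the relations of the new cycles with a third cycle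
`(c, C)`; its companion `_self` gives the relations among the new cycles.  The hypotheses are uniform
for all cases, so some of them are redundant. -/

section

set_option linter.unusedVariables false
set_option linter.unusedSimpArgs false

variable {i I j J c C r s R T x X I' J' R' T' : ℕ}

/-- Throughout the covers below, `i < j` stand at the positions `r < s` and then trade places.
Capital letters are the partners in the cycles and their positions. The hypotheses `g1` and `g2` are
the cover condition for the third cycle. Here `i = I` and `J = j` are allowed, so joining two fixed
points is a special case. -/
theorem Ok.link (h1 : i ≤ I) (h2 : I < J) (h3 : J ≤ j) (hrs : r < s)
    (k0 : Cyc i I r R) (k1 : Cyc J j T s) (o : Ok i I r R J j T s)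
    (kc : Cyc c C x X) (o0 : Ok i I r R c C x X) (o1 : Ok J j T s c C x X)
    (g1 : i < c → c < j → r < x → x < s → False) (g2 : i < C → C < j → r < X → X < s → False) :
    Ok i j s r c C x X ∧ (i < I → Ok I I R R c C x X) ∧ (J < j → Ok J J T T c C x X) := by
  simp only [Cyc, Half, Ok] at *
  refine ⟨⟨⟨?_, ?_, ?_⟩, ⟨?_, ?_, ?_⟩, ?_, ?_⟩, fun h => ⟨⟨?_, ?_, ?_⟩, ⟨?_, ?_, ?_⟩, ?_, ?_⟩,
      fun h => ⟨⟨?_, ?_, ?_⟩, ⟨?_, ?_, ?_⟩, ?_, ?_⟩⟩ <;> grind (splits := 40)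

theorem Ok.link_self (h1 : i ≤ I) (h2 : I < J) (h3 : J ≤ j) (hrs : r < s)
    (k0 : Cyc i I r R) (k1 : Cyc J j T s) (o : Ok i I r R J j T s) :
    Cyc i j s r ∧ (i < I → Cyc I I R R) ∧ (J < j → Cyc J J T T) ∧ (i < I → Ok i j s r I I R R) ∧
        (J < j → Ok i j s r J J T T) ∧ (i < I → J < j → Ok I I R R J J T T) := by
  simp only [Cyc, Half, Ok] at *
  split_ands <;> grind (splits := 40)

theorem Ok.unlink_right (h1 : I < i) (h2 : i < J) (h3 : J < j) (hrs : r < s)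
    (k0 : Cyc I i R r) (k1 : Cyc J j T s) (o : Ok I i R r J j T s)
    (kc : Cyc c C x X) (o0 : Ok I i R r c C x X) (o1 : Ok J j T s c C x X)
    (g1 : i < c → c < j → r < x → x < s → False) (g2 : i < C → C < j → r < X → X < s → False) :
    Ok I j R r c C x X ∧ Ok i i s s c C x X ∧ Ok J J T T c C x X := by
  simp only [Cyc, Half, Ok] at *
  split_ands <;> grind (splits := 40)

theorem Ok.unlink_right_self (h1 : I < i) (h2 : i < J) (h3 : J < j) (hrs : r < s)
    (k0 : Cyc I i R r) (k1 : Cyc J j T s) (o : Ok I i R r J j T s) :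
    Cyc I j R r ∧ Cyc i i s s ∧ Cyc J J T T ∧ (Ok I j R r i i s s) ∧ (Ok I j R r J J T T) ∧
        (Ok i i s s J J T T) := by
  simp only [Cyc, Half, Ok] at *
  split_ands <;> grind (splits := 40)

theorem Ok.unlink_left (h1 : i < I) (h2 : I < j) (h3 : j < J) (hrs : r < s)
    (k0 : Cyc i I r R) (k1 : Cyc j J s T) (o : Ok i I r R j J s T)
    (kc : Cyc c C x X) (o0 : Ok i I r R c C x X) (o1 : Ok j J s T c C x X)
    (g1 : i < c → c < j → r < x → x < s → False) (g2 : i < C → C < j → r < X → X < s → False) :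
    Ok i J s T c C x X ∧ Ok I I R R c C x X ∧ Ok j j r r c C x X := by
  simp only [Cyc, Half, Ok] at *
  split_ands <;> grind (splits := 40)

theorem Ok.unlink_left_self (h1 : i < I) (h2 : I < j) (h3 : j < J) (hrs : r < s)
    (k0 : Cyc i I r R) (k1 : Cyc j J s T) (o : Ok i I r R j J s T) :
    Cyc i J s T ∧ Cyc I I R R ∧ Cyc j j r r ∧ (Ok i J s T I I R R) ∧ (Ok i J s T j j r r) ∧
        (Ok I I R R j j r r) := by
  simp only [Cyc, Half, Ok] at *
  split_ands <;> grind (splits := 40)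

theorem Ok.relink (h1 : i < J) (h2 : J < I) (h3 : I < j) (hrs : r < s)
    (k0 : Cyc i I r R) (k1 : Cyc J j T s) (o : Ok i I r R J j T s)
    (kc : Cyc c C x X) (o0 : Ok i I r R c C x X) (o1 : Ok J j T s c C x X)
    (g1 : i < c → c < j → r < x → x < s → False) (g2 : i < C → C < j → r < X → X < s → False) :
    Ok i j s r c C x X ∧ Ok J I T R c C x X := by
  simp only [Cyc, Half, Ok] at *
  split_ands <;> grind (splits := 40)

theorem Ok.relink_self (h1 : i < J) (h2 : J < I) (h3 : I < j) (hrs : r < s)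
    (k0 : Cyc i I r R) (k1 : Cyc J j T s) (o : Ok i I r R J j T s) :
    Cyc i j s r ∧ Cyc J I T R ∧ (Ok i j s r J I T R) := by
  simp only [Cyc, Half, Ok] at *
  split_ands <;> grind (splits := 40)

/-- The primed partners account for fixed points: a fixed letter is its own partner and moves along
with it. Two fixed points are excluded by `h4`, since `Ok.link` joins them instead. -/
theorem Ok.conj_far (h1 : I < i ∧ I' = I ∨ I = i ∧ I' = j) (h2 : i < j) (h3 : j < J ∧ J' = J ∨
    j = J ∧ J' = i) (h4 : I < i ∨ j < J) (hrs : r < s)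
    (k0 : Cyc I i R r) (k1 : Cyc j J s T) (o : Ok I i R r j J s T)
    (kc : Cyc c C x X) (o0 : Ok I i R r c C x X) (o1 : Ok j J s T c C x X)
    (g1 : i < c → c < j → r < x → x < s → False) (g2 : i < C → C < j → r < X → X < s → False) :
    Ok I' j R r c C x X ∧ Ok i J' s T c C x X := by
  simp only [Cyc, Half, Ok] at *
  split_ands <;> grind (splits := 40)

theorem Ok.conj_far_self (h1 : I < i ∧ I' = I ∨ I = i ∧ I' = j) (h2 : i < j) (h3 : j < J ∧ J' = J ∨
    j = J ∧ J' = i) (h4 : I < i ∨ j < J) (hrs : r < s)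
    (k0 : Cyc I i R r) (k1 : Cyc j J s T) (o : Ok I i R r j J s T) :
    Cyc I' j R r ∧ Cyc i J' s T ∧ (Ok I' j R r i J' s T) := by
  simp only [Cyc, Half, Ok] at *
  split_ands <;> grind (splits := 40)

theorem Ok.conj_low (h1 : I < J) (h2 : J < i) (h3 : i < j) (hrs : r < s)
    (k0 : Cyc I i R r) (k1 : Cyc J j T s) (o : Ok I i R r J j T s)
    (kc : Cyc c C x X) (o0 : Ok I i R r c C x X) (o1 : Ok J j T s c C x X)
    (g1 : i < c → c < j → r < x → x < s → False) (g2 : i < C → C < j → r < X → X < s → False) :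
    Ok I j R r c C x X ∧ Ok J i T s c C x X := by
  simp only [Cyc, Half, Ok] at *
  split_ands <;> grind (splits := 40)

theorem Ok.conj_low_self (h1 : I < J) (h2 : J < i) (h3 : i < j) (hrs : r < s)
    (k0 : Cyc I i R r) (k1 : Cyc J j T s) (o : Ok I i R r J j T s) :
    Cyc I j R r ∧ Cyc J i T s ∧ (Ok I j R r J i T s) := by
  simp only [Cyc, Half, Ok] at *
  split_ands <;> grind (splits := 40)

theorem Ok.conj_high (h1 : i < j) (h2 : j < I) (h3 : I < J) (hrs : r < s)
    (k0 : Cyc i I r R) (k1 : Cyc j J s T) (o : Ok i I r R j J s T)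
    (kc : Cyc c C x X) (o0 : Ok i I r R c C x X) (o1 : Ok j J s T c C x X)
    (g1 : i < c → c < j → r < x → x < s → False) (g2 : i < C → C < j → r < X → X < s → False) :
    Ok j I r R c C x X ∧ Ok i J s T c C x X := by
  simp only [Cyc, Half, Ok] at *
  split_ands <;> grind (splits := 40)

theorem Ok.conj_high_self (h1 : i < j) (h2 : j < I) (h3 : I < J) (hrs : r < s)
    (k0 : Cyc i I r R) (k1 : Cyc j J s T) (o : Ok i I r R j J s T) :
    Cyc j I r R ∧ Cyc i J s T ∧ (Ok j I r R i J s T) := by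
  simp only [Cyc, Half, Ok] at *
  split_ands <;> grind (splits := 40)

/-- The exchange of `i` and `j` alone would leave `i` between `j` and its partner `J`, although `J <
i < j`. Moving `i` on to the position of `J` repairs this and keeps both cycles of letters, in
rotated positions. -/
theorem Ok.rotate_inner (h1 : J < i) (h2 : i < I ∧ R' = R ∨ i = I ∧ R' = T) (h3 : I < j)
    (hrs : r < s)
    (k0 : Cyc i I r R) (k1 : Cyc J j T s) (o : Ok i I r R J j T s)
    (kc : Cyc c C x X) (o0 : Ok i I r R c C x X) (o1 : Ok J j T s c C x X)
    (g1 : i < c → c < j → r < x → x < s → False) (g2 : i < C → C < j → r < X → X < s → False) :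
    Ok J j s r c C x X ∧ Ok i I T R' c C x X := by
  simp only [Cyc, Half, Ok] at *
  split_ands <;> grind (splits := 40)

theorem Ok.rotate_inner_self (h1 : J < i) (h2 : i < I ∧ R' = R ∨ i = I ∧ R' = T) (h3 : I < j)
    (hrs : r < s)
    (k0 : Cyc i I r R) (k1 : Cyc J j T s) (o : Ok i I r R J j T s) :
    Cyc J j s r ∧ Cyc i I T R' ∧ (Ok J j s r i I T R') := by
  simp only [Cyc, Half, Ok] at *
  split_ands <;> grind (splits := 40)

theorem Ok.rotate_below (h1 : J < I) (h2 : I < i) (h3 : i < j) (h4 : T < R) (hrs : r < s)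
    (k0 : Cyc I i R r) (k1 : Cyc J j T s) (o : Ok I i R r J j T s)
    (kc : Cyc c C x X) (o0 : Ok I i R r c C x X) (o1 : Ok J j T s c C x X)
    (g1 : i < c → c < j → r < x → x < s → False) (g2 : i < C → C < j → r < X → X < s → False) :
    Ok J j s r c C x X ∧ Ok I i R T c C x X := by
  simp only [Cyc, Half, Ok] at *
  split_ands <;> grind (splits := 40)

theorem Ok.rotate_below_self (h1 : J < I) (h2 : I < i) (h3 : i < j) (h4 : T < R) (hrs : r < s)
    (k0 : Cyc I i R r) (k1 : Cyc J j T s) (o : Ok I i R r J j T s) :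
    Cyc J j s r ∧ Cyc I i R T ∧ (Ok J j s r I i R T) := by
  simp only [Cyc, Half, Ok] at *
  split_ands <;> grind (splits := 40)

/-- With `R < T` the rotation would put `I` before the larger letter `i` of its cycle. Instead the
two cycles trade places as a whole. -/
theorem Ok.exchange_below (h1 : J < I) (h2 : I < i) (h3 : i < j) (h4 : R < T) (hrs : r < s)
    (k0 : Cyc I i R r) (k1 : Cyc J j T s) (o : Ok I i R r J j T s)
    (kc : Cyc c C x X) (o0 : Ok I i R r c C x X) (o1 : Ok J j T s c C x X)
    (g1 : i < c → c < j → r < x → x < s → False) (g2 : i < C → C < j → r < X → X < s → False) :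
    Ok J j R r c C x X ∧ Ok I i T s c C x X := by
  simp only [Cyc, Half, Ok] at *
  split_ands <;> grind (splits := 40)

theorem Ok.exchange_below_self (h1 : J < I) (h2 : I < i) (h3 : i < j) (h4 : R < T) (hrs : r < s)
    (k0 : Cyc I i R r) (k1 : Cyc J j T s) (o : Ok I i R r J j T s) :
    Cyc J j R r ∧ Cyc I i T s ∧ (Ok J j R r I i T s) := by
  simp only [Cyc, Half, Ok] at *
  split_ands <;> grind (splits := 40)

theorem Ok.rotate_outer (h1 : i < J) (h2 : J < j ∧ T' = T ∨ J = j ∧ T' = R) (h3 : j < I)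
    (hrs : r < s)
    (k0 : Cyc i I r R) (k1 : Cyc J j T s) (o : Ok i I r R J j T s)
    (kc : Cyc c C x X) (o0 : Ok i I r R c C x X) (o1 : Ok J j T s c C x X)
    (g1 : i < c → c < j → r < x → x < s → False) (g2 : i < C → C < j → r < X → X < s → False) :
    Ok i I s r c C x X ∧ Ok J j T' R c C x X := by
  simp only [Cyc, Half, Ok] at *
  split_ands <;> grind (splits := 40)

theorem Ok.rotate_outer_self (h1 : i < J) (h2 : J < j ∧ T' = T ∨ J = j ∧ T' = R) (h3 : j < I)
    (hrs : r < s)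
    (k0 : Cyc i I r R) (k1 : Cyc J j T s) (o : Ok i I r R J j T s) :
    Cyc i I s r ∧ Cyc J j T' R ∧ (Ok i I s r J j T' R) := by
  simp only [Cyc, Half, Ok] at *
  split_ands <;> grind (splits := 40)

theorem Ok.rotate_above (h1 : i < j) (h2 : j < J) (h3 : J < I) (h4 : T < R) (hrs : r < s)
    (k0 : Cyc i I r R) (k1 : Cyc j J s T) (o : Ok i I r R j J s T)
    (kc : Cyc c C x X) (o0 : Ok i I r R c C x X) (o1 : Ok j J s T c C x X)
    (g1 : i < c → c < j → r < x → x < s → False) (g2 : i < C → C < j → r < X → X < s → False) :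
    Ok i I s r c C x X ∧ Ok j J R T c C x X := by
  simp only [Cyc, Half, Ok] at *
  split_ands <;> grind (splits := 40)

theorem Ok.rotate_above_self (h1 : i < j) (h2 : j < J) (h3 : J < I) (h4 : T < R) (hrs : r < s)
    (k0 : Cyc i I r R) (k1 : Cyc j J s T) (o : Ok i I r R j J s T) :
    Cyc i I s r ∧ Cyc j J R T ∧ (Ok i I s r j J R T) := by
  simp only [Cyc, Half, Ok] at *
  split_ands <;> grind (splits := 40)

theorem Ok.exchange_above (h1 : i < j) (h2 : j < J) (h3 : J < I) (h4 : R < T) (hrs : r < s)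
    (k0 : Cyc i I r R) (k1 : Cyc j J s T) (o : Ok i I r R j J s T)
    (kc : Cyc c C x X) (o0 : Ok i I r R c C x X) (o1 : Ok j J s T c C x X)
    (g1 : i < c → c < j → r < x → x < s → False) (g2 : i < C → C < j → r < X → X < s → False) :
    Ok j J r R c C x X ∧ Ok i I s T c C x X := by
  simp only [Cyc, Half, Ok] at *
  split_ands <;> grind (splits := 40)

theorem Ok.exchange_above_self (h1 : i < j) (h2 : j < J) (h3 : J < I) (h4 : R < T) (hrs : r < s)
    (k0 : Cyc i I r R) (k1 : Cyc j J s T) (o : Ok i I r R j J s T) :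
    Cyc j J r R ∧ Cyc i I s T ∧ (Ok j J r R i I s T) := by
  simp only [Cyc, Half, Ok] at *
  split_ands <;> grind (splits := 40)

/-- From here the larger letter `j` stands first, and no letter of the block has a value between `i`
and `j`. These are the inverse steps of the action. -/
theorem Ok.descend_unlink (h : i < j) (hrs : r < s)
    (k0 : Cyc i j s r)
    (kc : Cyc c C x X) (o0 : Ok i j s r c C x X)
    (g1 : i < c → c < j → False) (g2 : i < C → C < j → False) :
    Ok i i r r c C x X ∧ Ok j j s s c C x X := by
  simp only [Cyc, Half, Ok] at *
  split_ands <;> grind (splits := 40)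

theorem Ok.descend_unlink_self (h : i < j) (hrs : r < s)
    (k0 : Cyc i j s r) :
    Cyc i i r r ∧ Cyc j j s s ∧ (Ok i i r r j j s s) := by
  simp only [Cyc, Half, Ok] at *
  split_ands <;> grind (splits := 40)

theorem Ok.descend_conj_far (h1 : J < j ∧ J' = J ∨ J = j ∧ J' = i) (h2 : i < j)
    (h3 : i < I ∧ I' = I ∨ i = I ∧ I' = j) (h4 : J < j ∨ i < I) (h5 : J ≤ i ∨ J = j)
    (h6 : j ≤ I ∨ i = I) (hrs : r < s)
    (k0 : Cyc J j R r) (k1 : Cyc i I s T) (o : Ok J j R r i I s T)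
    (kc : Cyc c C x X) (o0 : Ok J j R r c C x X) (o1 : Ok i I s T c C x X)
    (g1 : i < c → c < j → False) (g2 : i < C → C < j → False) :
    Ok J' i R r c C x X ∧ Ok j I' s T c C x X := by
  simp only [Cyc, Half, Ok] at *
  split_ands <;> grind (splits := 40)

theorem Ok.descend_conj_far_self (h1 : J < j ∧ J' = J ∨ J = j ∧ J' = i) (h2 : i < j)
    (h3 : i < I ∧ I' = I ∨ i = I ∧ I' = j) (h4 : J < j ∨ i < I) (h5 : J ≤ i ∨ J = j)
    (h6 : j ≤ I ∨ i = I) (hrs : r < s)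
    (k0 : Cyc J j R r) (k1 : Cyc i I s T) (o : Ok J j R r i I s T) :
    Cyc J' i R r ∧ Cyc j I' s T ∧ (Ok J' i R r j I' s T) := by
  simp only [Cyc, Half, Ok] at *
  split_ands <;> grind (splits := 40)

theorem Ok.descend_conj_low (h1 : J < I) (h2 : I < i) (h3 : i < j) (hrs : r < s)
    (k0 : Cyc J j R r) (k1 : Cyc I i T s) (o : Ok J j R r I i T s)
    (kc : Cyc c C x X) (o0 : Ok J j R r c C x X) (o1 : Ok I i T s c C x X)
    (g1 : i < c → c < j → False) (g2 : i < C → C < j → False) :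
    Ok J i R r c C x X ∧ Ok I j T s c C x X := by
  simp only [Cyc, Half, Ok] at *
  split_ands <;> grind (splits := 40)

theorem Ok.descend_conj_low_self (h1 : J < I) (h2 : I < i) (h3 : i < j) (hrs : r < s)
    (k0 : Cyc J j R r) (k1 : Cyc I i T s) (o : Ok J j R r I i T s) :
    Cyc J i R r ∧ Cyc I j T s ∧ (Ok J i R r I j T s) := by
  simp only [Cyc, Half, Ok] at *
  split_ands <;> grind (splits := 40)

theorem Ok.descend_conj_high (h1 : i < j) (h2 : j < J) (h3 : J < I) (hrs : r < s)
    (k0 : Cyc j J r R) (k1 : Cyc i I s T) (o : Ok j J r R i I s T)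
    (kc : Cyc c C x X) (o0 : Ok j J r R c C x X) (o1 : Ok i I s T c C x X)
    (g1 : i < c → c < j → False) (g2 : i < C → C < j → False) :
    Ok i J r R c C x X ∧ Ok j I s T c C x X := by
  simp only [Cyc, Half, Ok] at *
  split_ands <;> grind (splits := 40)

theorem Ok.descend_conj_high_self (h1 : i < j) (h2 : j < J) (h3 : J < I) (hrs : r < s)
    (k0 : Cyc j J r R) (k1 : Cyc i I s T) (o : Ok j J r R i I s T) :
    Cyc i J r R ∧ Cyc j I s T ∧ (Ok i J r R j I s T) := by
  simp only [Cyc, Half, Ok] at *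
  split_ands <;> grind (splits := 40)

/-- In a cover between two blocks, each block only has one of its letters replaced by a letter new
to it. This is the case in which the raised letter passes its partner and the cycle falls apart into
two fixed points. -/
theorem Ok.raise_split (h1 : i < I) (h2 : I < j)
    (k0 : Cyc i I r R)
    (kc : Cyc c C x X) (o0 : Ok i I r R c C x X)
    (g1 : i < c → c < j → r < x → False) (g2 : i < C → C < j → r < X → False) (n1 : j ≠ c)
    (n2 : j ≠ C) :
    Ok I I R R c C x X ∧ Ok j j r r c C x X := by
  simp only [Cyc, Half, Ok] at *
  split_ands <;> grind (splits := 40)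

theorem Ok.raise_split_self (h1 : i < I) (h2 : I < j)
    (k0 : Cyc i I r R) :
    Cyc I I R R ∧ Cyc j j r r ∧ (Ok I I R R j j r r) := by
  simp only [Cyc, Half, Ok] at *
  split_ands <;> grind (splits := 40)

theorem Ok.raise_left (h1 : i < j) (h2 : j < I)
    (k0 : Cyc i I r R)
    (kc : Cyc c C x X) (o0 : Ok i I r R c C x X)
    (g1 : i < c → c < j → r < x → False) (g2 : i < C → C < j → r < X → False) (n1 : j ≠ c)
    (n2 : j ≠ C) :
    Ok j I r R c C x X := by
  simp only [Cyc, Half, Ok] at *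
  split_ands <;> grind (splits := 40)

theorem Ok.raise_left_self (h1 : i < j) (h2 : j < I)
    (k0 : Cyc i I r R) :
    Cyc j I r R := by
  simp only [Cyc, Half, Ok] at *
  grind (splits := 40)

theorem Ok.raise_right (h1 : I < i ∧ I' = I ∨ I = i ∧ I' = j) (h2 : i < j)
    (k0 : Cyc I i R r)
    (kc : Cyc c C x X) (o0 : Ok I i R r c C x X)
    (g1 : i < c → c < j → r < x → False) (g2 : i < C → C < j → r < X → False) (n1 : j ≠ c)
    (n2 : j ≠ C) :
    Ok I' j R r c C x X := by
  simp only [Cyc, Half, Ok] at *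
  split_ands <;> grind (splits := 40)

theorem Ok.raise_right_self (h1 : I < i ∧ I' = I ∨ I = i ∧ I' = j) (h2 : i < j)
    (k0 : Cyc I i R r) :
    Cyc I' j R r := by
  simp only [Cyc, Half, Ok] at *
  grind (splits := 40)

theorem Ok.lower_split (h1 : i < J) (h2 : J < j)
    (k0 : Cyc J j R r)
    (kc : Cyc c C x X) (o0 : Ok J j R r c C x X)
    (g1 : i < c → c < j → x < r → False) (g2 : i < C → C < j → X < r → False) (n1 : i ≠ c)
    (n2 : i ≠ C) :
    Ok J J R R c C x X ∧ Ok i i r r c C x X := by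
  simp only [Cyc, Half, Ok] at *
  split_ands <;> grind (splits := 40)

theorem Ok.lower_split_self (h1 : i < J) (h2 : J < j)
    (k0 : Cyc J j R r) :
    Cyc J J R R ∧ Cyc i i r r ∧ (Ok J J R R i i r r) := by
  simp only [Cyc, Half, Ok] at *
  split_ands <;> grind (splits := 40)

theorem Ok.lower_right (h1 : i < j) (h2 : J < i)
    (k0 : Cyc J j R r)
    (kc : Cyc c C x X) (o0 : Ok J j R r c C x X)
    (g1 : i < c → c < j → x < r → False) (g2 : i < C → C < j → X < r → False) (n1 : i ≠ c)
    (n2 : i ≠ C) :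
    Ok J i R r c C x X := by
  simp only [Cyc, Half, Ok] at *
  split_ands <;> grind (splits := 40)

theorem Ok.lower_right_self (h1 : i < j) (h2 : J < i)
    (k0 : Cyc J j R r) :
    Cyc J i R r := by
  simp only [Cyc, Half, Ok] at *
  grind (splits := 40)

theorem Ok.lower_left (h1 : j < J ∧ J' = J ∨ j = J ∧ J' = i) (h2 : i < j)
    (k0 : Cyc j J r R)
    (kc : Cyc c C x X) (o0 : Ok j J r R c C x X)
    (g1 : i < c → c < j → x < r → False) (g2 : i < C → C < j → X < r → False) (n1 : i ≠ c)
    (n2 : i ≠ C) :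
    Ok i J' r R c C x X := by
  simp only [Cyc, Half, Ok] at *
  split_ands <;> grind (splits := 40)

theorem Ok.lower_left_self (h1 : j < J ∧ J' = J ∨ j = J ∧ J' = i) (h2 : i < j)
    (k0 : Cyc j J r R) :
    Cyc i J' r R := by
  simp only [Cyc, Half, Ok] at *
  grind (splits := 40)

end

end MuInv

/-! ### Patterns: an involution on positions, cut into blocks -/

namespace MuInv
/-- Reading the letters `u p` at the positions `p`, cut into blocks by `idx`, gives in every block
the word of an atom of the involution of the letters that `η` induces on positions. -/
structure Pat {n : ℕ} {κ : Type*} (idx : Fin n → κ) (η : Fin n → Fin n) (u : Fin n → ℕ) : Prop where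
  inv : ∀ p, η (η p) = p
  blk : ∀ p, idx (η p) = idx p
  -- The condition `u p ≤ u (η p)` selects the position of the smaller letter, so each cycle is
  -- listed once.
  cyc : ∀ p, u p ≤ u (η p) → Cyc (u p) (u (η p)) p (η p)
  ok : ∀ p q, idx p = idx q → u p ≤ u (η p) → u q ≤ u (η q) → p ≠ q →
    Ok (u p) (u (η p)) p (η p) (u q) (u (η q)) q (η q)

namespace Pat
variable {n : ℕ} {κ : Type*} {idx : Fin n → κ} {η : Fin n → Fin n} {u : Fin n → ℕ} {p q r s : Fin n}

/-- The letters `l` and `u` in the names say whether a position holds the lower or the upper letter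
of its cycle. -/
theorem cyc_u (h : Pat idx η u) (hp : u (η p) ≤ u p) : Cyc (u (η p)) (u p) (η p) p := by
  have := h.cyc (η p); rw [h.inv] at this; exact this hp

theorem ok_lu (h : Pat idx η u) (hb : idx p = idx q) (hp : u p ≤ u (η p)) (hq : u (η q) ≤ u q)
    (hpq : p ≠ η q) :
    Ok (u p) (u (η p)) p (η p) (u (η q)) (u q) (η q) q := by
  have := h.ok p (η q); rw [h.inv, h.blk] at this; exact this hb hp hq hpq

theorem ok_ul (h : Pat idx η u) (hb : idx p = idx q) (hp : u (η p) ≤ u p) (hq : u q ≤ u (η q))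
    (hpq : η p ≠ q) :
    Ok (u (η p)) (u p) (η p) p (u q) (u (η q)) q (η q) := by
  have := h.ok (η p) q; rw [h.inv, h.blk] at this; exact this hb hp hq hpq

theorem ok_uu (h : Pat idx η u) (hb : idx p = idx q) (hp : u (η p) ≤ u p) (hq : u (η q) ≤ u q)
    (hpq : p ≠ q) :
    Ok (u (η p)) (u p) (η p) p (u (η q)) (u q) (η q) q := by
  have := h.ok (η p) (η q); simp only [h.inv, h.blk] at this
  exact this hb hp hq (fun e => hpq (by rw [← h.inv p, e, h.inv]))

/-- A change that is confined to the cycles of `r` and `s` leaves all relations among the other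
cycles intact. What has to be checked is that the new cycles are compatible with each other (`hss`,
in either order, as `Ok` is symmetric) and with each untouched cycle (`hso`). -/
theorem glue (h : Pat idx η u) (hb : idx r = idx s) {η' : Fin n → Fin n} {u' : Fin n → ℕ}
    (hη : ∀ p, p ≠ r → p ≠ s → p ≠ η r → p ≠ η s → η' p = η p)
    (hu : ∀ p, p ≠ r → p ≠ s → p ≠ η r → p ≠ η s → u' p = u p)
    (hinv : ∀ p, p = r ∨ p = s ∨ p = η r ∨ p = η s → η' (η' p) = p ∧ (η' p = r ∨ η' p = s ∨
    η' p = η r ∨ η' p = η s))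
    (hcyc : ∀ p, p = r ∨ p = s ∨ p = η r ∨ p = η s → u' p ≤ u' (η' p) → Cyc (u' p)
    (u' (η' p)) p (η' p))
    (hss : ∀ p q, p = r ∨ p = s ∨ p = η r ∨ p = η s → q = r ∨ q = s ∨ q = η r ∨ q = η s →
      u' p ≤ u' (η' p) → u' q ≤ u' (η' q) → p ≠ q →
      Ok (u' p) (u' (η' p)) p (η' p) (u' q) (u' (η' q)) q (η' q) ∨ Ok (u' q) (u' (η' q)) q (η' q)
          (u' p) (u' (η' p)) p (η' p))
    (hso : ∀ c, idx c = idx r → c ≠ r → c ≠ s → c ≠ η r → c ≠ η s → η c ≠ r → η c ≠ s →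
    u c ≤ u (η c) →
      ∀ p, p = r ∨ p = s ∨ p = η r ∨ p = η s → u' p ≤ u' (η' p) →
      Ok (u' p) (u' (η' p)) p (η' p) (u c) (u (η c)) c (η c)) : Pat idx η' u' := by
  -- The complement of the four positions is stable under `η` because `η` is an involution.
  have hno : ∀ p, ¬ (p = r ∨ p = s ∨ p = η r ∨ p = η s) → η' p = η p ∧ u' p = u p ∧
      u' (η p) = u (η p) ∧
      η p ≠ r ∧ η p ≠ s ∧ p ≠ r ∧ p ≠ s ∧ p ≠ η r ∧ p ≠ η s := by
    intro p hp
    push Not at hp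
    have := h.inv p
    have e1 : η p ≠ r := by grind
    have e2 : η p ≠ s := by grind
    have e3 : η p ≠ η r := by intro e; apply hp.1; rw [← h.inv p, e, h.inv]
    have e4 : η p ≠ η s := by intro e; apply hp.2.1; rw [← h.inv p, e, h.inv]
    refine ⟨hη _ hp.1 hp.2.1 hp.2.2.1 hp.2.2.2, hu _ hp.1 hp.2.1 hp.2.2.1 hp.2.2.2,
        hu _ e1 e2 e3 e4, e1, e2, hp⟩
  have hS : ∀ p, (p = r ∨ p = s ∨ p = η r ∨ p = η s) → idx p = idx r := by
    rintro p (e | e | e | e) <;> rw [e] <;> simp [h.blk, hb]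
  constructor
  · intro p
    by_cases hp : p = r ∨ p = s ∨ p = η r ∨ p = η s
    · exact (hinv p hp).1
    · obtain ⟨e, -, -, e1, e2, h1, h2, h3, h4⟩ := hno p hp
      rw [e, hη _ e1 e2 (by rintro e; exact h1 (by rw [← h.inv p, e, h.inv]))
          (by rintro e; exact h2 (by rw [← h.inv p, e, h.inv])), h.inv]
  · intro p
    by_cases hp : p = r ∨ p = s ∨ p = η r ∨ p = η s
    · rw [hS _ hp, hS _ (hinv p hp).2]
    · rw [(hno p hp).1, h.blk]
  · intro p
    by_cases hp : p = r ∨ p = s ∨ p = η r ∨ p = η s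
    · exact hcyc p hp
    · obtain ⟨e, e', e'', -⟩ := hno p hp
      rw [e, e', e'']; exact h.cyc p
  · intro p q hpq hp' hq' hne
    by_cases hp : p = r ∨ p = s ∨ p = η r ∨ p = η s <;> by_cases hq : q = r ∨ q = s ∨ q = η r ∨
        q = η s
    · exact (hss p q hp hq hp' hq' hne).elim id Ok.symm
    · obtain ⟨e, e', e'', e1, e2, h1, h2, h3, h4⟩ := hno q hq
      rw [e, e', e''] at hq' ⊢
      exact hso q (hpq ▸ hS p hp) h1 h2 h3 h4 e1 e2 hq' p hp hp'
    · obtain ⟨e, e', e'', e1, e2, h1, h2, h3, h4⟩ := hno p hp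
      rw [e, e', e''] at hp' ⊢
      exact (hso p (hpq ▸ hS q hq) h1 h2 h3 h4 e1 e2 hp' q hq hq').symm
    · obtain ⟨e, e', e'', -⟩ := hno p hp
      obtain ⟨f, f', f'', -⟩ := hno q hq
      rw [e, e', e''] at hp' ⊢
      rw [f, f', f''] at hq' ⊢
      exact h.ok p q hpq hp' hq' hne

end Pat
end MuInv

/-! ### Exchanging two letters of one block along a Bruhat cover -/

namespace MuInv
namespace Pat
variable {n : ℕ} {κ : Type*} {idx : Fin n → κ} {η : Fin n → Fin n} {u : Fin n → ℕ} {p q r s : Fin n}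

/-- The conditions on the partners carry `η r ≠ r` and `η s ≠ s` because a fixed position is itself
one of the two that change. The values of `η'` are recorded since `Good.up` has to recognize this
involution as the one produced by the action. -/
theorem swap_link (h : Pat idx η u) (hb : idx r = idx s) (hrs : r < s) {u' : Fin n → ℕ}
    (hu : ∀ p, p ≠ r → p ≠ s → p ≠ η r → p ≠ η s → u' p = u p)
    (hr : u' r = u s) (hs : u' s = u r) (hR' : η r ≠ r → u' (η r) = u (η r))
    (hT' : η s ≠ s → u' (η s) = u (η s))
    (hc : ∀ t, idx t = idx r → u r < u t → u t < u s → r < t → t < s → False)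
    (h1 : u r ≤ u (η r)) (h2 : u (η r) < u (η s)) (h3 : u (η s) ≤ u s) : ∃ η', Pat idx η' u' ∧
    η' r = s ∧ η' s = r ∧ ∀ p, p ≠ r → p ≠ s → p ≠ η r → p ≠ η s → η' p = η p := by
  have hl1 : u r ≤ u (η r) := by lia
  have hl2 : u (η s) ≤ u s := by lia
  have hn := h.inv
  have o := h.ok_lu hb hl1 hl2 (by grind)
  have k0 := h.cyc r hl1
  have k1 := h.cyc_u hl2
  have hrs' : (r : ℕ) < s := hrs
  have hR : η r ≠ s := by rintro e; simp [Ok, e] at o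
  have hT : η s ≠ r := by rintro e; simp [Ok, e] at o
  have hRT : η r ≠ η s := by rintro e; simp [Ok, e] at o
  have hI : η r ≠ r → u r < u (η r) := by simp only [Cyc] at k0; grind
  have hJ : η s ≠ s → u (η s) < u s := by simp only [Cyc] at k1; grind
  let η' : Fin n → Fin n := fun t => if t = r then s else if t = s then r else if t = η r ∨
      t = η s then t else η t
  have e0 : η' r = s := by grind
  have e1 : η' s = r := by grind
  have e2 : η r ≠ r → η' (η r) = η r := by grind
  have e3 : η s ≠ s → η' (η s) = η s := by grind
  have hη : ∀ p, p ≠ r → p ≠ s → p ≠ η r → p ≠ η s → η' p = η p := by grind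
  clear_value η'
  have b := Ok.link_self h1 h2 h3 hrs' k0 k1 o
  refine ⟨η', h.glue hb hη hu ?_ ?_ ?_ ?_, ?_⟩
  · rintro p (hp | hp | hp | hp) <;> clear hc b k0 k1 o <;> grind
  · rintro p (hp | hp | hp | hp) hl <;> clear hc <;> grind [Cyc.refl]
  · rintro p q (hp | hp | hp | hp) (hq | hq | hq | hq) hpl hql hpq <;> clear hc <;> grind
  · intro c hcb n1 n2 n3 n4 n5 n6 hcl p hp hpl
    have b := Ok.link h1 h2 h3 hrs' k0 k1 o (h.cyc c hcl) (h.ok _ _ hcb.symm hl1 hcl n1.symm)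
        (h.ok_ul (hb ▸ hcb.symm) hl2 hcl n4.symm)
      (hc _ hcb) (hc _ ((h.blk c).trans hcb))
    clear hc
    rcases hp with hp | hp | hp | hp <;> grind
  · clear hc b k0 k1 o
    grind

theorem swap_unlink_right (h : Pat idx η u) (hb : idx r = idx s) (hrs : r < s) {u' : Fin n → ℕ}
    (hu : ∀ p, p ≠ r → p ≠ s → p ≠ η r → p ≠ η s → u' p = u p)
    (hr : u' r = u s) (hs : u' s = u r) (hR' : η r ≠ r → u' (η r) = u (η r))
    (hT' : η s ≠ s → u' (η s) = u (η s))
    (hc : ∀ t, idx t = idx r → u r < u t → u t < u s → r < t → t < s → False)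
    (h1 : u (η r) < u r) (h2 : u r < u (η s)) (h3 : u (η s) < u s) : ∃ η', Pat idx η' u' := by
  have hl1 : u (η r) ≤ u r := by lia
  have hl2 : u (η s) ≤ u s := by lia
  have hn := h.inv
  have o := h.ok_uu hb hl1 hl2 (by grind)
  have k0 := h.cyc_u hl1
  have k1 := h.cyc_u hl2
  have hrs' : (r : ℕ) < s := hrs
  have hR : η r ≠ s := by rintro e; simp [Ok, e] at o
  have hT : η s ≠ r := by rintro e; simp [Ok, e] at o
  have hRT : η r ≠ η s := by rintro e; simp [Ok, e] at o
  have hI : η r ≠ r := by simp only [Cyc] at k0; grind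
  have hJ : η s ≠ s := by simp only [Cyc] at k1; grind
  let η' : Fin n → Fin n := fun t => if t = s ∨ t = η s then t else η t
  have e0 : η' s = s := by grind
  have e1 : η' r = η r := by grind
  have e2 : η' (η r) = r := by grind
  have e3 : η' (η s) = η s := by grind
  have hη : ∀ p, p ≠ r → p ≠ s → p ≠ η r → p ≠ η s → η' p = η p := by grind
  clear_value η'
  have b := Ok.unlink_right_self h1 h2 h3 hrs' k0 k1 o
  refine ⟨η', h.glue hb hη hu ?_ ?_ ?_ ?_⟩
  · rintro p (hp | hp | hp | hp) <;> clear hc b k0 k1 o <;> grind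
  · rintro p (hp | hp | hp | hp) hl <;> clear hc <;> grind [Cyc.refl]
  · rintro p q (hp | hp | hp | hp) (hq | hq | hq | hq) hpl hql hpq <;> clear hc <;> grind
  · intro c hcb n1 n2 n3 n4 n5 n6 hcl p hp hpl
    have b := Ok.unlink_right h1 h2 h3 hrs' k0 k1 o (h.cyc c hcl)
        (h.ok_ul hcb.symm hl1 hcl n3.symm) (h.ok_ul (hb ▸ hcb.symm) hl2 hcl n4.symm)
      (hc _ hcb) (hc _ ((h.blk c).trans hcb))
    clear hc
    rcases hp with hp | hp | hp | hp <;> grind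

theorem swap_unlink_left (h : Pat idx η u) (hb : idx r = idx s) (hrs : r < s) {u' : Fin n → ℕ}
    (hu : ∀ p, p ≠ r → p ≠ s → p ≠ η r → p ≠ η s → u' p = u p)
    (hr : u' r = u s) (hs : u' s = u r) (hR' : η r ≠ r → u' (η r) = u (η r))
    (hT' : η s ≠ s → u' (η s) = u (η s))
    (hc : ∀ t, idx t = idx r → u r < u t → u t < u s → r < t → t < s → False)
    (h1 : u r < u (η r)) (h2 : u (η r) < u s) (h3 : u s < u (η s)) : ∃ η', Pat idx η' u' := by
  have hl1 : u r ≤ u (η r) := by lia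
  have hl2 : u s ≤ u (η s) := by lia
  have hn := h.inv
  have o := h.ok r s hb hl1 hl2 (by grind)
  have k0 := h.cyc r hl1
  have k1 := h.cyc s hl2
  have hrs' : (r : ℕ) < s := hrs
  have hR : η r ≠ s := by rintro e; simp [Ok, e] at o
  have hT : η s ≠ r := by rintro e; simp [Ok, e] at o
  have hRT : η r ≠ η s := by rintro e; simp [Ok, e] at o
  have hI : η r ≠ r := by simp only [Cyc] at k0; grind
  have hJ : η s ≠ s := by simp only [Cyc] at k1; grind
  let η' : Fin n → Fin n := fun t => if t = r ∨ t = η r then t else η t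
  have e0 : η' r = r := by grind
  have e1 : η' s = η s := by grind
  have e2 : η' (η s) = s := by grind
  have e3 : η' (η r) = η r := by grind
  have hη : ∀ p, p ≠ r → p ≠ s → p ≠ η r → p ≠ η s → η' p = η p := by grind
  clear_value η'
  have b := Ok.unlink_left_self h1 h2 h3 hrs' k0 k1 o
  refine ⟨η', h.glue hb hη hu ?_ ?_ ?_ ?_⟩
  · rintro p (hp | hp | hp | hp) <;> clear hc b k0 k1 o <;> grind
  · rintro p (hp | hp | hp | hp) hl <;> clear hc <;> grind [Cyc.refl]
  · rintro p q (hp | hp | hp | hp) (hq | hq | hq | hq) hpl hql hpq <;> clear hc <;> grind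
  · intro c hcb n1 n2 n3 n4 n5 n6 hcl p hp hpl
    have b := Ok.unlink_left h1 h2 h3 hrs' k0 k1 o (h.cyc c hcl)
        (h.ok _ _ hcb.symm hl1 hcl n1.symm) (h.ok _ _ (hb ▸ hcb.symm) hl2 hcl n2.symm)
      (hc _ hcb) (hc _ ((h.blk c).trans hcb))
    clear hc
    rcases hp with hp | hp | hp | hp <;> grind

theorem swap_relink (h : Pat idx η u) (hb : idx r = idx s) (hrs : r < s) {u' : Fin n → ℕ}
    (hu : ∀ p, p ≠ r → p ≠ s → p ≠ η r → p ≠ η s → u' p = u p)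
    (hr : u' r = u s) (hs : u' s = u r) (hR' : η r ≠ r → u' (η r) = u (η r))
    (hT' : η s ≠ s → u' (η s) = u (η s))
    (hc : ∀ t, idx t = idx r → u r < u t → u t < u s → r < t → t < s → False)
    (h1 : u r < u (η s)) (h2 : u (η s) < u (η r)) (h3 : u (η r) < u s) : ∃ η', Pat idx η' u' := by
  have hl1 : u r ≤ u (η r) := by lia
  have hl2 : u (η s) ≤ u s := by lia
  have hn := h.inv
  have o := h.ok_lu hb hl1 hl2 (by grind)
  have k0 := h.cyc r hl1
  have k1 := h.cyc_u hl2
  have hrs' : (r : ℕ) < s := hrs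
  have hR : η r ≠ s := by rintro e; simp [Ok, e] at o
  have hT : η s ≠ r := by rintro e; simp [Ok, e] at o
  have hRT : η r ≠ η s := by rintro e; simp [Ok, e] at o
  have hI : η r ≠ r := by simp only [Cyc] at k0; grind
  have hJ : η s ≠ s := by simp only [Cyc] at k1; grind
  let η' : Fin n → Fin n := fun t =>
      if t = r then s else if t = s then r else if t = η r then η s else if t =
      η s then η r else η t
  have e0 : η' r = s := by grind
  have e1 : η' s = r := by grind
  have e2 : η' (η r) = η s := by grind
  have e3 : η' (η s) = η r := by grind
  have hη : ∀ p, p ≠ r → p ≠ s → p ≠ η r → p ≠ η s → η' p = η p := by grind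
  clear_value η'
  have b := Ok.relink_self h1 h2 h3 hrs' k0 k1 o
  refine ⟨η', h.glue hb hη hu ?_ ?_ ?_ ?_⟩
  · rintro p (hp | hp | hp | hp) <;> clear hc b k0 k1 o <;> grind
  · rintro p (hp | hp | hp | hp) hl <;> clear hc <;> grind [Cyc.refl]
  · rintro p q (hp | hp | hp | hp) (hq | hq | hq | hq) hpl hql hpq <;> clear hc <;> grind
  · intro c hcb n1 n2 n3 n4 n5 n6 hcl p hp hpl
    have b := Ok.relink h1 h2 h3 hrs' k0 k1 o (h.cyc c hcl) (h.ok _ _ hcb.symm hl1 hcl n1.symm)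
        (h.ok_ul (hb ▸ hcb.symm) hl2 hcl n4.symm)
      (hc _ hcb) (hc _ ((h.blk c).trans hcb))
    clear hc
    rcases hp with hp | hp | hp | hp <;> grind

/-- In the three `conj` cases the involution on positions is unchanged, so the involution on letters
is conjugated by the transposition of the two exchanged letters. -/
theorem swap_conj_far (h : Pat idx η u) (hb : idx r = idx s) (hrs : r < s) {u' : Fin n → ℕ}
    (hu : ∀ p, p ≠ r → p ≠ s → p ≠ η r → p ≠ η s → u' p = u p)
    (hr : u' r = u s) (hs : u' s = u r) (hR' : η r ≠ r → u' (η r) = u (η r))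
    (hT' : η s ≠ s → u' (η s) = u (η s))
    (hc : ∀ t, idx t = idx r → u r < u t → u t < u s → r < t → t < s → False)
    (h1 : u (η r) ≤ u r) (h2 : u r < u s) (h3 : u s ≤ u (η s)) (h4 : u (η r) < u r ∨
    u s < u (η s)) : Pat idx η u' := by
  have hl1 : u (η r) ≤ u r := by lia
  have hl2 : u s ≤ u (η s) := by lia
  have hn := h.inv
  have o := h.ok_ul hb hl1 hl2 (by grind)
  have k0 := h.cyc_u hl1
  have k1 := h.cyc s hl2
  have hrs' : (r : ℕ) < s := hrs
  have hR : η r ≠ s := by rintro e; simp [Ok, e] at o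
  have hT : η s ≠ r := by rintro e; simp [Ok, e] at o
  have hRT : η r ≠ η s := by rintro e; simp [Ok, e] at o
  have hI : η r ≠ r → u (η r) < u r := by simp only [Cyc] at k0; grind
  have hJ : η s ≠ s → u s < u (η s) := by simp only [Cyc] at k1; grind
  -- A fixed point carries its own partner along.
  have f1 : u (η r) < u r ∧ u' (η r) = u (η r) ∨ u (η r) = u r ∧ u' (η r) = u s := by grind
  have f2 : u s < u (η s) ∧ u' (η s) = u (η s) ∨ u s = u (η s) ∧ u' (η s) = u r := by grind
  have b := Ok.conj_far_self f1 h2 f2 h4 hrs' k0 k1 o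
  refine h.glue hb (fun _ _ _ _ _ => rfl) hu ?_ ?_ ?_ ?_
  · rintro p (hp | hp | hp | hp) <;> clear hc b k0 k1 o <;> grind
  · rintro p (hp | hp | hp | hp) hl <;> clear hc <;> grind [Cyc.refl]
  · rintro p q (hp | hp | hp | hp) (hq | hq | hq | hq) hpl hql hpq <;> clear hc <;> grind
  · intro c hcb n1 n2 n3 n4 n5 n6 hcl p hp hpl
    have b := Ok.conj_far f1 h2 f2 h4 hrs' k0 k1 o (h.cyc c hcl) (h.ok_ul hcb.symm hl1 hcl n3.symm)
        (h.ok _ _ (hb ▸ hcb.symm) hl2 hcl n2.symm)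
      (hc _ hcb) (hc _ ((h.blk c).trans hcb))
    clear hc
    rcases hp with hp | hp | hp | hp <;> grind

theorem swap_conj_low (h : Pat idx η u) (hb : idx r = idx s) (hrs : r < s) {u' : Fin n → ℕ}
    (hu : ∀ p, p ≠ r → p ≠ s → p ≠ η r → p ≠ η s → u' p = u p)
    (hr : u' r = u s) (hs : u' s = u r) (hR' : η r ≠ r → u' (η r) = u (η r))
    (hT' : η s ≠ s → u' (η s) = u (η s))
    (hc : ∀ t, idx t = idx r → u r < u t → u t < u s → r < t → t < s → False)
    (h1 : u (η r) < u (η s)) (h2 : u (η s) < u r) (h3 : u r < u s) : Pat idx η u' := by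
  have hl1 : u (η r) ≤ u r := by lia
  have hl2 : u (η s) ≤ u s := by lia
  have hn := h.inv
  have o := h.ok_uu hb hl1 hl2 (by grind)
  have k0 := h.cyc_u hl1
  have k1 := h.cyc_u hl2
  have hrs' : (r : ℕ) < s := hrs
  have hR : η r ≠ s := by rintro e; simp [Ok, e] at o
  have hT : η s ≠ r := by rintro e; simp [Ok, e] at o
  have hRT : η r ≠ η s := by rintro e; simp [Ok, e] at o
  have hI : η r ≠ r := by simp only [Cyc] at k0; grind
  have hJ : η s ≠ s := by simp only [Cyc] at k1; grind
  have b := Ok.conj_low_self h1 h2 h3 hrs' k0 k1 o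
  refine h.glue hb (fun _ _ _ _ _ => rfl) hu ?_ ?_ ?_ ?_
  · rintro p (hp | hp | hp | hp) <;> clear hc b k0 k1 o <;> grind
  · rintro p (hp | hp | hp | hp) hl <;> clear hc <;> grind [Cyc.refl]
  · rintro p q (hp | hp | hp | hp) (hq | hq | hq | hq) hpl hql hpq <;> clear hc <;> grind
  · intro c hcb n1 n2 n3 n4 n5 n6 hcl p hp hpl
    have b := Ok.conj_low h1 h2 h3 hrs' k0 k1 o (h.cyc c hcl) (h.ok_ul hcb.symm hl1 hcl n3.symm)
        (h.ok_ul (hb ▸ hcb.symm) hl2 hcl n4.symm)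
      (hc _ hcb) (hc _ ((h.blk c).trans hcb))
    clear hc
    rcases hp with hp | hp | hp | hp <;> grind

theorem swap_conj_high (h : Pat idx η u) (hb : idx r = idx s) (hrs : r < s) {u' : Fin n → ℕ}
    (hu : ∀ p, p ≠ r → p ≠ s → p ≠ η r → p ≠ η s → u' p = u p)
    (hr : u' r = u s) (hs : u' s = u r) (hR' : η r ≠ r → u' (η r) = u (η r))
    (hT' : η s ≠ s → u' (η s) = u (η s))
    (hc : ∀ t, idx t = idx r → u r < u t → u t < u s → r < t → t < s → False)
    (h1 : u r < u s) (h2 : u s < u (η r)) (h3 : u (η r) < u (η s)) : Pat idx η u' := by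
  have hl1 : u r ≤ u (η r) := by lia
  have hl2 : u s ≤ u (η s) := by lia
  have hn := h.inv
  have o := h.ok r s hb hl1 hl2 (by grind)
  have k0 := h.cyc r hl1
  have k1 := h.cyc s hl2
  have hrs' : (r : ℕ) < s := hrs
  have hR : η r ≠ s := by rintro e; simp [Ok, e] at o
  have hT : η s ≠ r := by rintro e; simp [Ok, e] at o
  have hRT : η r ≠ η s := by rintro e; simp [Ok, e] at o
  have hI : η r ≠ r := by simp only [Cyc] at k0; grind
  have hJ : η s ≠ s := by simp only [Cyc] at k1; grind
  have b := Ok.conj_high_self h1 h2 h3 hrs' k0 k1 o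
  refine h.glue hb (fun _ _ _ _ _ => rfl) hu ?_ ?_ ?_ ?_
  · rintro p (hp | hp | hp | hp) <;> clear hc b k0 k1 o <;> grind
  · rintro p (hp | hp | hp | hp) hl <;> clear hc <;> grind [Cyc.refl]
  · rintro p q (hp | hp | hp | hp) (hq | hq | hq | hq) hpl hql hpq <;> clear hc <;> grind
  · intro c hcb n1 n2 n3 n4 n5 n6 hcl p hp hpl
    have b := Ok.conj_high h1 h2 h3 hrs' k0 k1 o (h.cyc c hcl) (h.ok _ _ hcb.symm hl1 hcl n1.symm)
        (h.ok _ _ (hb ▸ hcb.symm) hl2 hcl n2.symm)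
      (hc _ hcb) (hc _ ((h.blk c).trans hcb))
    clear hc
    rcases hp with hp | hp | hp | hp <;> grind

/-- From here `u'` results from two exchanges. The clause about `Y` says that the involution of
letters is the same before and after: any map `Y` on letters that induces `η` through `u` induces
`η'` through `u'`. -/
theorem rotate_inner (h : Pat idx η u) (hb : idx r = idx s) (hrs : r < s) {u' : Fin n → ℕ}
    (hu : ∀ p, p ≠ r → p ≠ s → p ≠ η r → p ≠ η s → u' p = u p)
    (hr : u' r = u s) (hs : u' s = u (η s)) (hT' : u' (η s) = u r)
    (hR' : η r ≠ r → u' (η r) = u (η r))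
    (hc : ∀ t, idx t = idx r → u r < u t → u t < u s → r < t → t < s → False)
    (h1 : u (η s) < u r) (h2 : u r ≤ u (η r)) (h3 : u (η r) < u s) : ∃ η', Pat idx η' u' ∧
    ∀ Y : ℕ → ℕ, (∀ p, Y (u p) = u (η p)) → ∀ p, Y (u' p) = u' (η' p) := by
  have hl1 : u r ≤ u (η r) := by lia
  have hl2 : u (η s) ≤ u s := by lia
  have hn := h.inv
  have o := h.ok_lu hb hl1 hl2 (by grind)
  have k0 := h.cyc r hl1
  have k1 := h.cyc_u hl2
  have hrs' : (r : ℕ) < s := hrs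
  have hR : η r ≠ s := by rintro e; simp [Ok, e] at o
  have hT : η s ≠ r := by rintro e; simp [Ok, e] at o
  have hRT : η r ≠ η s := by rintro e; simp [Ok, e] at o
  have hI : η r ≠ r → u r < u (η r) := by simp only [Cyc] at k0; grind
  have hJ : η s ≠ s := by simp only [Cyc] at k1; grind
  -- If `r` is fixed, its letter moves to the position `η s` and has to be fixed there.
  have f1 : u r < u (η r) ∧ ((if η r = r then η s else η r : Fin n) : ℕ) = η r ∨ u r = u (η r) ∧
      ((if η r = r then η s else η r : Fin n) : ℕ) = η s := by grind
  let η' : Fin n → Fin n := fun t =>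
      if t = r then s else if t = s then r else if t = η s then
      (if η r = r then η s else η r) else if t = η r then η s else η t
  have e0 : η' r = s := by grind
  have e1 : η' s = r := by grind
  have e2 : η' (η s) = if η r = r then η s else η r := by grind
  have e3 : η r ≠ r → η' (η r) = η s := by grind
  have hη : ∀ p, p ≠ r → p ≠ s → p ≠ η r → p ≠ η s → η' p = η p := by grind
  clear_value η'
  have b := Ok.rotate_inner_self h1 f1 h3 hrs' k0 k1 o
  refine ⟨η', h.glue hb hη hu ?_ ?_ ?_ ?_, ?_⟩
  · rintro p (hp | hp | hp | hp) <;> clear hc b k0 k1 o <;> grind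
  · rintro p (hp | hp | hp | hp) hl <;> clear hc <;> grind [Cyc.refl]
  · rintro p q (hp | hp | hp | hp) (hq | hq | hq | hq) hpl hql hpq <;> clear hc <;> grind
  · intro c hcb n1 n2 n3 n4 n5 n6 hcl p hp hpl
    have b := Ok.rotate_inner h1 f1 h3 hrs' k0 k1 o (h.cyc c hcl)
        (h.ok _ _ hcb.symm hl1 hcl n1.symm) (h.ok_ul (hb ▸ hcb.symm) hl2 hcl n4.symm)
      (hc _ hcb) (hc _ ((h.blk c).trans hcb))
    clear hc
    rcases hp with hp | hp | hp | hp <;> grind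
  · clear hc b k0 k1 o
    grind

theorem rotate_below (h : Pat idx η u) (hb : idx r = idx s) (hrs : r < s) {u' : Fin n → ℕ}
    (hu : ∀ p, p ≠ r → p ≠ s → p ≠ η r → p ≠ η s → u' p = u p)
    (hr : u' r = u s) (hs : u' s = u (η s)) (hT' : u' (η s) = u r) (hR' : u' (η r) = u (η r))
    (hc : ∀ t, idx t = idx r → u r < u t → u t < u s → r < t → t < s → False)
    (h1 : u (η s) < u (η r)) (h2 : u (η r) < u r) (h3 : u r < u s) (h4 : η s < η r) : ∃ η',
    Pat idx η' u' ∧ ∀ Y : ℕ → ℕ, (∀ p, Y (u p) = u (η p)) → ∀ p, Y (u' p) = u' (η' p) := by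
  have hl1 : u (η r) ≤ u r := by lia
  have hl2 : u (η s) ≤ u s := by lia
  have hn := h.inv
  have o := h.ok_uu hb hl1 hl2 (by grind)
  have k0 := h.cyc_u hl1
  have k1 := h.cyc_u hl2
  have hrs' : (r : ℕ) < s := hrs
  have hR : η r ≠ s := by rintro e; simp [Ok, e] at o
  have hT : η s ≠ r := by rintro e; simp [Ok, e] at o
  have hRT : η r ≠ η s := by rintro e; simp [Ok, e] at o
  have hI : η r ≠ r := by simp only [Cyc] at k0; grind
  have hJ : η s ≠ s := by simp only [Cyc] at k1; grind
  let η' : Fin n → Fin n := fun t =>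
      if t = r then s else if t = s then r else if t = η s then η r else if t =
      η r then η s else η t
  have e0 : η' r = s := by grind
  have e1 : η' s = r := by grind
  have e2 : η' (η s) = η r := by grind
  have e3 : η' (η r) = η s := by grind
  have hη : ∀ p, p ≠ r → p ≠ s → p ≠ η r → p ≠ η s → η' p = η p := by grind
  clear_value η'
  have b := Ok.rotate_below_self h1 h2 h3 h4 hrs' k0 k1 o
  refine ⟨η', h.glue hb hη hu ?_ ?_ ?_ ?_, ?_⟩
  · rintro p (hp | hp | hp | hp) <;> clear hc b k0 k1 o <;> grind
  · rintro p (hp | hp | hp | hp) hl <;> clear hc <;> grind [Cyc.refl]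
  · rintro p q (hp | hp | hp | hp) (hq | hq | hq | hq) hpl hql hpq <;> clear hc <;> grind
  · intro c hcb n1 n2 n3 n4 n5 n6 hcl p hp hpl
    have b := Ok.rotate_below h1 h2 h3 h4 hrs' k0 k1 o (h.cyc c hcl)
        (h.ok_ul hcb.symm hl1 hcl n3.symm) (h.ok_ul (hb ▸ hcb.symm) hl2 hcl n4.symm)
      (hc _ hcb) (hc _ ((h.blk c).trans hcb))
    clear hc
    rcases hp with hp | hp | hp | hp <;> grind
  · clear hc b k0 k1 o
    grind

/-- Both cycles move as a whole, the one at `r, η r` to `s, η s` and conversely, so `η` itself still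
serves. -/
theorem exchange_below (h : Pat idx η u) (hb : idx r = idx s) (hrs : r < s) {u' : Fin n → ℕ}
    (hu : ∀ p, p ≠ r → p ≠ s → p ≠ η r → p ≠ η s → u' p = u p)
    (hr : u' r = u s) (hs : u' s = u r) (hT' : u' (η s) = u (η r)) (hR' : u' (η r) = u (η s))
    (hc : ∀ t, idx t = idx r → u r < u t → u t < u s → r < t → t < s → False)
    (h1 : u (η s) < u (η r)) (h2 : u (η r) < u r) (h3 : u r < u s)
    (h4 : η r < η s) : Pat idx η u' ∧ ∀ Y : ℕ → ℕ, (∀ p, Y (u p) = u (η p)) → ∀ p,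
    Y (u' p) = u' (η p) := by
  have hl1 : u (η r) ≤ u r := by lia
  have hl2 : u (η s) ≤ u s := by lia
  have hn := h.inv
  have o := h.ok_uu hb hl1 hl2 (by grind)
  have k0 := h.cyc_u hl1
  have k1 := h.cyc_u hl2
  have hrs' : (r : ℕ) < s := hrs
  have hR : η r ≠ s := by rintro e; simp [Ok, e] at o
  have hT : η s ≠ r := by rintro e; simp [Ok, e] at o
  have hRT : η r ≠ η s := by rintro e; simp [Ok, e] at o
  have hI : η r ≠ r := by simp only [Cyc] at k0; grind
  have hJ : η s ≠ s := by simp only [Cyc] at k1; grind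
  have b := Ok.exchange_below_self h1 h2 h3 h4 hrs' k0 k1 o
  refine ⟨h.glue hb (fun _ _ _ _ _ => rfl) hu ?_ ?_ ?_ ?_, ?_⟩
  · rintro p (hp | hp | hp | hp) <;> clear hc b k0 k1 o <;> grind
  · rintro p (hp | hp | hp | hp) hl <;> clear hc <;> grind [Cyc.refl]
  · rintro p q (hp | hp | hp | hp) (hq | hq | hq | hq) hpl hql hpq <;> clear hc <;> grind
  · intro c hcb n1 n2 n3 n4 n5 n6 hcl p hp hpl
    have b := Ok.exchange_below h1 h2 h3 h4 hrs' k0 k1 o (h.cyc c hcl)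
        (h.ok_ul hcb.symm hl1 hcl n3.symm) (h.ok_ul (hb ▸ hcb.symm) hl2 hcl n4.symm)
      (hc _ hcb) (hc _ ((h.blk c).trans hcb))
    clear hc
    rcases hp with hp | hp | hp | hp <;> grind
  · clear hc b k0 k1 o
    grind

theorem rotate_outer (h : Pat idx η u) (hb : idx r = idx s) (hrs : r < s) {u' : Fin n → ℕ}
    (hu : ∀ p, p ≠ r → p ≠ s → p ≠ η r → p ≠ η s → u' p = u p)
    (hr : u' r = u (η r)) (hs : u' s = u r) (hR' : u' (η r) = u s)
    (hT' : η s ≠ s → u' (η s) = u (η s))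
    (hc : ∀ t, idx t = idx r → u r < u t → u t < u s → r < t → t < s → False)
    (h1 : u r < u (η s)) (h2 : u (η s) ≤ u s) (h3 : u s < u (η r)) : ∃ η', Pat idx η' u' ∧
    ∀ Y : ℕ → ℕ, (∀ p, Y (u p) = u (η p)) → ∀ p, Y (u' p) = u' (η' p) := by
  have hl1 : u r ≤ u (η r) := by lia
  have hl2 : u (η s) ≤ u s := by lia
  have hn := h.inv
  have o := h.ok_lu hb hl1 hl2 (by grind)
  have k0 := h.cyc r hl1
  have k1 := h.cyc_u hl2
  have hrs' : (r : ℕ) < s := hrs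
  have hR : η r ≠ s := by rintro e; simp [Ok, e] at o
  have hT : η s ≠ r := by rintro e; simp [Ok, e] at o
  have hRT : η r ≠ η s := by rintro e; simp [Ok, e] at o
  have hJ : η s ≠ s → u (η s) < u s := by simp only [Cyc] at k1; grind
  have hI : η r ≠ r := by simp only [Cyc] at k0; grind
  have f1 : u (η s) < u s ∧ ((if η s = s then η r else η s : Fin n) : ℕ) = η s ∨ u (η s) = u s ∧
      ((if η s = s then η r else η s : Fin n) : ℕ) = η r := by grind
  let η' : Fin n → Fin n := fun t =>
      if t = r then s else if t = s then r else if t = η r then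
      (if η s = s then η r else η s) else if t = η s then η r else η t
  have e0 : η' r = s := by grind
  have e1 : η' s = r := by grind
  have e2 : η' (η r) = if η s = s then η r else η s := by grind
  have e3 : η s ≠ s → η' (η s) = η r := by grind
  have hη : ∀ p, p ≠ r → p ≠ s → p ≠ η r → p ≠ η s → η' p = η p := by grind
  clear_value η'
  have b := Ok.rotate_outer_self h1 f1 h3 hrs' k0 k1 o
  refine ⟨η', h.glue hb hη hu ?_ ?_ ?_ ?_, ?_⟩
  · rintro p (hp | hp | hp | hp) <;> clear hc b k0 k1 o <;> grind
  · rintro p (hp | hp | hp | hp) hl <;> clear hc <;> grind [Cyc.refl]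
  · rintro p q (hp | hp | hp | hp) (hq | hq | hq | hq) hpl hql hpq <;> clear hc <;> grind
  · intro c hcb n1 n2 n3 n4 n5 n6 hcl p hp hpl
    have b := Ok.rotate_outer h1 f1 h3 hrs' k0 k1 o (h.cyc c hcl)
        (h.ok _ _ hcb.symm hl1 hcl n1.symm) (h.ok_ul (hb ▸ hcb.symm) hl2 hcl n4.symm)
      (hc _ hcb) (hc _ ((h.blk c).trans hcb))
    clear hc
    rcases hp with hp | hp | hp | hp <;> grind
  · clear hc b k0 k1 o
    grind

theorem rotate_above (h : Pat idx η u) (hb : idx r = idx s) (hrs : r < s) {u' : Fin n → ℕ}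
    (hu : ∀ p, p ≠ r → p ≠ s → p ≠ η r → p ≠ η s → u' p = u p)
    (hr : u' r = u (η r)) (hs : u' s = u r) (hR' : u' (η r) = u s) (hT' : u' (η s) = u (η s))
    (hc : ∀ t, idx t = idx r → u r < u t → u t < u s → r < t → t < s → False)
    (h1 : u r < u s) (h2 : u s < u (η s)) (h3 : u (η s) < u (η r)) (h4 : η s < η r) : ∃ η',
    Pat idx η' u' ∧ ∀ Y : ℕ → ℕ, (∀ p, Y (u p) = u (η p)) → ∀ p, Y (u' p) = u' (η' p) := by
  have hl1 : u r ≤ u (η r) := by lia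
  have hl2 : u s ≤ u (η s) := by lia
  have hn := h.inv
  have o := h.ok r s hb hl1 hl2 (by grind)
  have k0 := h.cyc r hl1
  have k1 := h.cyc s hl2
  have hrs' : (r : ℕ) < s := hrs
  have hR : η r ≠ s := by rintro e; simp [Ok, e] at o
  have hT : η s ≠ r := by rintro e; simp [Ok, e] at o
  have hRT : η r ≠ η s := by rintro e; simp [Ok, e] at o
  have hI : η r ≠ r := by simp only [Cyc] at k0; grind
  have hJ : η s ≠ s := by simp only [Cyc] at k1; grind
  let η' : Fin n → Fin n := fun t =>
      if t = r then s else if t = s then r else if t = η s then η r else if t =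
      η r then η s else η t
  have e0 : η' r = s := by grind
  have e1 : η' s = r := by grind
  have e2 : η' (η s) = η r := by grind
  have e3 : η' (η r) = η s := by grind
  have hη : ∀ p, p ≠ r → p ≠ s → p ≠ η r → p ≠ η s → η' p = η p := by grind
  clear_value η'
  have b := Ok.rotate_above_self h1 h2 h3 h4 hrs' k0 k1 o
  refine ⟨η', h.glue hb hη hu ?_ ?_ ?_ ?_, ?_⟩
  · rintro p (hp | hp | hp | hp) <;> clear hc b k0 k1 o <;> grind
  · rintro p (hp | hp | hp | hp) hl <;> clear hc <;> grind [Cyc.refl]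
  · rintro p q (hp | hp | hp | hp) (hq | hq | hq | hq) hpl hql hpq <;> clear hc <;> grind
  · intro c hcb n1 n2 n3 n4 n5 n6 hcl p hp hpl
    have b := Ok.rotate_above h1 h2 h3 h4 hrs' k0 k1 o (h.cyc c hcl)
        (h.ok _ _ hcb.symm hl1 hcl n1.symm) (h.ok _ _ (hb ▸ hcb.symm) hl2 hcl n2.symm)
      (hc _ hcb) (hc _ ((h.blk c).trans hcb))
    clear hc
    rcases hp with hp | hp | hp | hp <;> grind
  · clear hc b k0 k1 o
    grind

theorem exchange_above (h : Pat idx η u) (hb : idx r = idx s) (hrs : r < s) {u' : Fin n → ℕ}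
    (hu : ∀ p, p ≠ r → p ≠ s → p ≠ η r → p ≠ η s → u' p = u p)
    (hr : u' r = u s) (hs : u' s = u r) (hT' : u' (η s) = u (η r)) (hR' : u' (η r) = u (η s))
    (hc : ∀ t, idx t = idx r → u r < u t → u t < u s → r < t → t < s → False)
    (h1 : u r < u s) (h2 : u s < u (η s)) (h3 : u (η s) < u (η r))
    (h4 : η r < η s) : Pat idx η u' ∧ ∀ Y : ℕ → ℕ, (∀ p, Y (u p) = u (η p)) → ∀ p,
    Y (u' p) = u' (η p) := by
  have hl1 : u r ≤ u (η r) := by lia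
  have hl2 : u s ≤ u (η s) := by lia
  have hn := h.inv
  have o := h.ok r s hb hl1 hl2 (by grind)
  have k0 := h.cyc r hl1
  have k1 := h.cyc s hl2
  have hrs' : (r : ℕ) < s := hrs
  have hR : η r ≠ s := by rintro e; simp [Ok, e] at o
  have hT : η s ≠ r := by rintro e; simp [Ok, e] at o
  have hRT : η r ≠ η s := by rintro e; simp [Ok, e] at o
  have hI : η r ≠ r := by simp only [Cyc] at k0; grind
  have hJ : η s ≠ s := by simp only [Cyc] at k1; grind
  have b := Ok.exchange_above_self h1 h2 h3 h4 hrs' k0 k1 o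
  refine ⟨h.glue hb (fun _ _ _ _ _ => rfl) hu ?_ ?_ ?_ ?_, ?_⟩
  · rintro p (hp | hp | hp | hp) <;> clear hc b k0 k1 o <;> grind
  · rintro p (hp | hp | hp | hp) hl <;> clear hc <;> grind [Cyc.refl]
  · rintro p q (hp | hp | hp | hp) (hq | hq | hq | hq) hpl hql hpq <;> clear hc <;> grind
  · intro c hcb n1 n2 n3 n4 n5 n6 hcl p hp hpl
    have b := Ok.exchange_above h1 h2 h3 h4 hrs' k0 k1 o (h.cyc c hcl)
        (h.ok _ _ hcb.symm hl1 hcl n1.symm) (h.ok _ _ (hb ▸ hcb.symm) hl2 hcl n2.symm)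
      (hc _ hcb) (hc _ ((h.blk c).trans hcb))
    clear hc
    rcases hp with hp | hp | hp | hp <;> grind
  · clear hc b k0 k1 o
    grind

end Pat
end MuInv

/-! ### Descents inside a block, and replacing one letter of a block -/

namespace MuInv
namespace Pat
variable {n : ℕ} {κ : Type*} {idx : Fin n → κ} {η : Fin n → Fin n} {u : Fin n → ℕ} {p q r s : Fin n}

theorem descend_conj_far (h : Pat idx η u) (hb : idx r = idx s) (hrs : r < s) {u' : Fin n → ℕ}
    (hu : ∀ p, p ≠ r → p ≠ s → p ≠ η r → p ≠ η s → u' p = u p)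
    (hr : u' r = u s) (hs : u' s = u r) (hR' : η r ≠ r → u' (η r) = u (η r))
    (hT' : η s ≠ s → u' (η s) = u (η s))
    (hc : ∀ t, idx t = idx r → u s < u t → u t < u r → False)
    (h1 : u (η r) ≤ u r) (h2 : u s < u r) (h3 : u s ≤ u (η s)) (h4 : u (η r) < u r ∨ u s < u (η s))
    (h7 : η r ≠ s) : Pat idx η u' := by
  have hl1 : u (η r) ≤ u r := by lia
  have hl2 : u s ≤ u (η s) := by lia
  have hn := h.inv
  have o := h.ok_ul hb hl1 hl2 (by grind)
  have k0 := h.cyc_u hl1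
  have k1 := h.cyc s hl2
  have hrs' : (r : ℕ) < s := hrs
  have hR : η r ≠ s := by rintro e; simp [Ok, e] at o
  have hT : η s ≠ r := by rintro e; simp [Ok, e] at o
  have hRT : η r ≠ η s := by rintro e; simp [Ok, e] at o
  have hI : η r ≠ r → u (η r) < u r := by simp only [Cyc] at k0; grind
  have hJ : η s ≠ s → u s < u (η s) := by simp only [Cyc] at k1; grind
  have f1 : u (η r) < u r ∧ u' (η r) = u (η r) ∨ u (η r) = u r ∧ u' (η r) = u s := by grind
  have f2 : u s < u (η s) ∧ u' (η s) = u (η s) ∨ u s = u (η s) ∧ u' (η s) = u r := by grind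
  have o' := o.2.2.1
  have f3 : u (η r) ≤ u s ∨ u (η r) = u r := by have := hc (η r) (h.blk r); lia
  have f5 : η r ≠ r → u (η r) < u s := by grind
  have f4 : u r ≤ u (η s) ∨ u s = u (η s) := by have := hc (η s) ((h.blk s).trans hb.symm); lia
  have f6 : η s ≠ s → u r < u (η s) := by grind
  have b := Ok.descend_conj_far_self f1 h2 f2 h4 f3 f4 hrs' k0 k1 o
  refine h.glue hb (fun _ _ _ _ _ => rfl) hu ?_ ?_ ?_ ?_
  · rintro p (hp | hp | hp | hp) <;> clear hc b k0 k1 o <;> grind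
  · rintro p (hp | hp | hp | hp) hl <;> clear hc <;> grind [Cyc.refl]
  · rintro p q (hp | hp | hp | hp) (hq | hq | hq | hq) hpl hql hpq <;> clear hc <;> grind
  · intro c hcb n1 n2 n3 n4 n5 n6 hcl p hp hpl
    have b := Ok.descend_conj_far f1 h2 f2 h4 f3 f4 hrs' k0 k1 o (h.cyc c hcl)
        (h.ok_ul hcb.symm hl1 hcl n3.symm) (h.ok _ _ (hb ▸ hcb.symm) hl2 hcl n2.symm)
      (hc _ hcb) (hc _ ((h.blk c).trans hcb))
    clear hc
    rcases hp with hp | hp | hp | hp <;> grind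

theorem descend_conj_low (h : Pat idx η u) (hb : idx r = idx s) (hrs : r < s) {u' : Fin n → ℕ}
    (hu : ∀ p, p ≠ r → p ≠ s → p ≠ η r → p ≠ η s → u' p = u p)
    (hr : u' r = u s) (hs : u' s = u r) (hR' : η r ≠ r → u' (η r) = u (η r))
    (hT' : η s ≠ s → u' (η s) = u (η s))
    (hc : ∀ t, idx t = idx r → u s < u t → u t < u r → False)
    (h1 : u (η r) < u (η s)) (h2 : u (η s) < u s) (h3 : u s < u r) : Pat idx η u' := by
  have hl1 : u (η r) ≤ u r := by lia
  have hl2 : u (η s) ≤ u s := by lia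
  have hn := h.inv
  have o := h.ok_uu hb hl1 hl2 (by grind)
  have k0 := h.cyc_u hl1
  have k1 := h.cyc_u hl2
  have hrs' : (r : ℕ) < s := hrs
  have hR : η r ≠ s := by rintro e; simp [Ok, e] at o
  have hT : η s ≠ r := by rintro e; simp [Ok, e] at o
  have hRT : η r ≠ η s := by rintro e; simp [Ok, e] at o
  have hI : η r ≠ r := by simp only [Cyc] at k0; grind
  have hJ : η s ≠ s := by simp only [Cyc] at k1; grind
  have b := Ok.descend_conj_low_self h1 h2 h3 hrs' k0 k1 o
  refine h.glue hb (fun _ _ _ _ _ => rfl) hu ?_ ?_ ?_ ?_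
  · rintro p (hp | hp | hp | hp) <;> clear hc b k0 k1 o <;> grind
  · rintro p (hp | hp | hp | hp) hl <;> clear hc <;> grind [Cyc.refl]
  · rintro p q (hp | hp | hp | hp) (hq | hq | hq | hq) hpl hql hpq <;> clear hc <;> grind
  · intro c hcb n1 n2 n3 n4 n5 n6 hcl p hp hpl
    have b := Ok.descend_conj_low h1 h2 h3 hrs' k0 k1 o (h.cyc c hcl)
        (h.ok_ul hcb.symm hl1 hcl n3.symm) (h.ok_ul (hb ▸ hcb.symm) hl2 hcl n4.symm)
      (hc _ hcb) (hc _ ((h.blk c).trans hcb))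
    clear hc
    rcases hp with hp | hp | hp | hp <;> grind

theorem descend_conj_high (h : Pat idx η u) (hb : idx r = idx s) (hrs : r < s) {u' : Fin n → ℕ}
    (hu : ∀ p, p ≠ r → p ≠ s → p ≠ η r → p ≠ η s → u' p = u p)
    (hr : u' r = u s) (hs : u' s = u r) (hR' : η r ≠ r → u' (η r) = u (η r))
    (hT' : η s ≠ s → u' (η s) = u (η s))
    (hc : ∀ t, idx t = idx r → u s < u t → u t < u r → False)
    (h1 : u s < u r) (h2 : u r < u (η r)) (h3 : u (η r) < u (η s)) : Pat idx η u' := by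
  have hl1 : u r ≤ u (η r) := by lia
  have hl2 : u s ≤ u (η s) := by lia
  have hn := h.inv
  have o := h.ok r s hb hl1 hl2 (by grind)
  have k0 := h.cyc r hl1
  have k1 := h.cyc s hl2
  have hrs' : (r : ℕ) < s := hrs
  have hR : η r ≠ s := by rintro e; simp [Ok, e] at o
  have hT : η s ≠ r := by rintro e; simp [Ok, e] at o
  have hRT : η r ≠ η s := by rintro e; simp [Ok, e] at o
  have hI : η r ≠ r := by simp only [Cyc] at k0; grind
  have hJ : η s ≠ s := by simp only [Cyc] at k1; grind
  have b := Ok.descend_conj_high_self h1 h2 h3 hrs' k0 k1 o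
  refine h.glue hb (fun _ _ _ _ _ => rfl) hu ?_ ?_ ?_ ?_
  · rintro p (hp | hp | hp | hp) <;> clear hc b k0 k1 o <;> grind
  · rintro p (hp | hp | hp | hp) hl <;> clear hc <;> grind [Cyc.refl]
  · rintro p q (hp | hp | hp | hp) (hq | hq | hq | hq) hpl hql hpq <;> clear hc <;> grind
  · intro c hcb n1 n2 n3 n4 n5 n6 hcl p hp hpl
    have b := Ok.descend_conj_high h1 h2 h3 hrs' k0 k1 o (h.cyc c hcl)
        (h.ok _ _ hcb.symm hl1 hcl n1.symm) (h.ok _ _ (hb ▸ hcb.symm) hl2 hcl n2.symm)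
      (hc _ hcb) (hc _ ((h.blk c).trans hcb))
    clear hc
    rcases hp with hp | hp | hp | hp <;> grind

theorem descend_unlink (h : Pat idx η u) (hrs : r < s) (hηr : η r = s) {u' : Fin n → ℕ}
    (hu : ∀ p, p ≠ r → p ≠ s → u' p = u p) (hr : u' r = u s) (hs : u' s = u r)
    (hc : ∀ t, idx t = idx r → u s < u t → u t < u r → False) (h1 : u s < u r) :
    ∃ η', Pat idx η' u' ∧ η' r = r ∧ η' s = s ∧ ∀ p, p ≠ r → p ≠ s → η' p = η p := by
  have hn := h.inv
  have hηs : η s = r := by rw [← hηr, h.inv]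
  have hb : idx r = idx s := by rw [← hηr, h.blk]
  have hrs' : (r : ℕ) < s := hrs
  have hl : u (η r) ≤ u r := by rw [hηr]; lia
  have k0 := h.cyc_u hl
  rw [hηr] at k0
  let η' : Fin n → Fin n := fun t => if t = r ∨ t = s then t else η t
  have e0 : η' r = r := by grind
  have e1 : η' s = s := by grind
  have hη : ∀ p, p ≠ r → p ≠ s → η' p = η p := by grind
  clear_value η'
  have b := Ok.descend_unlink_self h1 hrs' k0
  refine ⟨η', h.glue hb (fun p h1 h2 _ _ => hη p h1 h2)
      (fun p h1 h2 _ _ => hu p h1 h2) ?_ ?_ ?_ ?_, e0, e1, hη⟩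
  · rintro p (hp | hp | hp | hp) <;> clear hc b k0 <;> grind
  · rintro p (hp | hp | hp | hp) hl <;> clear hc <;> grind [Cyc.refl]
  · rintro p q (hp | hp | hp | hp) (hq | hq | hq | hq) hpl hql hpq <;> clear hc <;> grind
  · intro c hcb n1 n2 n3 n4 n5 n6 hcl p hp hpl
    have o := h.ok_ul hcb.symm hl hcl n3.symm
    rw [hηr] at o
    have b := Ok.descend_unlink h1 hrs' k0 (h.cyc c hcl) o (hc _ hcb) (hc _ ((h.blk c).trans hcb))
    clear hc
    rcases hp with hp | hp | hp | hp <;> grind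

/-- Let the cycles of `p` and `q` be `a ≤ b` and `c ≤ d`. Whichever letters `p` and `q` hold, the
hypotheses give `a < c` and `b < d`, so `a` precedes `d`. As `b` does not come after `a`, nor `d`
after `c`, the position `p` precedes `q`. -/
theorem lt_of_lt (h : Pat idx η u) (hb : idx p = idx q) (h1 : u p < u q) (h2 : u (η p) < u (η q)) :
    p < q := by
  have hpq : p ≠ q := by rintro rfl; lia
  have hpq' : p ≠ η q := by rintro rfl; rw [h.inv] at h2; lia
  have hpq'' : η p ≠ q := by rintro rfl; rw [h.inv] at h2; lia
  rw [Fin.lt_def]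
  rcases le_total (u p) (u (η p)) with hp | hp <;> rcases le_total (u q) (u (η q)) with hq | hq
  · have o := h.ok p q hb hp hq hpq
    have k := h.cyc p hp
    have k' := h.cyc q hq
    simp only [Ok, Half, Cyc] at *
    grind
  · have o := h.ok_lu hb hp hq hpq'
    have k := h.cyc p hp
    have k' := h.cyc_u hq
    simp only [Ok, Half, Cyc] at *
    grind
  · have o := h.ok_ul hb hp hq hpq''
    have k := h.cyc_u hp
    have k' := h.cyc q hq
    simp only [Ok, Half, Cyc] at *
    grind
  · have o := h.ok_uu hb hp hq hpq
    have k := h.cyc_u hp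
    have k' := h.cyc_u hq
    simp only [Ok, Half, Cyc] at *
    grind

/-- Letters need only be distinct inside a block. A pattern may repeat a letter in different blocks,
which the passage through `raise` and `lower` exploits. -/
theorem inj (h : Pat idx η u) (hb : idx p = idx q) (e : u p = u q) : p = q := by
  by_contra hpq
  by_cases hpq' : p = η q
  · subst hpq'
    rcases le_total (u q) (u (η q)) with hq | hq
    · have k := h.cyc q hq
      simp only [Cyc] at k; exact hpq (Fin.ext (by grind))
    · have k := h.cyc_u hq
      simp only [Cyc] at k; exact hpq (Fin.ext (by grind))
  have hpq'' : η p ≠ q := by rintro rfl; exact hpq' (h.inv p).symm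
  rcases le_total (u p) (u (η p)) with hp | hp <;> rcases le_total (u q) (u (η q)) with hq | hq
  · have o := h.ok p q hb hp hq hpq
    simp only [Ok] at o; grind
  · have o := h.ok_lu hb hp hq hpq'
    simp only [Ok] at o; grind
  · have o := h.ok_ul hb hp hq hpq''
    simp only [Ok] at o; grind
  · have o := h.ok_uu hb hp hq hpq
    simp only [Ok] at o; grind

/-- An upper letter or a fixed point stays the top of its cycle. A lower letter either stays below
its partner or jumps over it, and in the latter case the cycle is split. The condition `hc` is what
a cover leaves of itself in the left of its two blocks. -/
theorem raise (h : Pat idx η u) {u' : Fin n → ℕ} (hu : ∀ p, p ≠ r → u' p = u p) (hr : u r < u' r)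
    (hn : ∀ t, idx t = idx r → t ≠ r → u t ≠ u' r)
    (hc : ∀ t, idx t = idx r → u r < u t → u t < u' r → r < t → False) : ∃ η', Pat idx η' u' := by
  have hinv := h.inv
  by_cases hl : u (η r) ≤ u r
  · have k0 := h.cyc_u hl
    have hI : η r ≠ r → u (η r) < u r := by simp only [Cyc] at k0; grind
    have f1 : u (η r) < u r ∧ u' (η r) = u (η r) ∨ u (η r) = u r ∧ u' (η r) = u' r := by grind
    have b := Ok.raise_right_self f1 hr k0
    refine ⟨η, h.glue rfl (fun _ _ _ _ _ => rfl) (fun p h1 _ _ _ => hu p h1) ?_ ?_ ?_ ?_⟩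
    · rintro p (hp | hp | hp | hp) <;> clear hc b k0 <;> grind
    · rintro p (hp | hp | hp | hp) hl <;> clear hc <;> grind [Cyc.refl]
    · rintro p q (hp | hp | hp | hp) (hq | hq | hq | hq) hpl hql hpq <;> clear hc <;> grind
    · intro c hcb n1 n2 n3 n4 n5 n6 hcl p hp hpl
      have b := Ok.raise_right f1 hr k0 (h.cyc c hcl) (h.ok_ul hcb.symm hl hcl n3.symm)
        (hc _ hcb) (hc _ ((h.blk c).trans hcb))
        (hn _ hcb n1).symm (hn _ ((h.blk c).trans hcb) n5).symm
      clear hc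
      rcases hp with hp | hp | hp | hp <;> grind
  have hl : u r ≤ u (η r) := by lia
  have k0 := h.cyc r hl
  have hI : η r ≠ r := by rintro e; rw [e] at hl; lia
  by_cases hj : u' r < u (η r)
  · have b := Ok.raise_left_self hr hj k0
    refine ⟨η, h.glue rfl (fun _ _ _ _ _ => rfl) (fun p h1 _ _ _ => hu p h1) ?_ ?_ ?_ ?_⟩
    · rintro p (hp | hp | hp | hp) <;> clear hc b k0 <;> grind
    · rintro p (hp | hp | hp | hp) hl <;> clear hc <;> grind [Cyc.refl]
    · rintro p q (hp | hp | hp | hp) (hq | hq | hq | hq) hpl hql hpq <;> clear hc <;> grind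
    · intro c hcb n1 n2 n3 n4 n5 n6 hcl p hp hpl
      have b := Ok.raise_left hr hj k0 (h.cyc c hcl) (h.ok _ _ hcb.symm hl hcl n1.symm)
        (hc _ hcb) (hc _ ((h.blk c).trans hcb))
        (hn _ hcb n1).symm (hn _ ((h.blk c).trans hcb) n5).symm
      clear hc
      rcases hp with hp | hp | hp | hp <;> grind
  · have h1 : u r < u (η r) := by lia
    have h2 : u (η r) < u' r := by have := hn (η r) (h.blk r) hI; lia
    let η' : Fin n → Fin n := fun t => if t = r ∨ t = η r then t else η t
    have e0 : η' r = r := by grind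
    have e1 : η' (η r) = η r := by grind
    have hη : ∀ p, p ≠ r → p ≠ r → p ≠ η r → p ≠ η r → η' p = η p := by grind
    clear_value η'
    have b := Ok.raise_split_self h1 h2 k0
    refine ⟨η', h.glue rfl hη (fun p h1 _ _ _ => hu p h1) ?_ ?_ ?_ ?_⟩
    · rintro p (hp | hp | hp | hp) <;> clear hc b k0 <;> grind
    · rintro p (hp | hp | hp | hp) hl <;> clear hc <;> grind [Cyc.refl]
    · rintro p q (hp | hp | hp | hp) (hq | hq | hq | hq) hpl hql hpq <;> clear hc <;> grind
    · intro c hcb n1 n2 n3 n4 n5 n6 hcl p hp hpl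
      have b := Ok.raise_split h1 h2 k0 (h.cyc c hcl) (h.ok _ _ hcb.symm hl hcl n1.symm)
        (hc _ hcb) (hc _ ((h.blk c).trans hcb))
        (hn _ hcb n1).symm (hn _ ((h.blk c).trans hcb) n5).symm
      clear hc
      rcases hp with hp | hp | hp | hp <;> grind

/-- The mirror image of `raise`, for the right of the two blocks. -/
theorem lower (h : Pat idx η u) {u' : Fin n → ℕ} (hu : ∀ p, p ≠ r → u' p = u p) (hr : u' r < u r)
    (hn : ∀ t, idx t = idx r → t ≠ r → u t ≠ u' r)
    (hc : ∀ t, idx t = idx r → u' r < u t → u t < u r → t < r → False) : ∃ η', Pat idx η' u' := by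
  have hinv := h.inv
  by_cases hl : u r ≤ u (η r)
  · have k0 := h.cyc r hl
    have hI : η r ≠ r → u r < u (η r) := by simp only [Cyc] at k0; grind
    have f1 : u r < u (η r) ∧ u' (η r) = u (η r) ∨ u r = u (η r) ∧ u' (η r) = u' r := by grind
    have b := Ok.lower_left_self f1 hr k0
    refine ⟨η, h.glue rfl (fun _ _ _ _ _ => rfl) (fun p h1 _ _ _ => hu p h1) ?_ ?_ ?_ ?_⟩
    · rintro p (hp | hp | hp | hp) <;> clear hc b k0 <;> grind
    · rintro p (hp | hp | hp | hp) hl <;> clear hc <;> grind [Cyc.refl]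
    · rintro p q (hp | hp | hp | hp) (hq | hq | hq | hq) hpl hql hpq <;> clear hc <;> grind
    · intro c hcb n1 n2 n3 n4 n5 n6 hcl p hp hpl
      have b := Ok.lower_left f1 hr k0 (h.cyc c hcl) (h.ok _ _ hcb.symm hl hcl n1.symm)
        (hc _ hcb) (hc _ ((h.blk c).trans hcb))
        (hn _ hcb n1).symm (hn _ ((h.blk c).trans hcb) n5).symm
      clear hc
      rcases hp with hp | hp | hp | hp <;> grind
  have hl : u (η r) ≤ u r := by lia
  have k0 := h.cyc_u hl
  have hI : η r ≠ r := by rintro e; rw [e] at hl; lia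
  by_cases hj : u (η r) < u' r
  · have b := Ok.lower_right_self hr hj k0
    refine ⟨η, h.glue rfl (fun _ _ _ _ _ => rfl) (fun p h1 _ _ _ => hu p h1) ?_ ?_ ?_ ?_⟩
    · rintro p (hp | hp | hp | hp) <;> clear hc b k0 <;> grind
    · rintro p (hp | hp | hp | hp) hl <;> clear hc <;> grind [Cyc.refl]
    · rintro p q (hp | hp | hp | hp) (hq | hq | hq | hq) hpl hql hpq <;> clear hc <;> grind
    · intro c hcb n1 n2 n3 n4 n5 n6 hcl p hp hpl
      have b := Ok.lower_right hr hj k0 (h.cyc c hcl) (h.ok_ul hcb.symm hl hcl n3.symm)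
        (hc _ hcb) (hc _ ((h.blk c).trans hcb))
        (hn _ hcb n1).symm (hn _ ((h.blk c).trans hcb) n5).symm
      clear hc
      rcases hp with hp | hp | hp | hp <;> grind
  · have h1 : u' r < u (η r) := by have := hn (η r) (h.blk r) hI; lia
    have h2 : u (η r) < u r := by lia
    let η' : Fin n → Fin n := fun t => if t = r ∨ t = η r then t else η t
    have e0 : η' r = r := by grind
    have e1 : η' (η r) = η r := by grind
    have hη : ∀ p, p ≠ r → p ≠ r → p ≠ η r → p ≠ η r → η' p = η p := by grind
    clear_value η'
    have b := Ok.lower_split_self h1 h2 k0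
    refine ⟨η', h.glue rfl hη (fun p h1 _ _ _ => hu p h1) ?_ ?_ ?_ ?_⟩
    · rintro p (hp | hp | hp | hp) <;> clear hc b k0 <;> grind
    · rintro p (hp | hp | hp | hp) hl <;> clear hc <;> grind [Cyc.refl]
    · rintro p q (hp | hp | hp | hp) (hq | hq | hq | hq) hpl hql hpq <;> clear hc <;> grind
    · intro c hcb n1 n2 n3 n4 n5 n6 hcl p hp hpl
      have b := Ok.lower_split h1 h2 k0 (h.cyc c hcl) (h.ok_ul hcb.symm hl hcl n3.symm)
        (hc _ hcb) (hc _ ((h.blk c).trans hcb))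
        (hn _ hcb n1).symm (hn _ ((h.blk c).trans hcb) n5).symm
      clear hc
      rcases hp with hp | hp | hp | hp <;> grind

end Pat
end MuInv

/-! ### Length, strong exchange and deletion of letters in the symmetric group -/

namespace MuInv
open Equiv
variable {n : ℕ}

theorem simple_eq (x : Fin (n - 1)) :
    simple n x = swap (⟨x, by omega⟩ : Fin n) ⟨x + 1, by omega⟩ := by
  rw [simple, dif_pos]

theorem simple_mul_self (x : Fin (n - 1)) : simple n x * simple n x = 1 := by
  rw [simple_eq, swap_mul_self]

theorem simple_inv (x : Fin (n - 1)) : (simple n x)⁻¹ = simple n x := by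
  rw [simple_eq, swap_inv]

theorem simple_mul_cancel_left (x : Fin (n - 1)) (w : Perm (Fin n)) :
    simple n x * (simple n x * w) = w := by
  rw [← mul_assoc, simple_mul_self, one_mul]

theorem wordProd_nil : wordProd ([] : Word n) = 1 := rfl

theorem wordProd_cons (x : Fin (n - 1)) (a : Word n) :
    wordProd (x :: a) = simple n x * wordProd a := by
  simp [wordProd]

theorem wordProd_append (a b : Word n) : wordProd (a ++ b) = wordProd a * wordProd b := by
  simp [wordProd]

theorem wordProd_reverse (a : Word n) : wordProd a.reverse = (wordProd a)⁻¹ := by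
  induction a with
  | nil => simp [wordProd]
  | cons x a ih =>
    rw [List.reverse_cons, wordProd_append, ih, wordProd_cons, wordProd_cons, wordProd_nil,
        mul_inv_rev,
      simple_inv, mul_one]

theorem exists_word (w : Perm (Fin n)) : ∃ a : Word n, wordProd a = w := by
  rcases n with _ | m
  · exact ⟨[], Subsingleton.elim _ _⟩
  have hw : w ∈ Submonoid.closure (Set.range fun i : Fin m => swap i.castSucc i.succ) := by
    rw [Equiv.Perm.mclosure_swap_castSucc_succ]; trivial
  induction hw using Submonoid.closure_induction with
  | mem x hx =>
    obtain ⟨i, rfl⟩ := hx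
    refine ⟨[(i : Fin (m + 1 - 1))], ?_⟩
    rw [wordProd_cons, wordProd_nil, mul_one, simple_eq]
    rfl
  | one => exact ⟨[], rfl⟩
  | mul x y _ _ hx hy =>
    obtain ⟨a, rfl⟩ := hx
    obtain ⟨b, rfl⟩ := hy
    exact ⟨a ++ b, wordProd_append a b⟩

theorem len_wordProd_le (a : Word n) : len (wordProd a) ≤ a.length :=
  Nat.sInf_le ⟨a, rfl, rfl⟩

theorem exists_reduced (w : Perm (Fin n)) : ∃ a : Word n, wordProd a = w ∧ a.length = len w := by
  obtain ⟨a, ha⟩ := exists_word w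
  exact Nat.sInf_mem (s := {k | ∃ a : Word n, wordProd a = w ∧ a.length = k}) ⟨_, a, ha, rfl⟩

theorem len_one : len (1 : Perm (Fin n)) = 0 := Nat.le_zero.1 (len_wordProd_le [])

theorem len_inv (w : Perm (Fin n)) : len w⁻¹ = len w := by
  have key : ∀ w : Perm (Fin n), len w⁻¹ ≤ len w := fun w => by
    obtain ⟨a, rfl, ha⟩ := exists_reduced w
    rw [← wordProd_reverse, ← ha, ← List.length_reverse]
    exact len_wordProd_le _
  exact le_antisymm (key w) (by simpa using key w⁻¹)

theorem simple_apply_lt {x : Fin (n - 1)} {p q : Fin n} (h : p < q)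
    (h' : simple n x q < simple n x p) :
    p.1 = x ∧ q.1 = x + 1 := by
  rw [simple_eq, swap_apply_def, swap_apply_def] at h'
  simp only [Fin.ext_iff, Fin.lt_def] at *
  grind

/-- Strong exchange: an inversion of the product is removed by deleting one letter. -/
theorem exists_eraseIdx {a : Word n} {i j : Fin n} (hij : i < j) (h : wordProd a j < wordProd a i) :
    ∃ k : Fin a.length, wordProd (a.eraseIdx k) = wordProd a * swap i j := by
  induction a with
  | nil => simp [wordProd] at h; omega
  | cons x b ih =>
    by_cases hb : wordProd b j < wordProd b i
    · obtain ⟨k, hk⟩ := ih hb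
      exact ⟨k.succ, by simp [wordProd_cons, hk, mul_assoc]⟩
    · have hlt : wordProd b i < wordProd b j :=
        lt_of_le_of_ne (not_lt.1 hb) fun e => hij.ne ((wordProd b).injective e)
      rw [wordProd_cons, Perm.mul_apply, Perm.mul_apply] at h
      obtain ⟨e1, e2⟩ := simple_apply_lt hlt h
      -- The inversion `(i, j)` is created by the first letter itself, so that letter is deleted.
      refine ⟨⟨0, by simp⟩, ?_⟩
      have : simple n x = swap (wordProd b i) (wordProd b j) := by
        rw [simple_eq]; congr 1 <;> exact Fin.ext (by simp [e1, e2])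
      simp only [List.eraseIdx_cons_zero, wordProd_cons]
      rw [mul_assoc, Equiv.mul_swap_eq_swap_mul, ← this, simple_mul_cancel_left]

theorem length_eraseIdx' {a : Word n} (k : Fin a.length) : (a.eraseIdx k).length + 1 = a.length :=
    by
  have := k.2
  rw [List.length_eraseIdx_of_lt k.2]; omega

theorem len_mul_swap_lt {w : Perm (Fin n)} {i j : Fin n} (hij : i < j) (h : w j < w i) :
    len (w * swap i j) < len w := by
  obtain ⟨a, rfl, ha⟩ := exists_reduced w
  obtain ⟨k, hk⟩ := exists_eraseIdx hij h
  have h1 := len_wordProd_le (a.eraseIdx k)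
  have h2 := length_eraseIdx' k
  rw [← hk]
  omega

theorem lt_len_mul_swap {w : Perm (Fin n)} {i j : Fin n} (hij : i < j) (h : w i < w j) :
    len w < len (w * swap i j) := by
  have := len_mul_swap_lt (w := w * swap i j) hij (by simpa using h)
  rwa [mul_assoc, swap_mul_self, mul_one] at this

theorem len_mul_swap_lt_iff {w : Perm (Fin n)} {i j : Fin n} (hij : i < j) :
    len (w * swap i j) < len w ↔ w j < w i := by
  refine ⟨fun h => ?_, len_mul_swap_lt hij⟩
  by_contra h'
  have := lt_len_mul_swap (w := w) hij (lt_of_le_of_ne (not_lt.1 h') fun e =>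
      hij.ne (w.injective e))
  omega

theorem len_mul_simple_le (w : Perm (Fin n))
    (x : Fin (n - 1)) : len (w * simple n x) ≤ len w + 1 := by
  obtain ⟨a, rfl, ha⟩ := exists_reduced w
  have := len_wordProd_le (a ++ [x])
  rw [wordProd_append, wordProd_cons, wordProd_nil, mul_one] at this
  simpa [ha] using this

theorem len_mul_simple {w : Perm (Fin n)} {x : Fin (n - 1)}
    (h : w ⟨x, by omega⟩ < w ⟨x + 1, by omega⟩) : len (w * simple n x) = len w + 1 := by
  have h1 := len_mul_simple_le w x
  have := lt_len_mul_swap (w := w) (i := ⟨x, by omega⟩) (j := ⟨x + 1, by omega⟩)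
      (by simp [Fin.lt_def]) h
  rw [← simple_eq] at this
  omega

theorem len_mul_simple' {w : Perm (Fin n)} {x : Fin (n - 1)}
    (h : w ⟨x + 1, by omega⟩ < w ⟨x, by omega⟩) : len (w * simple n x) + 1 = len w := by
  have := len_mul_simple (w := w * simple n x) (x := x) (by simpa [simple_eq] using h)
  rw [mul_assoc, simple_mul_self, mul_one] at this
  exact this.symm

theorem len_simple_mul {w : Perm (Fin n)} {x : Fin (n - 1)}
    (h : w⁻¹ ⟨x, by omega⟩ < w⁻¹ ⟨x + 1, by omega⟩) : len (simple n x * w) = len w + 1 := by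
  rw [← len_inv, mul_inv_rev, simple_inv, len_mul_simple h, len_inv]

theorem len_simple_mul' {w : Perm (Fin n)} {x : Fin (n - 1)}
    (h : w⁻¹ ⟨x + 1, by omega⟩ < w⁻¹ ⟨x, by omega⟩) : len (simple n x * w) + 1 = len w := by
  rw [← len_inv, mul_inv_rev, simple_inv, len_mul_simple' h, len_inv]

theorem inv_apply_lt_or (w : Perm (Fin n)) (x : Fin (n - 1)) :
    w ⟨x, by omega⟩ < w ⟨x + 1, by omega⟩ ∨ w ⟨x + 1, by omega⟩ < w ⟨x, by omega⟩ :=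
  lt_or_gt_of_ne fun e => by simpa using w.injective e

theorem simple_mul_eq_mul_swap (w : Perm (Fin n)) (x : Fin (n - 1)) :
    simple n x * w = w * swap (w⁻¹ ⟨x, by omega⟩) (w⁻¹ ⟨x + 1, by omega⟩) := by
  rw [Equiv.mul_swap_eq_swap_mul]; simp [simple_eq]

/-- In a Bruhat cover no value between the exchanged ones stands between them. -/
theorem not_between_of_len {v : Perm (Fin n)} {i j e : Fin n} (hie : i < e) (hej : e < j)
    (h1 : v i < v e) (h2 : v e < v j) : len v + 3 ≤ len (v * swap i j) := by
  -- Write `t_ij = t_ie t_ej t_ie`. Each of the three factors in turn increases the length.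
  have e1 := lt_len_mul_swap hie h1
  have e2 := lt_len_mul_swap (w := v * swap i e) hej (by
    simp [swap_apply_of_ne_of_ne (hie.trans hej).ne' hej.ne', h1.trans h2])
  have e3 := lt_len_mul_swap (w := v * swap i e * swap e j) hie (by
    simp [swap_apply_of_ne_of_ne (hie.trans hej).ne' hej.ne',
        swap_apply_of_ne_of_ne hie.ne (hie.trans hej).ne, h2])
  have : v * swap i e * swap e j * swap i e = v * swap i j := by
    rw [mul_assoc, mul_assoc, ← mul_assoc (swap i e), swap_comm i e, swap_comm e j,
      swap_mul_swap_mul_swap hej.ne' (hie.trans hej).ne']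
  rw [this] at e3
  omega

/-- The word `a` is reduced in the symmetric group. -/
def Reduced (a : Word n) : Prop := len (wordProd a) = a.length

theorem Reduced.tail {x : Fin (n - 1)} {a : Word n} (h : Reduced (x :: a)) : Reduced a := by
  unfold Reduced at *
  have h1 := len_wordProd_le a
  have h2 := len_mul_simple_le (wordProd a)⁻¹ x
  rw [← len_inv, mul_inv_rev, inv_inv, simple_inv, ← wordProd_cons, h, len_inv,
      List.length_cons] at h2
  omega

theorem len_cons_of_not_reduced {x : Fin (n - 1)} {a : Word n} (ha : Reduced a)
    (h : ¬ Reduced (x :: a)) : len (simple n x * wordProd a) + 1 = len (wordProd a) := by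
  rcases inv_apply_lt_or (wordProd a)⁻¹ x with h' | h'
  · refine absurd ?_ h
    rw [Reduced, wordProd_cons, len_simple_mul h', ha, List.length_cons]
  · exact len_simple_mul' h'

/-- The exchange property. -/
theorem exchange {x : Fin (n - 1)} {a : Word n}
    (h : len (simple n x * wordProd a) < len (wordProd a)) :
    ∃ k : Fin a.length, wordProd (a.eraseIdx k) = simple n x * wordProd a := by
  set w := wordProd a with hw
  rcases inv_apply_lt_or w⁻¹ x with h' | h'
  · rw [len_simple_mul h'] at h; omega
  · obtain ⟨k, hk⟩ := exists_eraseIdx (a := a) h' (by simp [← hw, Fin.lt_def])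
    exact ⟨k, by rw [hk, simple_mul_eq_mul_swap, swap_comm]⟩

theorem exists_swap_eraseIdx (a : Word n) (m : Fin a.length) :
    ∃ i j : Fin n, i ≠ j ∧ wordProd (a.eraseIdx m) = wordProd a * swap i j := by
  induction a with
  | nil => exact absurd m.2 (by simp)
  | cons y a ih =>
    rcases m with ⟨_ | m, hm⟩
    · refine ⟨(wordProd a)⁻¹ ⟨y, by omega⟩, (wordProd a)⁻¹ ⟨y + 1, by omega⟩, fun e => ?_, ?_⟩
      · simpa using (wordProd a)⁻¹.injective e
      · simp only [List.eraseIdx_cons_zero]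
        rw [wordProd_cons, mul_assoc, ← simple_mul_eq_mul_swap, simple_mul_cancel_left]
    · obtain ⟨i, j, hne, e⟩ := ih ⟨m, by simpa using hm⟩
      exact ⟨i, j, hne, by simp only [List.eraseIdx_cons_succ, wordProd_cons, mul_assoc]; rw [← e]⟩

/-- The lifting property for a letter deleted from a reduced word. -/
theorem lifting {x : Fin (n - 1)} {a : Word n} {m : Fin a.length} (ha : Reduced a)
    (hm : Reduced (x :: a.eraseIdx m)) (h : ¬ Reduced (x :: a)) :
    wordProd a = wordProd (x :: a.eraseIdx m) := by
  have hl := len_cons_of_not_reduced ha h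
  obtain ⟨b, hb, hbl⟩ := exists_reduced (simple n x * wordProd a)
  have hxb : wordProd (x :: b) = wordProd a := by rw [wordProd_cons, hb, simple_mul_cancel_left]
  have e1 := length_eraseIdx' m
  have e2 : len (wordProd (a.eraseIdx m)) = (a.eraseIdx m).length := hm.tail
  have e3 : len (wordProd (x :: a.eraseIdx m)) = (a.eraseIdx m).length + 1 := hm
  have e4 : len (wordProd a) = a.length := ha
  obtain ⟨i, j, hij, hlt, e⟩ : ∃ i j : Fin n, i < j ∧ wordProd a j < wordProd a i ∧
      wordProd (a.eraseIdx m) = wordProd a * swap i j := by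
    obtain ⟨i, j, hne, e⟩ := exists_swap_eraseIdx a m
    rcases lt_or_gt_of_ne hne with h' | h'
    · refine ⟨i, j, h', ?_, e⟩
      rw [← len_mul_swap_lt_iff h', ← e]; omega
    · refine ⟨j, i, h', ?_, by rw [e, swap_comm]⟩
      rw [← len_mul_swap_lt_iff h', swap_comm, ← e]; omega
  -- Strong exchange is applied to the reduced word `x :: b` of `wordProd a`. Deleting `x` gives the
  -- claim. Deleting a letter of `b` would express `x :: a.eraseIdx m` by a word with two letters
  -- fewer, against `hm`.
  rw [← hxb] at hlt
  obtain ⟨⟨k, hk⟩, hk'⟩ := exists_eraseIdx hij hlt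
  rw [hxb, ← e] at hk'
  rcases k with _ | k
  · simp only [List.eraseIdx_cons_zero] at hk'
    rw [wordProd_cons, ← hk', hb, simple_mul_cancel_left]
  · simp only [List.eraseIdx_cons_succ, wordProd_cons] at hk' e3
    have e5 := len_wordProd_le (b.eraseIdx k)
    rw [← hk', simple_mul_cancel_left] at e3
    have := length_eraseIdx' (a := b) ⟨k, by simpa using hk⟩
    simp only at this
    omega

/-- If deleting a letter makes a word reduced, then its product is determined by the word. -/
theorem exists_wordProd_eraseIdx_eq {a : Word n} (ha : ¬ Reduced a) :
    ∃ w : Perm (Fin n), ∀ k : Fin a.length, Reduced (a.eraseIdx k) → wordProd (a.eraseIdx k) = w :=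
        by
  induction a with
  | nil => exact absurd len_one ha
  | cons x a ih =>
    by_cases h : Reduced a
    · refine ⟨wordProd a, ?_⟩
      rintro ⟨_ | k, hk⟩ hr
      · rfl
      · exact (lifting (m := ⟨k, by simpa using hk⟩) h hr ha).symm
    · obtain ⟨w, hw⟩ := ih h
      refine ⟨simple n x * w, ?_⟩
      rintro ⟨_ | k, hk⟩ hr
      · exact absurd hr h
      · simp only [List.eraseIdx_cons_succ, wordProd_cons] at hr ⊢
        rw [hw ⟨k, by simpa using hk⟩ hr.tail]

/-- The induction runs down to the shortest suffix that is not reduced. Its tail is reduced, so its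
first letter pairs with a letter of the tail: by `exchange` if the first letter was deleted, and by
`lifting` otherwise. -/
theorem exists_ne_wordProd_eraseIdx {a : Word n} (ha : ¬ Reduced a) (m : Fin a.length)
    (hm : Reduced (a.eraseIdx m)) :
    ∃ k : Fin a.length, k ≠ m ∧ wordProd (a.eraseIdx k) = wordProd (a.eraseIdx m) := by
  induction a with
  | nil => exact absurd m.2 (by simp)
  | cons x a ih =>
    by_cases h : Reduced a
    · rcases m with ⟨_ | m, hm'⟩
      · have := len_cons_of_not_reduced h ha
        obtain ⟨k, hk⟩ := exchange (x := x) (a := a) (by omega)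
        refine ⟨k.succ, by simp [Fin.ext_iff], ?_⟩
        simp [wordProd_cons, hk, simple_mul_cancel_left]
      · exact ⟨⟨0, by simp⟩, by simp [Fin.ext_iff],
          lifting (m := ⟨m, by simpa using hm'⟩) h hm ha⟩
    · rcases m with ⟨_ | m, hm'⟩
      · exact absurd hm h
      · obtain ⟨k, hk, hk'⟩ := ih h ⟨m, by simpa using hm'⟩ (Reduced.tail hm)
        refine ⟨k.succ, by simpa [Fin.ext_iff] using hk, ?_⟩
        simp only [Fin.val_succ, List.eraseIdx_cons_succ, wordProd_cons, hk']

/-- Equality of the two deletions means that moving the letter `k` across the stretch up to `l`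
turns it into the letter `l`, so that the two letters cancel. -/
theorem wordProd_eq_of_eraseIdx_eq {a : Word n} {k l : ℕ} (hkl : k < l) (hl : l < a.length)
    (h : wordProd (a.eraseIdx k) = wordProd (a.eraseIdx l)) :
    wordProd a = wordProd ((a.eraseIdx l).eraseIdx k) := by
  induction a generalizing k l with
  | nil => simp at hl
  | cons x a ih =>
    obtain ⟨l, rfl⟩ : ∃ l', l = l' + 1 := ⟨l - 1, by omega⟩
    rcases k with _ | k
    · simp only [List.eraseIdx_cons_zero, List.eraseIdx_cons_succ, wordProd_cons] at h ⊢
      rw [h, simple_mul_cancel_left]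
    · simp only [List.eraseIdx_cons_succ, wordProd_cons, mul_right_inj] at h ⊢
      exact ih (by omega) (by simpa using hl) h

/-- Deleting the letter `k` multiplies the product on the left by a reflection that depends only on
the letters up to `k`. A deletion further right does not affect it. -/
theorem wordProd_eraseIdx_mul_inv {a : Word n} {k l : ℕ} (hkl : k < l) (hl : l < a.length) :
    wordProd ((a.eraseIdx l).eraseIdx k) * (wordProd (a.eraseIdx l))⁻¹ =
      wordProd (a.eraseIdx k) * (wordProd a)⁻¹ := by
  induction a generalizing k l with
  | nil => simp at hl
  | cons x a ih =>
    obtain ⟨l, rfl⟩ : ∃ l', l = l' + 1 := ⟨l - 1, by omega⟩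
    rcases k with _ | k
    · simp [wordProd_cons]
    · simp only [List.eraseIdx_cons_succ, wordProd_cons, mul_inv_rev]
      have := ih (k := k) (l := l) (by omega) (by simpa using hl)
      rw [mul_assoc, ← mul_assoc (wordProd _) _ (simple n x)⁻¹, this]
      group

theorem Reduced.eraseIdx_ne {a : Word n} (ha : Reduced a) {k l : ℕ} (hkl : k < l)
    (hl : l < a.length) :
    wordProd (a.eraseIdx k) ≠ wordProd (a.eraseIdx l) := by
  intro h
  have h1 := wordProd_eq_of_eraseIdx_eq hkl hl h
  have h2 := len_wordProd_le ((a.eraseIdx l).eraseIdx k)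
  rw [← h1, ha, List.length_eraseIdx_of_lt (by rw [List.length_eraseIdx_of_lt hl]; omega),
    List.length_eraseIdx_of_lt hl] at h2
  omega

theorem Reduced.eraseIdx_injective {a : Word n} (ha : Reduced a) {k l : Fin a.length}
    (h : wordProd (a.eraseIdx k) = wordProd (a.eraseIdx l)) : k = l := by
  rcases lt_trichotomy k l with hkl | hkl | hkl
  · exact absurd h (ha.eraseIdx_ne hkl l.2)
  · exact hkl
  · exact absurd h.symm (ha.eraseIdx_ne hkl k.2)

/-- By `wordProd_eraseIdx_mul_inv`, the deletions of `k` and `l` still agree once `m` is gone, and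
in a reduced word distinct deletions have distinct products. -/
theorem not_reduced_of_three {a : Word n} {k l m : ℕ} (hkl : k < l) (hlm : l < m)
    (hm : m < a.length)
    (h : wordProd (a.eraseIdx k) = wordProd (a.eraseIdx l)) : ¬ Reduced (a.eraseIdx m) := fun hr =>
  hr.eraseIdx_ne hkl (by rw [List.length_eraseIdx_of_lt hm]; omega) <| by
    have h1 := wordProd_eraseIdx_mul_inv (a := a) (hkl.trans hlm) hm
    rw [h, ← wordProd_eraseIdx_mul_inv hlm hm] at h1
    exact mul_right_cancel h1

/-- A word that is not reduced, but becomes reduced by deleting the letter `m`, becomes reduced by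
deleting exactly one other letter. -/
theorem existsUnique_eraseIdx {a : Word n} (ha : ¬ Reduced a) (m : Fin a.length)
    (hm : Reduced (a.eraseIdx m)) :
    ∃ k : Fin a.length, k ≠ m ∧ wordProd (a.eraseIdx k) = wordProd (a.eraseIdx m) ∧
      ∀ l : Fin a.length, l ≠ m → Reduced (a.eraseIdx l) → l = k := by
  obtain ⟨k, hkm, hk⟩ := exists_ne_wordProd_eraseIdx ha m hm
  obtain ⟨w, hw⟩ := exists_wordProd_eraseIdx_eq ha
  refine ⟨k, hkm, hk, fun l hlm hl => ?_⟩
  have hkr : Reduced (a.eraseIdx k) := by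
    have h1 := length_eraseIdx' k
    have h2 := length_eraseIdx' m
    rw [Reduced, hk, hm]; omega
  -- All reduced deletions have the product `w`, so the two leftmost of any three exclude the third.
  have key : ∀ x y z : Fin a.length, x < y → y < z → Reduced (a.eraseIdx x) →
      Reduced (a.eraseIdx y) →
      ¬ Reduced (a.eraseIdx z) := fun x y z hxy hyz hx hy =>
    not_reduced_of_three hxy hyz z.2 ((hw x hx).trans (hw y hy).symm)
  by_contra hlk
  rcases lt_or_gt_of_ne hkm with h1 | h1 <;> rcases lt_or_gt_of_ne hlm with h2 | h2 <;>
    rcases lt_or_gt_of_ne hlk with h3 | h3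
  · exact key l k m h3 h1 hl hkr hm
  · exact key k l m h3 h2 hkr hl hm
  · omega
  · exact key k m l h1 h2 hkr hm hl
  · exact key l m k h2 h1 hl hm hkr
  · omega
  · exact key m l k h2 h3 hm hl hkr
  · exact key m k l h1 h3 hm hkr hl
end MuInv

/-! ### Standardization of blocks -/

namespace MuInv
open Equiv
variable {n : ℕ} {μ : Composition n}

theorem monotone_index (μ : Composition n) : Monotone μ.index := by
  intro p q hpq
  by_contra h
  have h1 := μ.lt_sizeUpTo_index_succ q
  have h2 := μ.sizeUpTo_index_le p
  have h3 := μ.monotone_sizeUpTo (show (μ.index q).succ.1 ≤ (μ.index p).1 by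
    have := not_le.1 h; rw [Fin.lt_def] at this; simpa using this)
  have : p.1 ≤ q.1 := hpq
  omega

theorem lt_of_index_lt {p q : Fin n} (h : μ.index p < μ.index q) : p < q := by
  by_contra h'
  exact absurd (monotone_index μ (not_lt.1 h')) (not_le.2 h)

theorem blockStd_embedding (π : Perm (Fin n)) (b : Fin μ.length) (p : Fin (μ.blocksFun b)) :
    blockStd μ π (μ.embedding b p) = μ.embedding b (std (block μ π b) p) := by
  have : μ.embedding b p = μ.blocksFinEquiv ⟨b, p⟩ := rfl
  rw [this, blockStd, permCongr_apply, symm_apply_apply]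
  rfl

theorem block_injective (π : Perm (Fin n)) (b : Fin μ.length) : Function.Injective (block μ π b) :=
  π.injective.comp (μ.embedding b).injective

theorem index_blockStd (π : Perm (Fin n)) (p : Fin n) :
    μ.index (blockStd μ π p) = μ.index p := by
  rw [← μ.embedding_comp_inv p, blockStd_embedding, μ.index_embedding, μ.index_embedding]

theorem blockStd_lt_iff (π : Perm (Fin n)) {p q : Fin n} (h : μ.index p = μ.index q) :
    blockStd μ π p < blockStd μ π q ↔ π p < π q := by
  obtain ⟨b, p', rfl⟩ : ∃ b p', p = μ.embedding b p' := ⟨_, _, (μ.embedding_comp_inv p).symm⟩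
  rw [μ.index_embedding] at h
  obtain ⟨q', rfl⟩ : ∃ q', q = μ.embedding b q' := by
    subst h; exact ⟨_, (μ.embedding_comp_inv q).symm⟩
  rw [blockStd_embedding, blockStd_embedding, OrderEmbedding.lt_iff_lt,
    std_lt_std_iff (block_injective π b)]
  rfl

/-- Both permutations preserve the consecutive intervals and order each of them alike, so `b' * b⁻¹`
is strictly increasing on `Fin n`, hence the identity. -/
theorem eq_of_index_of_lt_iff {b b' : Perm (Fin n)} (h : ∀ p, μ.index (b p) = μ.index p)
    (h' : ∀ p, μ.index (b' p) = μ.index p)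
    (hlt : ∀ p q, μ.index p = μ.index q → (b p < b q ↔ b' p < b' q)) : b = b' := by
  have hmono : StrictMono (b' * b⁻¹) := by
    intro p q hpq
    obtain ⟨p, rfl⟩ := b.surjective p
    obtain ⟨q, rfl⟩ := b.surjective q
    simp only [Perm.mul_apply, Perm.inv_def, symm_apply_apply]
    rcases (monotone_index μ hpq.le).lt_or_eq with hi | hi <;> rw [h, h] at hi
    · exact lt_of_index_lt (μ := μ) (by rwa [h', h'])
    · exact (hlt p q hi).1 hpq
  have := Subsingleton.elim (hmono.orderIsoOfSurjective _ (b' * b⁻¹).surjective) (OrderIso.refl _)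
  ext p : 1
  have := DFunLike.congr_fun this (b p)
  simpa using this.symm

theorem blockStd_unique {π b : Perm (Fin n)} (h : ∀ p, μ.index (b p) = μ.index p)
    (hlt : ∀ p q, μ.index p = μ.index q → (b p < b q ↔ π p < π q)) : blockStd μ π = b :=
  eq_of_index_of_lt_iff (index_blockStd π) h fun p q hpq => by
    rw [blockStd_lt_iff π hpq, hlt p q hpq]

theorem mem_muInvolutions {π : Perm (Fin n)} :
    π ∈ muInvolutions μ ↔ ∀ p, blockStd μ π (blockStd μ π p) = p := by
  constructor
  · intro h p
    rw [← μ.embedding_comp_inv p, blockStd_embedding, blockStd_embedding]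
    rw [← Perm.mul_apply, inv_eq_iff_mul_eq_one.1 (h _), Perm.one_apply]
  · intro h b
    rw [inv_eq_iff_mul_eq_one]
    ext p : 1
    have := h (μ.embedding b p)
    rw [blockStd_embedding, blockStd_embedding] at this
    exact (μ.embedding b).injective this

/-- Two letters in a block that are consecutive values have consecutive ranks. -/
theorem blockStd_succ {π : Perm (Fin n)} {x : Fin (n - 1)}
    (h : μ.index (π⁻¹ ⟨x, by omega⟩) = μ.index (π⁻¹ ⟨x + 1, by omega⟩)) :
    (blockStd μ π (π⁻¹ ⟨x + 1, by omega⟩)).1 = blockStd μ π (π⁻¹ ⟨x, by omega⟩) + 1 := by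
  set β := blockStd μ π with hβ
  set r := π⁻¹ ⟨x, by omega⟩ with hr
  set r' := π⁻¹ ⟨x + 1, by omega⟩ with hr'
  have e1 : π r = ⟨x, by omega⟩ := by simp [hr]
  have e2 : π r' = ⟨x + 1, by omega⟩ := by simp [hr']
  have hlt : β r < β r' := by
    rw [blockStd_lt_iff π h, e1, e2]; simp [Fin.lt_def]
  by_contra hne
  have hlt' : (β r).1 < β r' := hlt
  -- If the ranks were not consecutive, the letter of the skipped rank would lie strictly between
  -- `x` and `x + 1`.
  let t : Fin n := ⟨β r + 1, by omega⟩
  obtain ⟨p, hp⟩ := β.surjective t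
  have h1 : β r < β p := by rw [hp]; simp [t, Fin.lt_def]
  have h2 : β p < β r' := by rw [hp]; simp only [t, Fin.lt_def]; omega
  have i1 : μ.index r ≤ μ.index p := by
    have := monotone_index μ h1.le; rwa [hβ, index_blockStd, index_blockStd] at this
  have i2 : μ.index p ≤ μ.index r' := by
    have := monotone_index μ h2.le; rwa [hβ, index_blockStd, index_blockStd] at this
  have i3 : μ.index p = μ.index r := le_antisymm (i2.trans h.ge) i1
  have h1' := (blockStd_lt_iff π i3.symm).1 h1
  have h2' := (blockStd_lt_iff π (i3.trans h)).1 h2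
  rw [e1, Fin.lt_def] at h1'
  rw [e2, Fin.lt_def] at h2'
  simp only at h1' h2'
  omega

theorem simple_lt_iff {x : Fin (n - 1)} {p q : Fin n}
    (h : ¬ (p.1 = x ∧ q.1 = x + 1)) (h' : ¬ (q.1 = x ∧ p.1 = x + 1)) :
    simple n x p < simple n x q ↔ p < q := by
  rcases lt_trichotomy p q with hpq | rfl | hpq
  · simp only [hpq, iff_true]
    by_contra hc
    rcases (not_lt.1 hc).lt_or_eq with hc | hc
    · exact h (simple_apply_lt hpq hc)
    · exact hpq.ne' ((simple n x).injective hc)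
  · simp
  · simp only [hpq.not_gt, iff_false]
    intro hc
    exact h' (simple_apply_lt hpq hc)

theorem simple_apply_left (x : Fin (n - 1)) : simple n x ⟨x, by omega⟩ = ⟨x + 1, by omega⟩ := by
  rw [simple_eq, swap_apply_left]

theorem simple_apply_right (x : Fin (n - 1)) : simple n x ⟨x + 1, by omega⟩ = ⟨x, by omega⟩ := by
  rw [simple_eq, swap_apply_right]

theorem simple_apply_simple (x : Fin (n - 1)) (p : Fin n) : simple n x (simple n x p) = p := by
  rw [← Perm.mul_apply, simple_mul_self, Perm.one_apply]

theorem simple_apply_of_ne {x : Fin (n - 1)} {p : Fin n} (h : p.1 ≠ x) (h' : p.1 ≠ x + 1) :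
    simple n x p = p := by
  rw [simple_eq, swap_apply_of_ne_of_ne] <;> simpa [Fin.ext_iff]

end MuInv

/-! ### The action of a letter on `μ`-involutions, and its rank function -/

namespace MuInv
open Equiv
variable {n : ℕ} {μ : Composition n}

/-- The smaller of the two values exchanged by `simple n x`. -/
abbrev lo (x : Fin (n - 1)) : Fin n := ⟨x, by omega⟩

/-- The larger of the two values exchanged by `simple n x`. -/
abbrev hi (x : Fin (n - 1)) : Fin n := ⟨x + 1, by omega⟩

theorem lo_lt_hi (x : Fin (n - 1)) : lo x < hi x := by simp [Fin.lt_def]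

theorem index_simple {c : Fin (n - 1)} (h : μ.index (lo c) = μ.index (hi c)) (p : Fin n) :
    μ.index (simple n c p) = μ.index p := by
  rw [simple_eq, swap_apply_def]
  split_ifs with h1 h2
  · rw [h1]; exact h.symm
  · rw [h2]; exact h
  · rfl

section moves

variable {π : Perm (Fin n)} {x c : Fin (n - 1)}

theorem blockStd_hi (hb : μ.index (π⁻¹ (lo x)) = μ.index (π⁻¹ (hi x)))
    (hc : blockStd μ π (π⁻¹ (lo x)) = lo c) : blockStd μ π (π⁻¹ (hi x)) = hi c :=
  Fin.ext (by rw [blockStd_succ hb, hc])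

theorem exists_rank (hb : μ.index (π⁻¹ (lo x)) = μ.index (π⁻¹ (hi x))) :
    ∃ c : Fin (n - 1), blockStd μ π (π⁻¹ (lo x)) = lo c := by
  have h := blockStd_succ hb
  have := (blockStd μ π (π⁻¹ (hi x))).2
  exact ⟨⟨blockStd μ π (π⁻¹ (lo x)), by simp only [lo, hi] at *; omega⟩, rfl⟩

theorem index_lo_hi (hb : μ.index (π⁻¹ (lo x)) = μ.index (π⁻¹ (hi x)))
    (hc : blockStd μ π (π⁻¹ (lo x)) = lo c) : μ.index (lo c) = μ.index (hi c) := by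
  rw [← hc, ← blockStd_hi hb hc, index_blockStd, index_blockStd, hb]

theorem assoc_apply (z : Fin n) : assocInvolution μ π z = π (blockStd μ π (π⁻¹ z)) := rfl

theorem assoc_lo (hc : blockStd μ π (π⁻¹ (lo x)) = lo c) :
    assocInvolution μ π (lo x) = π (lo c) := by rw [assoc_apply, hc]

theorem assoc_hi (hb : μ.index (π⁻¹ (lo x)) = μ.index (π⁻¹ (hi x)))
    (hc : blockStd μ π (π⁻¹ (lo x)) = lo c) :
    assocInvolution μ π (hi x) = π (hi c) := by rw [assoc_apply, blockStd_hi hb hc]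

/-- Since the block standardization is an involution, the partners of two letters of a block are
ordered like the positions of these letters in `π`. Thus `y_π` already records the order within
blocks. -/
theorem assoc_lt_iff (hπ : π ∈ muInvolutions μ) {a b : Fin n}
    (hb : μ.index (π⁻¹ a) = μ.index (π⁻¹ b)) :
    assocInvolution μ π a < assocInvolution μ π b ↔ π⁻¹ a < π⁻¹ b := by
  rw [assoc_apply, assoc_apply, ← blockStd_lt_iff π (by rw [index_blockStd, index_blockStd, hb]),
    mem_muInvolutions.1 hπ, mem_muInvolutions.1 hπ]

theorem assoc_assoc (hπ : π ∈ muInvolutions μ) (a : Fin n) :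
    assocInvolution μ π (assocInvolution μ π a) = a := by
  rw [assoc_apply, assoc_apply]; simp [mem_muInvolutions.1 hπ]

theorem index_assoc (a : Fin n) : μ.index (π⁻¹ (assocInvolution μ π a)) = μ.index (π⁻¹ a) := by
  rw [assoc_apply]; simp [index_blockStd]

theorem eq_inv_iff (p : Fin n) (z : Fin n) : p = π⁻¹ z ↔ π p = z := by
  constructor
  · rintro rfl; simp
  · rintro rfl; simp

theorem blockStd_simple_mul_of_ne (hb : μ.index (π⁻¹ (lo x)) ≠ μ.index (π⁻¹ (hi x))) :
    blockStd μ (simple n x * π) = blockStd μ π := by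
  refine blockStd_unique (index_blockStd π) fun p q hpq => ?_
  rw [blockStd_lt_iff π hpq, Perm.mul_apply, Perm.mul_apply, simple_lt_iff]
  · rintro ⟨h1, h2⟩
    apply hb
    rw [← (eq_inv_iff (π := π) p (lo x)).2 (Fin.ext h1),
        ← (eq_inv_iff (π := π) q (hi x)).2 (Fin.ext h2), hpq]
  · rintro ⟨h1, h2⟩
    apply hb
    rw [← (eq_inv_iff (π := π) q (lo x)).2 (Fin.ext h1),
        ← (eq_inv_iff (π := π) p (hi x)).2 (Fin.ext h2), hpq]

theorem simple_blockStd_lt_iff (hb : μ.index (π⁻¹ (lo x)) = μ.index (π⁻¹ (hi x)))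
    (hc : blockStd μ π (π⁻¹ (lo x)) = lo c) {p q : Fin n} (hpq : μ.index p = μ.index q) :
    simple n c (blockStd μ π p) < simple n c (blockStd μ π q) ↔
        simple n x (π p) < simple n x (π q) := by
  have hc' := blockStd_hi hb hc
  have h1 : ∀ p, π p = lo x ↔ blockStd μ π p = lo c := fun p => by
    rw [← hc, (blockStd μ π).apply_eq_iff_eq, eq_inv_iff]
  have h2 : ∀ p, π p = hi x ↔ blockStd μ π p = hi c := fun p => by
    rw [← hc', (blockStd μ π).apply_eq_iff_eq, eq_inv_iff]
  by_cases e1 : π p = lo x ∧ π q = hi x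
  · have := (h1 p).1 e1.1
    have := (h2 q).1 e1.2
    simp only [*, simple_apply_left, simple_apply_right]
    simp [Fin.lt_def]
  by_cases e2 : π q = lo x ∧ π p = hi x
  · have := (h1 q).1 e2.1
    have := (h2 p).1 e2.2
    simp only [*, simple_apply_left, simple_apply_right]
    simp [Fin.lt_def]
  have f1 := e1
  have f2 := e2
  rw [h1, h2] at f1 f2
  simp only [Fin.ext_iff] at e1 e2 f1 f2
  rw [simple_lt_iff f1 f2, simple_lt_iff e1 e2, blockStd_lt_iff π hpq]

theorem blockStd_conj (hb : μ.index (π⁻¹ (lo x)) = μ.index (π⁻¹ (hi x)))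
    (hc : blockStd μ π (π⁻¹ (lo x)) = lo c) :
    blockStd μ (simple n x * π * simple n c) = simple n c * blockStd μ π * simple n c := by
  have hi := index_simple (index_lo_hi hb hc)
  refine blockStd_unique (fun p => ?_) fun p q hpq => ?_
  · simp [hi, index_blockStd]
  · simp only [Perm.mul_apply]
    exact simple_blockStd_lt_iff hb hc (by rw [hi, hi, hpq])

theorem blockStd_link (hb : μ.index (π⁻¹ (lo x)) = μ.index (π⁻¹ (hi x)))
    (hc : blockStd μ π (π⁻¹ (lo x)) = lo c) :
    blockStd μ (simple n x * π) = simple n c * blockStd μ π := by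
  have hi := index_simple (index_lo_hi hb hc)
  refine blockStd_unique (fun p => ?_) fun p q hpq => ?_
  · simp [hi, index_blockStd]
  · exact simple_blockStd_lt_iff hb hc hpq

theorem simple_mul_comm_of (h : (π (lo c) = lo x ∧ π (hi c) = hi x) ∨
    (π (lo c) = hi x ∧ π (hi c) = lo x)) :
    π * simple n c = simple n x * π := by
  rw [simple_eq c, mul_swap_eq_swap_mul, simple_eq x]
  rcases h with h | h
  · rw [h.1, h.2]
  · rw [h.1, h.2, swap_comm]

theorem blockStd_comm_of (hπ : π ∈ muInvolutions μ)
    (hb : μ.index (π⁻¹ (lo x)) = μ.index (π⁻¹ (hi x)))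
    (hc : blockStd μ π (π⁻¹ (lo x)) = lo c)
    (h : (π (lo c) = lo x ∧ π (hi c) = hi x) ∨ (π (lo c) = hi x ∧ π (hi c) = lo x)) :
    blockStd μ π * simple n c = simple n c * blockStd μ π := by
  have hc' := blockStd_hi hb hc
  have hβ := mem_muInvolutions.1 hπ
  rcases h with ⟨h1, h2⟩ | ⟨h1, h2⟩
  · rw [← (eq_inv_iff _ _).2 h1] at hc
    rw [← (eq_inv_iff _ _).2 h2] at hc'
    exact simple_mul_comm_of (Or.inl ⟨hc, hc'⟩)
  · rw [← (eq_inv_iff _ _).2 h1] at hc'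
    rw [← (eq_inv_iff _ _).2 h2] at hc
    exact simple_mul_comm_of (Or.inr ⟨hc', hc⟩)

theorem conj_mem (hπ : π ∈ muInvolutions μ) (hb : μ.index (π⁻¹ (lo x)) = μ.index (π⁻¹ (hi x)))
    (hc : blockStd μ π (π⁻¹ (lo x)) = lo c) : simple n x * π * simple n c ∈ muInvolutions μ := by
  rw [mem_muInvolutions, blockStd_conj hb hc]
  intro p
  simp [simple_apply_simple, mem_muInvolutions.1 hπ]

theorem link_mem (hπ : π ∈ muInvolutions μ) (hb : μ.index (π⁻¹ (lo x)) = μ.index (π⁻¹ (hi x)))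
    (hc : blockStd μ π (π⁻¹ (lo x)) = lo c)
    (h : (π (lo c) = lo x ∧ π (hi c) = hi x) ∨ (π (lo c) = hi x ∧ π (hi c) = lo x)) :
    simple n x * π ∈ muInvolutions μ := by
  have hcomm := blockStd_comm_of hπ hb hc h
  rw [mem_muInvolutions, blockStd_link hb hc]
  intro p
  rw [← Perm.mul_apply]
  conv_lhs => enter [1, 1]; rw [← hcomm]
  simp [simple_apply_simple, mem_muInvolutions.1 hπ]

theorem cross_mem (hπ : π ∈ muInvolutions μ) (hb : μ.index (π⁻¹ (lo x)) ≠ μ.index (π⁻¹ (hi x))) :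
    simple n x * π ∈ muInvolutions μ := by
  rw [mem_muInvolutions, blockStd_simple_mul_of_ne hb]
  exact mem_muInvolutions.1 hπ

theorem assoc_conj (hb : μ.index (π⁻¹ (lo x)) = μ.index (π⁻¹ (hi x)))
    (hc : blockStd μ π (π⁻¹ (lo x)) = lo c) :
    assocInvolution μ (simple n x * π * simple n c) =
      simple n x * assocInvolution μ π * simple n x := by
  rw [assocInvolution, blockStd_conj hb hc, assocInvolution]
  simp only [mul_inv_rev, simple_inv]
  simp only [mul_assoc, simple_mul_cancel_left]

theorem assoc_cross (hb : μ.index (π⁻¹ (lo x)) ≠ μ.index (π⁻¹ (hi x))) :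
    assocInvolution μ (simple n x * π) = simple n x * assocInvolution μ π * simple n x := by
  rw [assocInvolution, blockStd_simple_mul_of_ne hb, assocInvolution]
  simp only [mul_inv_rev, simple_inv, mul_assoc]

theorem assoc_link (hb : μ.index (π⁻¹ (lo x)) = μ.index (π⁻¹ (hi x)))
    (hc : blockStd μ π (π⁻¹ (lo x)) = lo c)
    (h : (π (lo c) = lo x ∧ π (hi c) = hi x) ∨ (π (lo c) = hi x ∧ π (hi c) = lo x)) :
    assocInvolution μ (simple n x * π) = assocInvolution μ π * simple n x := by
  rw [assocInvolution, blockStd_link hb hc, assocInvolution, ← mul_assoc, mul_assoc (simple n x) π,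
    simple_mul_comm_of h, simple_mul_cancel_left]
  simp only [mul_inv_rev, simple_inv, mul_assoc]

theorem heckeLeft_of_lt (h : π⁻¹ (lo x) < π⁻¹ (hi x)) : heckeLeft x π = simple n x * π := by
  rw [heckeLeft, if_pos (by rw [len_simple_mul h]; omega)]

theorem heckeLeft_of_gt (h : π⁻¹ (hi x) < π⁻¹ (lo x)) : heckeLeft x π = π := by
  rw [heckeLeft, if_neg (by have := len_simple_mul' h; omega)]

theorem heckeRight_of_lt (h : π (lo c) < π (hi c)) : heckeRight π c = π * simple n c := by
  rw [heckeRight, if_pos (by rw [len_mul_simple h]; omega)]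

theorem heckeRight_of_gt (h : π (hi c) < π (lo c)) : heckeRight π c = π := by
  rw [heckeRight, if_neg (by have := len_mul_simple' h; omega)]

theorem muAct_of_ne (hb : μ.index (π⁻¹ (lo x)) ≠ μ.index (π⁻¹ (hi x))) :
    muAct μ π x = heckeLeft x π := if_neg hb

theorem muAct_of_eq (hb : μ.index (π⁻¹ (lo x)) = μ.index (π⁻¹ (hi x)))
    (hc : blockStd μ π (π⁻¹ (lo x)) = lo c) :
    muAct μ π x = heckeRight (heckeLeft x π) c := by
  have : muAct μ π x = heckeRight (heckeLeft x π) (blockStd μ π (π⁻¹ (lo x))) := if_pos hb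
  rw [this, hc]

/-- A letter `x` at an ascent of `π⁻¹` acts in one of three ways. The values lie in different
blocks, or both are fixed by `y_π` (`muAct_link`, where the left factor creates a descent at `c` and
the right factor does nothing), or both factors act (`muAct_conj`). At a descent nothing happens
(`muAct_stay`). -/
theorem muAct_cross (hb : μ.index (π⁻¹ (lo x)) ≠ μ.index (π⁻¹ (hi x)))
    (h : π⁻¹ (lo x) < π⁻¹ (hi x)) : muAct μ π x = simple n x * π := by
  rw [muAct_of_ne hb, heckeLeft_of_lt h]

theorem muAct_link (hb : μ.index (π⁻¹ (lo x)) = μ.index (π⁻¹ (hi x)))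
    (hc : blockStd μ π (π⁻¹ (lo x)) = lo c) (h : π⁻¹ (lo x) < π⁻¹ (hi x))
    (h1 : π (lo c) = lo x) (h2 : π (hi c) = hi x) : muAct μ π x = simple n x * π := by
  rw [muAct_of_eq hb hc, heckeLeft_of_lt h, heckeRight_of_gt]
  rw [Perm.mul_apply, Perm.mul_apply, h1, h2, simple_apply_left, simple_apply_right]
  exact lo_lt_hi x

theorem simple_conj_lt (hlt : π (lo c) < π (hi c)) (h : ¬ (π (lo c) = lo x ∧ π (hi c) = hi x)) :
    (simple n x * π) (lo c) < (simple n x * π) (hi c) := by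
  rw [Perm.mul_apply, Perm.mul_apply, simple_lt_iff]
  · exact hlt
  · simpa only [Fin.ext_iff] using h
  · rintro ⟨h1, h2⟩
    rw [Fin.lt_def] at hlt; omega

theorem muAct_conj (hπ : π ∈ muInvolutions μ) (hb : μ.index (π⁻¹ (lo x)) = μ.index (π⁻¹ (hi x)))
    (hc : blockStd μ π (π⁻¹ (lo x)) = lo c) (h : π⁻¹ (lo x) < π⁻¹ (hi x))
    (h' : ¬ (π (lo c) = lo x ∧ π (hi c) = hi x)) : muAct μ π x = simple n x * π * simple n c := by
  rw [muAct_of_eq hb hc, heckeLeft_of_lt h, heckeRight_of_lt]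
  have := (assoc_lt_iff hπ hb).2 h
  rw [assoc_lo hc, assoc_hi hb hc] at this
  exact simple_conj_lt this h'

theorem muAct_stay (hπ : π ∈ muInvolutions μ) (h : π⁻¹ (hi x) < π⁻¹ (lo x)) : muAct μ π x = π := by
  by_cases hb : μ.index (π⁻¹ (lo x)) = μ.index (π⁻¹ (hi x))
  · obtain ⟨c, hc⟩ := exists_rank hb
    rw [muAct_of_eq hb hc, heckeLeft_of_gt h, heckeRight_of_gt]
    have := (assoc_lt_iff hπ hb.symm).2 h
    rwa [assoc_lo hc, assoc_hi hb hc] at this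
  · rw [muAct_of_ne hb, heckeLeft_of_gt h]

/-- Four times the length of the reduced `μ`-words for `π`. -/
noncomputable def rank4 (μ : Composition n) (π : Perm (Fin n)) : ℕ :=
  2 * len π + 2 * len (π * (blockStd μ π)⁻¹) + (blockStd μ π).support.card

/-- The permutation `π * (blockStd μ π)⁻¹` lists each block in increasing order, so its length
counts the inversions between blocks. A cross step raises both lengths by 1. A conjugation raises
only `len π`, by 2. A link raises `len π` by 1 and the support by 2. Each contributes 4. -/
theorem rank4_cross (hb : μ.index (π⁻¹ (lo x)) ≠ μ.index (π⁻¹ (hi x)))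
    (h : π⁻¹ (lo x) < π⁻¹ (hi x)) : rank4 μ (simple n x * π) = rank4 μ π + 4 := by
  rw [rank4, rank4, blockStd_simple_mul_of_ne hb, len_simple_mul h, mul_assoc, len_simple_mul]
  · ring
  · have hlt := lt_of_le_of_ne (monotone_index μ h.le) hb
    simp only [mul_inv_rev, inv_inv, Perm.mul_apply]
    exact lt_of_index_lt (μ := μ) (by rwa [index_blockStd, index_blockStd])

theorem simple_mul_blockStd_inv (hb : μ.index (π⁻¹ (lo x)) = μ.index (π⁻¹ (hi x)))
    (hc : blockStd μ π (π⁻¹ (lo x)) = lo c) :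
    simple n x * (π * (blockStd μ π)⁻¹) * simple n c = π * (blockStd μ π)⁻¹ := by
  rw [mul_assoc, simple_mul_comm_of (π := π * (blockStd μ π)⁻¹) (x := x), simple_mul_cancel_left]
  left
  constructor
  · rw [← hc]; simp
  · rw [← blockStd_hi hb hc]; simp

theorem rank4_conj (hπ : π ∈ muInvolutions μ) (hb : μ.index (π⁻¹ (lo x)) = μ.index (π⁻¹ (hi x)))
    (hc : blockStd μ π (π⁻¹ (lo x)) = lo c) (h : π⁻¹ (lo x) < π⁻¹ (hi x))
    (h' : ¬ (π (lo c) = lo x ∧ π (hi c) = hi x)) :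
    rank4 μ (simple n x * π * simple n c) = rank4 μ π + 4 := by
  have hlt := (assoc_lt_iff hπ hb).2 h
  rw [assoc_lo hc, assoc_hi hb hc] at hlt
  have e : simple n x * π * simple n c * (simple n c * blockStd μ π * simple n c)⁻¹ =
      π * (blockStd μ π)⁻¹ := by
    rw [← simple_mul_blockStd_inv hb hc]
    simp only [mul_inv_rev, simple_inv, mul_assoc, simple_mul_cancel_left]
  have e2 : (simple n c * blockStd μ π * simple n c).support.card = (blockStd μ π).support.card :=
      by
    conv_lhs => enter [1, 1, 2]; rw [← simple_inv]
    exact Perm.card_support_conj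
  rw [rank4, rank4, blockStd_conj hb hc, e, e2, len_mul_simple (simple_conj_lt hlt h'),
      len_simple_mul h]
  ring

theorem rank4_link (hb : μ.index (π⁻¹ (lo x)) = μ.index (π⁻¹ (hi x)))
    (hc : blockStd μ π (π⁻¹ (lo x)) = lo c) (h : π⁻¹ (lo x) < π⁻¹ (hi x))
    (h1 : π (lo c) = lo x) (h2 : π (hi c) = hi x) : rank4 μ (simple n x * π) = rank4 μ π + 4 := by
  have hc' := blockStd_hi hb hc
  have e : simple n x * π * (simple n c * blockStd μ π)⁻¹ = π * (blockStd μ π)⁻¹ := by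
    rw [← simple_mul_blockStd_inv hb hc]
    simp only [mul_inv_rev, simple_inv, mul_assoc]
  rw [← (eq_inv_iff _ _).2 h1] at hc
  rw [← (eq_inv_iff _ _).2 h2] at hc'
  have hd : Perm.Disjoint (simple n c) (blockStd μ π) := by
    intro p
    by_cases hp : p = lo c
    · right; rw [hp, hc]
    by_cases hp' : p = hi c
    · right; rw [hp', hc']
    left
    exact simple_apply_of_ne (fun e => hp (Fin.ext e)) (fun e => hp' (Fin.ext e))
  have e2 : (simple n c * blockStd μ π).support.card = (blockStd μ π).support.card + 2 := by
    rw [hd.card_support_mul, simple_eq, Perm.card_support_swap (by simp [Fin.ext_iff]), add_comm]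
  rw [rank4, rank4, blockStd_link hb (by rw [← (eq_inv_iff _ _).2 h1]; exact hc), e, e2,
      len_simple_mul h]
  ring

end moves
end MuInv

/-! ### Good permutations, and how they follow the action -/

namespace MuInv
open Equiv

namespace Pat
variable {n : ℕ} {κ : Type*} {idx : Fin n → κ} {η : Fin n → Fin n} {u u' : Fin n → ℕ}
    {p q r s : Fin n}

/-- A pattern only depends on the relative order of the letters within each block. A cross step
therefore preserves it. -/
theorem congr_lt (h : Pat idx η u) (hlt : ∀ p q, idx p = idx q → (u p < u q ↔ u' p < u' q)) :
    Pat idx η u' := by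
  have hle : ∀ p q, idx p = idx q → (u' p ≤ u' q ↔ u p ≤ u q) := fun p q hpq => by
    rw [← not_lt, ← not_lt, hlt q p hpq.symm]
  have heq : ∀ p q, idx p = idx q → (u' p = u' q ↔ u p = u q) := fun p q hpq => by
    rw [le_antisymm_iff, le_antisymm_iff, hle p q hpq, hle q p hpq.symm]
  refine ⟨h.inv, h.blk, fun p hp => ?_, fun p q hpq hp hq hne => ?_⟩
  · have hb := (h.blk p).symm
    have := h.cyc p ((hle _ _ hb).1 hp)
    simpa only [Cyc, heq _ _ hb, ← hlt _ _ hb] using this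
  · have h1 := (h.blk p).symm
    have h2 := (h.blk q).symm
    have e1 : idx p = idx (η q) := hpq.trans h2
    have e2 : idx (η p) = idx q := h1.symm.trans hpq
    have e3 : idx (η p) = idx (η q) := e2.trans h2
    have := h.ok p q hpq ((hle _ _ h1).1 hp) ((hle _ _ h2).1 hq) hne
    simpa only [Ok, Half, ne_eq, heq _ _ hpq, heq _ _ e1, heq _ _ e2, heq _ _ e3, ← hlt _ _ hpq,
      ← hlt _ _ e1, ← hlt _ _ e2, ← hlt _ _ e3, ← hlt _ _ hpq.symm, ← hlt _ _ e1.symm,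
          ← hlt _ _ e2.symm,
      ← hlt _ _ e3.symm] using this

theorem ne_of_ne (h : Pat idx η u) (hb : idx p = idx q) (hne : p ≠ q) : u p ≠ u q :=
  fun e => hne (h.inj hb e)

/-- With no letter of the block in between, the partners lie outside the interval from `u r` to `u
s`. Unless both letters are fixed, this leaves only the three `conj` shapes. -/
theorem ascend_conj (h : Pat idx η u) (hb : idx r = idx s) (hu : ∀ p, p ≠ r → p ≠ s → u' p = u p)
    (hr : u' r = u s) (hs : u' s = u r) (h1 : u r < u s)
    (hc : ∀ t, idx t = idx r → u r < u t → u t < u s → False) (h2 : u (η r) < u (η s))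
    (h3 : ¬ (η r = r ∧ η s = s)) : Pat idx η u' := by
  have hrs := h.lt_of_lt hb h1 h2
  have hne : η r ≠ s := by
    intro e; rw [← e, h.inv, e] at h2; lia
  have hne' : η s ≠ r := by
    intro e; rw [← e, h.inv] at hne; exact hne rfl
  have hu' : ∀ p, p ≠ r → p ≠ s → p ≠ η r → p ≠ η s → u' p = u p := fun p a b _ _ => hu p a b
  have hR := fun e => hu (η r) e hne
  have hT := fun e => hu (η s) hne' e
  have hc' : ∀ t, idx t = idx r → u r < u t → u t < u s → r < t → t < s → False :=
    fun t a b c _ _ => hc t a b c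
  have i1 : u (η r) ≠ u s := h.ne_of_ne ((h.blk r).trans hb) hne
  have i2 : u (η s) ≠ u r := h.ne_of_ne ((h.blk s).trans hb.symm) hne'
  have i3 := h.ne_of_ne (h.blk r)
  have i4 := h.ne_of_ne (h.blk s)
  have a1 := hc _ (h.blk r)
  have a2 := hc _ ((h.blk s).trans hb.symm)
  by_cases c1 : u (η s) < u r
  · exact h.swap_conj_low hb hrs hu' hr hs hR hT hc' h2 c1 h1
  by_cases c2 : u s < u (η r)
  · exact h.swap_conj_high hb hrs hu' hr hs hR hT hc' h1 c2 h2
  have c3 : u (η r) ≤ u r := by lia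
  have c4 : u s ≤ u (η s) := by lia
  refine h.swap_conj_far hb hrs hu' hr hs hR hT hc' c3 h1 c4 ?_
  by_contra c5
  apply h3
  constructor <;> by_contra c6
  · have := i3 c6; lia
  · have := i4 c6; lia

theorem descend_conj (h : Pat idx η u) (hb : idx r = idx s) (hu : ∀ p, p ≠ r → p ≠ s → u' p = u p)
    (hr : u' r = u s) (hs : u' s = u r) (hrs : r < s) (h1 : u s < u r)
    (hc : ∀ t, idx t = idx r → u s < u t → u t < u r → False) (hne : η r ≠ s) : Pat idx η u' := by
  -- The opposite order of the partners would force `s < r` by `lt_of_lt`.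
  have h2 : u (η r) < u (η s) := by
    rcases lt_trichotomy (u (η r)) (u (η s)) with h2 | h2 | h2
    · exact h2
    · have e := h.inj (by rw [h.blk, h.blk, hb]) h2
      have := h.inv r
      rw [e, h.inv] at this
      exact absurd this hrs.ne'
    · exact absurd (h.lt_of_lt hb.symm h1 h2) hrs.not_gt
  have hne' : η s ≠ r := by
    intro e; rw [← e, h.inv] at hne; exact hne rfl
  have hu' : ∀ p, p ≠ r → p ≠ s → p ≠ η r → p ≠ η s → u' p = u p := fun p a b _ _ => hu p a b
  have hR := fun e => hu (η r) e hne
  have hT := fun e => hu (η s) hne' e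
  have i1 : u (η r) ≠ u s := h.ne_of_ne ((h.blk r).trans hb) hne
  have i2 : u (η s) ≠ u r := h.ne_of_ne ((h.blk s).trans hb.symm) hne'
  have a1 := hc _ (h.blk r)
  have a2 := hc _ ((h.blk s).trans hb.symm)
  by_cases c1 : u (η s) < u s
  · exact h.descend_conj_low hb hrs hu' hr hs hR hT hc h2 c1 h1
  by_cases c2 : u r < u (η r)
  · exact h.descend_conj_high hb hrs hu' hr hs hR hT hc h1 c2 h2
  exact h.descend_conj_far hb hrs hu' hr hs hR hT hc (by lia) h1 (by lia) (by lia) hne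

end Pat

variable {n : ℕ} {μ : Composition n}

/-- The combinatorial description of the relation `w ∈ 𝓐_μ(π)`: the inverse of `w` has the same
block contents as `π`, and each of its blocks is the word of an atom. -/
structure Good (μ : Composition n) (π w : Perm (Fin n)) : Prop where
  idx : ∀ z, μ.index (w z) = μ.index (π⁻¹ z)
  pat : Pat μ.index (fun p => w (assocInvolution μ π (w⁻¹ p))) (fun p => (w⁻¹ p : ℕ))

theorem good_one : Good μ 1 1 := by
  have hβ : blockStd μ (1 : Perm (Fin n)) = 1 := blockStd_unique (fun _ => rfl) fun _ _ _ => Iff.rfl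
  have hy : ∀ p, assocInvolution μ (1 : Perm (Fin n)) p = p := fun p => by
    rw [assoc_apply, hβ]; simp
  refine ⟨fun z => by simp, ?_⟩
  simp only [hy]
  refine ⟨fun p => by simp, fun p => by simp, fun p _ => by simpa using Cyc.refl _ _, ?_⟩
  intro p q _ _ _ hpq
  have : p.1 ≠ q := fun e => hpq (Fin.ext e)
  simp [Ok, Half]
  lia

/-- In the increasing word no larger letter precedes a smaller one, so all cycles are trivial. Then
every block of `π` is increasing, with the contents of the corresponding interval. -/
theorem eq_one_of_good {π : Perm (Fin n)} (hπ : π ∈ muInvolutions μ) (h : Good μ π 1) : π = 1 := by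
  have hi : ∀ z, μ.index (π z) = μ.index z := fun z => by simpa using h.idx (π z)
  have hβ : ∀ p, blockStd μ π p = p := fun p => by
    by_contra hp
    have key : ∀ p, p < blockStd μ π p → False := fun p hlt => by
      have hy : assocInvolution μ π (π p) = π (blockStd μ π p) := by rw [assoc_apply]; simp
      have hb := index_blockStd (μ := μ) π p
      have h1 : π p < π (blockStd μ π p) ∨ π (blockStd μ π p) < π p :=
        lt_or_gt_of_ne fun e => hlt.ne (π.injective e)
      have h2 : ∀ z, z < assocInvolution μ π z → False := fun z hz => by
        have := h.pat.cyc z (by simpa using hz.le)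
        simp [Cyc] at this
        rw [Fin.lt_def] at hz
        omega
      rcases h1 with h1 | h1
      · exact h2 (π p) (by rwa [hy])
      · exact h2 (π (blockStd μ π p)) (by rwa [← hy, assoc_assoc hπ, hy])
    rcases lt_or_gt_of_ne hp with h1 | h1
    · exact key (blockStd μ π p) (by rwa [mem_muInvolutions.1 hπ])
    · exact key p h1
  refine eq_of_index_of_lt_iff (μ := μ) hi (fun _ => rfl) fun p q hpq => ?_
  rw [← blockStd_lt_iff π hpq, hβ, hβ]
  rfl

section step
variable {π w : Perm (Fin n)} {x c : Fin (n - 1)}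

theorem inv_mul_simple_apply_of_ne {p : Fin n} (h1 : p ≠ w (lo x)) (h2 : p ≠ w (hi x)) :
    (w * simple n x)⁻¹ p = w⁻¹ p := by
  rw [mul_inv_rev, simple_inv, Perm.mul_apply, simple_apply_of_ne]
  · intro e; apply h1; rw [← (Fin.ext e : w⁻¹ p = lo x)]; simp
  · intro e; apply h2; rw [← (Fin.ext e : w⁻¹ p = hi x)]; simp

theorem inv_mul_simple_lo : (w * simple n x)⁻¹ (w (lo x)) = hi x := by
  rw [mul_inv_rev, simple_inv, Perm.mul_apply]; simp [simple_apply_left]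

theorem inv_mul_simple_hi : (w * simple n x)⁻¹ (w (hi x)) = lo x := by
  rw [mul_inv_rev, simple_inv, Perm.mul_apply]; simp [simple_apply_right]

theorem not_between_lo_hi (z : ℕ) (h1 : (lo x).1 < z) (h2 : z < (hi x).1) : False := by
  simp only at h1 h2; omega

theorem apply_of_inv_apply {p z : Fin n} (e : w⁻¹ p = z) : w z = p := by
  rw [← e]; simp

theorem Good.index_eq (h : Good μ π w) {a b : Fin n} (hb : μ.index (π⁻¹ a) = μ.index (π⁻¹ b)) :
    μ.index (w a) = μ.index (w b) := by rw [h.idx, h.idx, hb]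

/-- An effective letter for `π` is thus an ascent of every good `w`, so that `μ`-words with only
effective letters are reduced in the symmetric group. The converse fails, since `π` may have more
descents than `w`. -/
theorem Good.lt (h : Good μ π w) (hπ : π ∈ muInvolutions μ) (hlt : π⁻¹ (lo x) < π⁻¹ (hi x)) :
    w (lo x) < w (hi x) := by
  rcases (monotone_index μ hlt.le).lt_or_eq with hb | hb
  · exact lt_of_index_lt (μ := μ) (by rwa [h.idx, h.idx])
  · have h1 := (assoc_lt_iff hπ hb).2 hlt
    exact h.pat.lt_of_lt (h.index_eq hb) (by simp) (by simpa using h1)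

theorem Good.cross (h : Good μ π w) (hb : μ.index (π⁻¹ (lo x)) ≠ μ.index (π⁻¹ (hi x))) :
    Good μ (simple n x * π) (w * simple n x) := by
  refine ⟨fun z => ?_, ?_⟩
  · rw [mul_inv_rev, simple_inv, Perm.mul_apply, Perm.mul_apply, h.idx]
  · have e : (fun p => (w * simple n x) (assocInvolution μ (simple n x * π)
      ((w * simple n x)⁻¹ p))) =
        fun p => w (assocInvolution μ π (w⁻¹ p)) := by
      funext p
      rw [assoc_cross hb, mul_inv_rev, simple_inv]
      simp only [Perm.mul_apply, simple_apply_simple]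
    rw [e]
    refine h.pat.congr_lt fun p q hpq => ?_
    rw [mul_inv_rev, simple_inv, Perm.mul_apply, Perm.mul_apply, ← Fin.lt_def, ← Fin.lt_def,
        simple_lt_iff]
    · rintro ⟨h1, h2⟩
      apply hb
      rw [← h.idx, ← h.idx, apply_of_inv_apply (Fin.ext h1 : w⁻¹ p = lo x),
        apply_of_inv_apply (Fin.ext h2 : w⁻¹ q = hi x)]
      exact hpq
    · rintro ⟨h1, h2⟩
      apply hb
      rw [← h.idx, ← h.idx, apply_of_inv_apply (Fin.ext h1 : w⁻¹ q = lo x),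
        apply_of_inv_apply (Fin.ext h2 : w⁻¹ p = hi x)]
      exact hpq.symm

theorem conj_eta (hb : μ.index (π⁻¹ (lo x)) = μ.index (π⁻¹ (hi x)))
    (hc : blockStd μ π (π⁻¹ (lo x)) = lo c) :
    (fun p => (w * simple n x) (assocInvolution μ (simple n x * π * simple n c)
    ((w * simple n x)⁻¹ p))) =
      fun p => w (assocInvolution μ π (w⁻¹ p)) := by
  funext p
  rw [assoc_conj hb hc, mul_inv_rev, simple_inv]
  simp only [Perm.mul_apply, simple_apply_simple]

theorem link_eta (hb : μ.index (π⁻¹ (lo x)) = μ.index (π⁻¹ (hi x)))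
    (hc : blockStd μ π (π⁻¹ (lo x)) = lo c)
    (h : (π (lo c) = lo x ∧ π (hi c) = hi x) ∨ (π (lo c) = hi x ∧ π (hi c) = lo x)) :
    (fun p => (w * simple n x) (assocInvolution μ (simple n x * π) ((w * simple n x)⁻¹ p))) =
      fun p => w (simple n x (assocInvolution μ π (w⁻¹ p))) := by
  funext p
  rw [assoc_link hb hc h, mul_inv_rev, simple_inv]
  simp only [Perm.mul_apply, simple_apply_simple]

theorem Good.idx_conj (h : Good μ π w) (hb : μ.index (π⁻¹ (lo x)) = μ.index (π⁻¹ (hi x)))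
    (hc : blockStd μ π (π⁻¹ (lo x)) = lo c) (z : Fin n) :
    μ.index ((w * simple n x) z) = μ.index ((simple n x * π * simple n c)⁻¹ z) := by
  simp only [mul_inv_rev, simple_inv, Perm.mul_apply]
  rw [index_simple (index_lo_hi hb hc), h.idx]

theorem Good.idx_link (h : Good μ π w) (z : Fin n) :
    μ.index ((w * simple n x) z) = μ.index ((simple n x * π)⁻¹ z) := by
  simp only [mul_inv_rev, simple_inv, Perm.mul_apply, h.idx]

theorem val_inv_apply (z : Fin n) : (w⁻¹ (w z)).1 = z := by simp

theorem muAct_mem_and_rank4 (hπ : π ∈ muInvolutions μ) (hlt : π⁻¹ (lo x) < π⁻¹ (hi x)) :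
    muAct μ π x ∈ muInvolutions μ ∧ rank4 μ (muAct μ π x) = rank4 μ π + 4 := by
  by_cases hb : μ.index (π⁻¹ (lo x)) = μ.index (π⁻¹ (hi x))
  swap
  · rw [muAct_cross hb hlt]
    exact ⟨cross_mem hπ hb, rank4_cross hb hlt⟩
  obtain ⟨c, hc⟩ := exists_rank hb
  by_cases hfix : π (lo c) = lo x ∧ π (hi c) = hi x
  · rw [muAct_link hb hc hlt hfix.1 hfix.2]
    exact ⟨link_mem hπ hb hc (Or.inl hfix), rank4_link hb hc hlt hfix.1 hfix.2⟩
  · rw [muAct_conj hπ hb hc hlt hfix]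
    exact ⟨conj_mem hπ hb hc, rank4_conj hπ hb hc hlt hfix⟩

/-- Cross, link and conjugation steps correspond to `congr_lt`, `swap_link` and `ascend_conj`. -/
theorem Good.up (h : Good μ π w) (hπ : π ∈ muInvolutions μ) (hlt : π⁻¹ (lo x) < π⁻¹ (hi x)) :
    Good μ (muAct μ π x) (w * simple n x) := by
  by_cases hb : μ.index (π⁻¹ (lo x)) = μ.index (π⁻¹ (hi x))
  swap
  · rw [muAct_cross hb hlt]
    exact h.cross hb
  obtain ⟨c, hc⟩ := exists_rank hb
  have hwb := h.index_eq hb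
  have hwlt := h.lt hπ hlt
  have hylt := (assoc_lt_iff hπ hb).2 hlt
  by_cases hfix : π (lo c) = lo x ∧ π (hi c) = hi x
  · rw [muAct_link hb hc hlt hfix.1 hfix.2]
    refine ⟨h.idx_link, ?_⟩
    have y1 : assocInvolution μ π (lo x) = lo x := (assoc_lo hc).trans hfix.1
    have y2 : assocInvolution μ π (hi x) = hi x := (assoc_hi hb hc).trans hfix.2
    have e1 : w (assocInvolution μ π (w⁻¹ (w (lo x)))) = w (lo x) := by
      rw [Perm.inv_def, symm_apply_apply, y1]
    have e2 : w (assocInvolution μ π (w⁻¹ (w (hi x)))) = w (hi x) := by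
      rw [Perm.inv_def, symm_apply_apply, y2]
    obtain ⟨η', hη', f1, f2, f3⟩ := h.pat.swap_link hwb hwlt
      (u' := fun p => ((w * simple n x)⁻¹ p : ℕ))
      (fun p a b _ _ => congrArg Fin.val (inv_mul_simple_apply_of_ne a b))
      (by rw [val_inv_apply, inv_mul_simple_lo]) (by rw [val_inv_apply, inv_mul_simple_hi])
      (fun e => absurd e1 e) (fun e => absurd e2 e)
      (fun t _ a b _ _ => not_between_lo_hi (w⁻¹ t) (by simpa using a) (by simpa using b))
      (by rw [e1]) (by rw [e1, e2, val_inv_apply, val_inv_apply]; exact lo_lt_hi x) (by rw [e2])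
    convert hη' using 1
    rw [link_eta hb hc (Or.inl hfix)]
    funext p
    by_cases hp1 : p = w (lo x)
    · rw [hp1, f1, Perm.inv_def, symm_apply_apply, y1, simple_apply_left]
    by_cases hp2 : p = w (hi x)
    · rw [hp2, f2, Perm.inv_def, symm_apply_apply, y2, simple_apply_right]
    rw [f3 p hp1 hp2 (by rw [e1]; exact hp1) (by rw [e2]; exact hp2), simple_apply_of_ne]
    · intro e
      apply hp1
      rw [← y1, ← (Fin.ext e : _ = lo x), assoc_assoc hπ]; simp
    · intro e
      apply hp2
      rw [← y2, ← (Fin.ext e : _ = hi x), assoc_assoc hπ]; simp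
  · rw [muAct_conj hπ hb hc hlt hfix]
    refine ⟨h.idx_conj hb hc, ?_⟩
    rw [conj_eta hb hc]
    refine h.pat.ascend_conj hwb (fun p a b => congrArg Fin.val (inv_mul_simple_apply_of_ne a b))
      (by rw [val_inv_apply, inv_mul_simple_lo]) (by rw [val_inv_apply, inv_mul_simple_hi])
      (by rw [val_inv_apply, val_inv_apply]; exact lo_lt_hi x)
      (fun t _ a b => not_between_lo_hi (w⁻¹ t) (by simpa using a) (by simpa using b))
      (by simpa using hylt) ?_
    rintro ⟨e1, e2⟩
    apply hfix
    rw [← assoc_lo hc, ← assoc_hi hb hc]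
    simpa using And.intro e1 e2

/-- Every right descent of a good `w` can be the last letter of a reduced `μ`-word. This makes all
reduced words of `w`, not only some of them, reduced `μ`-words. -/
theorem Good.down (h : Good μ π w) (hπ : π ∈ muInvolutions μ) (hlt : w (hi x) < w (lo x)) :
    ∃ π' ∈ muInvolutions μ, muAct μ π' x = π ∧ rank4 μ π = rank4 μ π' + 4 ∧
      Good μ π' (w * simple n x) := by
  have hπlt : π⁻¹ (hi x) < π⁻¹ (lo x) := by
    rcases inv_apply_lt_or π⁻¹ x with h' | h'
    · exact absurd (h.lt hπ h') hlt.not_gt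
    · exact h'
  suffices H : ∃ π' ∈ muInvolutions μ, muAct μ π' x = π ∧ π'⁻¹ (lo x) < π'⁻¹ (hi x) ∧
      Good μ π' (w * simple n x) by
    obtain ⟨π', h1, h2, h3, h4⟩ := H
    exact ⟨π', h1, h2, h2 ▸ (muAct_mem_and_rank4 h1 h3).2, h4⟩
  have e1 : (simple n x * π)⁻¹ (lo x) = π⁻¹ (hi x) := by
    rw [mul_inv_rev, simple_inv, Perm.mul_apply, simple_apply_left]
  have e2 : (simple n x * π)⁻¹ (hi x) = π⁻¹ (lo x) := by
    rw [mul_inv_rev, simple_inv, Perm.mul_apply, simple_apply_right]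
  by_cases hb : μ.index (π⁻¹ (lo x)) = μ.index (π⁻¹ (hi x))
  swap
  · refine ⟨simple n x * π, cross_mem hπ hb, ?_, by rwa [e1, e2], h.cross hb⟩
    rw [muAct_cross (by rw [e1, e2]; exact fun e => hb e.symm) (by rwa [e1, e2]),
      simple_mul_cancel_left]
  obtain ⟨c, hc⟩ := exists_rank hb
  have hc' := blockStd_hi hb hc
  have hwb := h.index_eq hb
  have hylt := (assoc_lt_iff hπ hb.symm).2 hπlt
  have hylt' := hylt
  rw [assoc_lo hc, assoc_hi hb hc] at hylt'
  -- If `x` and `x + 1` form a cycle of `y_π`, the last step was a link, undone by separating the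
  -- cycle. Otherwise it was a conjugation.
  by_cases hfix : π (lo c) = hi x ∧ π (hi c) = lo x
  · have g1 : (simple n x * π) (lo c) = lo x := by rw [Perm.mul_apply, hfix.1, simple_apply_right]
    have g2 : (simple n x * π) (hi c) = hi x := by rw [Perm.mul_apply, hfix.2, simple_apply_left]
    refine ⟨simple n x * π, link_mem hπ hb hc (Or.inr hfix), ?_, by rwa [e1, e2], h.idx_link, ?_⟩
    · rw [muAct_link (c := c) (by rw [e1, e2]; exact hb.symm) _ (by rwa [e1, e2]) g1 g2,
        simple_mul_cancel_left]
      rw [e1, blockStd_link hb hc, Perm.mul_apply, hc', simple_apply_right]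
    have y1 : assocInvolution μ π (lo x) = hi x := (assoc_lo hc).trans hfix.1
    have y2 : assocInvolution μ π (hi x) = lo x := (assoc_hi hb hc).trans hfix.2
    obtain ⟨η', hη', f1, f2, f3⟩ := h.pat.descend_unlink hlt (by simp [y2])
      (u' := fun p => ((w * simple n x)⁻¹ p : ℕ))
      (fun p b a => congrArg Fin.val (inv_mul_simple_apply_of_ne a b))
      (by rw [val_inv_apply, inv_mul_simple_hi]) (by rw [val_inv_apply, inv_mul_simple_lo])
      (fun t _ a b => not_between_lo_hi (w⁻¹ t) (by simpa using a) (by simpa using b))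
      (by rw [val_inv_apply, val_inv_apply]; exact lo_lt_hi x)
    convert hη' using 1
    rw [link_eta hb hc (Or.inr hfix)]
    funext p
    by_cases hp1 : p = w (lo x)
    · rw [hp1, f2, Perm.inv_def, symm_apply_apply, y1, simple_apply_right]
    by_cases hp2 : p = w (hi x)
    · rw [hp2, f1, Perm.inv_def, symm_apply_apply, y2, simple_apply_left]
    rw [f3 p hp2 hp1, simple_apply_of_ne]
    · intro e
      apply hp2
      rw [← y1, ← (Fin.ext e : _ = lo x), assoc_assoc hπ]; simp
    · intro e
      apply hp1
      rw [← y2, ← (Fin.ext e : _ = hi x), assoc_assoc hπ]; simp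
  · have i1 : (simple n x * π * simple n c)⁻¹ (lo x) = simple n c (π⁻¹ (hi x)) := by
      rw [mul_inv_rev, simple_inv, Perm.mul_apply, e1]
    have i2 : (simple n x * π * simple n c)⁻¹ (hi x) = simple n c (π⁻¹ (lo x)) := by
      rw [mul_inv_rev, simple_inv, Perm.mul_apply, e2]
    have hidx := index_simple (index_lo_hi hb hc)
    have hb' : μ.index ((simple n x * π * simple n c)⁻¹ (lo x)) =
        μ.index ((simple n x * π * simple n c)⁻¹ (hi x)) := by
      rw [i1, i2, hidx, hidx, hb]
    have hc2 : blockStd μ (simple n x * π * simple n c)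
        ((simple n x * π * simple n c)⁻¹ (lo x)) = lo c := by
      rw [i1, blockStd_conj hb hc]
      simp only [Perm.mul_apply, simple_apply_simple, hc', simple_apply_right]
    have hm := conj_mem hπ hb hc
    have k1 : (simple n x * π * simple n c) (lo c) = simple n x (π (hi c)) := by
      rw [Perm.mul_apply, Perm.mul_apply, simple_apply_left]
    have k2 : (simple n x * π * simple n c) (hi c) = simple n x (π (lo c)) := by
      rw [Perm.mul_apply, Perm.mul_apply, simple_apply_right]
    have hlt' : (simple n x * π * simple n c)⁻¹ (lo x) < (simple n x * π * simple n c)⁻¹ (hi x) :=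
        by
      rw [← assoc_lt_iff hm hb', assoc_lo hc2, assoc_hi hb' hc2, k1, k2, simple_lt_iff]
      · exact hylt'
      · rintro ⟨a, b⟩; exact hfix ⟨Fin.ext b, Fin.ext a⟩
      · rintro ⟨a, b⟩; rw [Fin.lt_def, a, b] at hylt'; omega
    refine ⟨simple n x * π * simple n c, hm, ?_, hlt', h.idx_conj hb hc, ?_⟩
    · rw [muAct_conj hm hb' hc2 hlt']
      · simp only [mul_assoc, simple_mul_cancel_left, simple_mul_self, mul_one]
      · rw [k1, k2]
        rintro ⟨a, b⟩
        have a' := congrArg (simple n x) a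
        have b' := congrArg (simple n x) b
        rw [simple_apply_simple, simple_apply_left] at a'
        rw [simple_apply_simple, simple_apply_right] at b'
        rw [a', b'] at hylt'
        exact absurd hylt' (lo_lt_hi x).not_gt
    rw [conj_eta hb hc]
    refine h.pat.descend_conj hwb.symm (fun p b a =>
        congrArg Fin.val (inv_mul_simple_apply_of_ne a b))
      (by rw [val_inv_apply, inv_mul_simple_hi]) (by rw [val_inv_apply, inv_mul_simple_lo]) hlt
      (by rw [val_inv_apply, val_inv_apply]; exact lo_lt_hi x)
      (fun t _ a b => not_between_lo_hi (w⁻¹ t) (by simpa using a) (by simpa using b)) ?_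
    intro e
    apply hfix
    have e' : assocInvolution μ π (hi x) = lo x := by simpa using e
    rw [← assoc_lo hc, ← assoc_hi hb hc]
    exact ⟨by rw [← e', assoc_assoc hπ], e'⟩

end step
end MuInv

/-! ### Atoms are exactly the good permutations -/

namespace MuInv
open Equiv
variable {n : ℕ} {μ : Composition n}

/-- The pattern determines the involution. Sorting the blocks of `w⁻¹` gives `w⁻¹ * ν⁻¹`, and the
blocks are to standardize to `ν * E * ν⁻¹`, which is `E` read on ranks. The product of the two is
`w⁻¹ * E * ν⁻¹`. -/
theorem exists_good_of_pat {w : Perm (Fin n)} {η : Fin n → Fin n}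
    (h : Pat μ.index η (fun p => (w⁻¹ p : ℕ))) : ∃ π ∈ muInvolutions μ, Good μ π w := by
  let E : Perm (Fin n) := Function.Involutive.toPerm η h.inv
  have hE : ∀ p, E p = η p := fun _ => rfl
  have hEE : ∀ p, E (E p) = p := h.inv
  have hEi : E⁻¹ = E := by rw [inv_eq_iff_mul_eq_one]; ext p : 1; exact hEE p
  have hEb : ∀ p, μ.index (E p) = μ.index p := h.blk
  clear_value E
  set ν := blockStd μ w⁻¹ with hν
  have hνb : ∀ p, μ.index (ν p) = μ.index p := index_blockStd _
  have hνb' : ∀ p, μ.index (ν⁻¹ p) = μ.index p := fun p => by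
    rw [← hνb (ν⁻¹ p)]; simp
  have hβ : blockStd μ (w⁻¹ * E * ν⁻¹) = ν * E * ν⁻¹ := by
    refine blockStd_unique (fun p => ?_) fun p q hpq => ?_
    · simp only [Perm.mul_apply, hνb, hEb, hνb']
    · simp only [Perm.mul_apply]
      exact blockStd_lt_iff w⁻¹ (by rw [hEb, hEb, hνb', hνb', hpq])
  have hy : ∀ p, w (assocInvolution μ (w⁻¹ * E * ν⁻¹) (w⁻¹ p)) = E p := by
    intro p
    rw [assocInvolution, hβ]
    simp [mul_inv_rev, hEi, hEE]
  refine ⟨w⁻¹ * E * ν⁻¹, ?_, fun z => ?_, ?_⟩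
  · rw [mem_muInvolutions, hβ]
    intro p
    simp [hEE]
  · simp only [mul_inv_rev, hEi, inv_inv, Perm.mul_apply, hνb, hEb]
  · simp only [hy, hE]
    exact h

theorem muEval_concat (a : Word n) (x : Fin (n - 1)) :
    muEval μ (a ++ [x]) = muAct μ (muEval μ a) x := by
  simp [muEval, List.foldl_append]

theorem one_mem : (1 : Perm (Fin n)) ∈ muInvolutions μ := by
  have : blockStd μ (1 : Perm (Fin n)) = 1 := blockStd_unique (fun _ => rfl) fun _ _ _ => Iff.rfl
  rw [mem_muInvolutions, this]
  exact fun _ => rfl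

theorem rank4_one : rank4 μ (1 : Perm (Fin n)) = 0 := by
  have : blockStd μ (1 : Perm (Fin n)) = 1 := blockStd_unique (fun _ => rfl) fun _ _ _ => Iff.rfl
  simp [rank4, this, len_one]

/-- A word of the least length that the rank allows consists of effective steps only. -/
theorem muEval_spec (a : Word n) : muEval μ a ∈ muInvolutions μ ∧
    rank4 μ (muEval μ a) ≤ 4 * a.length ∧
    (∃ b : Word n, muEval μ b = muEval μ a ∧ 4 * b.length = rank4 μ (muEval μ a)) ∧
    (rank4 μ (muEval μ a) = 4 * a.length → Good μ (muEval μ a) (wordProd a) ∧ Reduced a) := by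
  induction a using List.reverseRecOn with
  | nil =>
    exact ⟨one_mem, by simp [muEval, rank4_one], ⟨[], rfl, by simp [muEval, rank4_one]⟩,
      fun _ => ⟨good_one, len_one⟩⟩
  | append_singleton a x ih =>
    obtain ⟨h1, h2, ⟨b, hb, hbl⟩, h4⟩ := ih
    rw [muEval_concat]
    rcases inv_apply_lt_or (muEval μ a)⁻¹ x with hlt | hlt
    · have key := muAct_mem_and_rank4 h1 hlt
      refine ⟨key.1, by rw [key.2]; simp; omega,
        ⟨b ++ [x], by rw [muEval_concat, hb], by rw [key.2]; simp; omega⟩, fun h => ?_⟩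
      rw [key.2] at h
      obtain ⟨hg, hr⟩ := h4 (by simp at h; omega)
      have hw : wordProd (a ++ [x]) = wordProd a * simple n x := by
        rw [wordProd_append, wordProd_cons, wordProd_nil, mul_one]
      rw [Reduced, hw]
      refine ⟨hg.up h1 hlt, ?_⟩
      rw [len_mul_simple (hg.lt h1 hlt), hr]; simp
    · rw [muAct_stay h1 hlt]
      refine ⟨h1, by simp; omega, ⟨b, hb, hbl⟩, fun h => ?_⟩
      simp at h; omega

theorem muEval_mem (a : Word n) : muEval μ a ∈ muInvolutions μ := (muEval_spec a).1

theorem mem_muReducedWords {π : Perm (Fin n)} {a : Word n} :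
    a ∈ muReducedWords μ π ↔ muEval μ a = π ∧ 4 * a.length = rank4 μ π := by
  constructor
  · rintro ⟨rfl, h⟩
    obtain ⟨-, h2, ⟨b, hb, hbl⟩, -⟩ := muEval_spec (μ := μ) a
    have := h b hb
    exact ⟨rfl, by omega⟩
  · rintro ⟨rfl, h⟩
    refine ⟨rfl, fun b hb => ?_⟩
    have := (muEval_spec (μ := μ) b).2.1
    rw [hb] at this
    omega

theorem good_of_mem {π : Perm (Fin n)} {a : Word n} (h : a ∈ muReducedWords μ π) :
    π ∈ muInvolutions μ ∧ Good μ π (wordProd a) ∧ Reduced a := by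
  obtain ⟨rfl, h2⟩ := mem_muReducedWords.1 h
  exact ⟨muEval_mem a, (muEval_spec a).2.2.2 h2.symm⟩

/-- Letters are peeled off from the right by `Good.down`. Conversely, `muEval_spec` shows that
reduced `μ`-words have good products. -/
theorem mem_of_good {π : Perm (Fin n)} {a : Word n} (hπ : π ∈ muInvolutions μ)
    (h : Good μ π (wordProd a)) (ha : Reduced a) : a ∈ muReducedWords μ π := by
  rw [mem_muReducedWords]
  induction a using List.reverseRecOn generalizing π with
  | nil =>
    rw [wordProd_nil] at h
    obtain rfl := eq_one_of_good hπ h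
    exact ⟨rfl, by simp [rank4_one]⟩
  | append_singleton a x ih =>
    have hw : wordProd (a ++ [x]) = wordProd a * simple n x := by
      rw [wordProd_append, wordProd_cons, wordProd_nil, mul_one]
    have hw' : wordProd (a ++ [x]) * simple n x = wordProd a := by
      rw [hw, mul_assoc, simple_mul_self, mul_one]
    have hle := len_wordProd_le a
    rw [Reduced, List.length_append, List.length_singleton] at ha
    rcases inv_apply_lt_or (wordProd (a ++ [x])) x with hlt | hlt
    · have := len_mul_simple hlt
      rw [hw'] at this
      omega
    · obtain ⟨π', h1, h2, h3, h4⟩ := h.down hπ hlt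
      have := len_mul_simple' hlt
      rw [hw'] at h4 this
      obtain ⟨e, e'⟩ := ih h1 h4 (by rw [Reduced]; omega)
      exact ⟨by rw [muEval_concat, e, h2], by rw [h3, ← e']; simp; ring⟩

theorem Good.four_mul_len {π w : Perm (Fin n)} (h : Good μ π w) (hπ : π ∈ muInvolutions μ) :
    4 * len w = rank4 μ π := by
  obtain ⟨a, rfl, ha⟩ := exists_reduced w
  rw [← ha, (mem_muReducedWords.1 (mem_of_good hπ h ha.symm)).2]

theorem mem_muAtoms {π w : Perm (Fin n)} (hπ : π ∈ muInvolutions μ) :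
    w ∈ muAtoms μ π ↔ Good μ π w := by
  constructor
  · intro h
    obtain ⟨a, rfl, ha⟩ := exists_reduced w
    exact (good_of_mem (h ⟨rfl, ha⟩)).2.1
  · rintro h a ⟨rfl, ha⟩
    exact mem_of_good hπ h ha.symm

theorem isMuAtom_iff {w : Perm (Fin n)} : IsMuAtom μ w ↔ ∃ π ∈ muInvolutions μ, Good μ π w :=
  exists_congr fun _ => and_congr_right mem_muAtoms

/-- To recognize an atom it suffices to exhibit some involution on positions. -/
theorem isMuAtom_of_pat {w : Perm (Fin n)} {η : Fin n → Fin n}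
    (h : Pat μ.index η (fun p => (w⁻¹ p : ℕ))) : IsMuAtom μ w :=
  isMuAtom_iff.2 (exists_good_of_pat h)
end MuInv

/-! ### Uniqueness of the second exchange for abstract words -/

namespace MuInv

/-- The word of an atom in which the neighbouring cycle of `j` encloses that of `i`: if exchanging
first `i, j` and then `p, q` gives again an atom, then `p, q` are determined. -/
theorem unique_pair {A κ : Type*} {ℓ v w z : A → ℤ} {y : A → A} {f : A → κ} {i j p q : A}
    (hℓ : Function.Injective ℓ) (hv : Function.Injective v) (hy : ∀ a, y (y a) = a)
    (V1 : ∀ a, ℓ a < ℓ (y a) → v (y a) < v a)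
    (V2 : ∀ a e, ℓ a < ℓ e → ℓ e < ℓ (y a) → v (y a) < v e → v e < v a → False)
    (V3 : ∀ a b, f a = f b → ℓ a ≤ ℓ (y a) → ℓ b ≤ ℓ (y b) → ℓ a < ℓ b → ℓ (y a) < ℓ (y b) →
    v a < v (y b))
    (hwi : w i = v j) (hwj : w j = v i) (hw : ∀ e, e ≠ i → e ≠ j → w e = v e)
    (hp : z p = w q) (hq : z q = w p) (hz : ∀ e, e ≠ p → e ≠ q → z e = w e)
    (hpq : ℓ p < ℓ q) (hd : w q < w p)
    (hadj : ∀ e, ℓ p < ℓ e → ℓ e < ℓ q → w q < w e → w e < w p → False)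
    (W1 : z j < z (y j)) (W2 : ∀ e, ℓ (y j) < ℓ e → ℓ e < ℓ j → z j < z e → z e < z (y j) → False)
    (hij : ℓ i < ℓ j) (hvij : v i < v j) (hJ : ℓ (y j) < ℓ i) (hI : ℓ (y i) < ℓ j)
    (hJI : ℓ (y j) < ℓ (y i)) (hne : ¬ (p = i ∧ q = j)) (hf : f i = f j) (hfy : ∀ a, f (y a) = f a)
    (hfpq : f p = f q) :
    (p = y j ∧ q = i ∧ ¬ (ℓ (y i) < ℓ i ∧ v (y i) < v (y j))) ∨
      (p = y j ∧ q = y i ∧ ℓ (y i) < ℓ i ∧ v (y i) < v (y j)) := by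
  have hJv : v j < v (y j) := by
    have := V1 (y j); rw [hy] at this; exact this (by omega)
  have hJj : y j ≠ j := by rintro e; rw [e] at hJv; omega
  have hJi : y j ≠ i := by rintro e; rw [e] at hJ; omega
  have hij' : i ≠ j := by rintro rfl; omega
  have hwJ : w (y j) = v (y j) := hw _ hJi hJj
  have hinj : ∀ a b, a ≠ b → v a ≠ v b ∧ ℓ a ≠ ℓ b := fun a b h => ⟨fun e => h (hv e), fun e =>
      h (hℓ e)⟩
  have hVJ : ∀ e, ℓ (y j) < ℓ e → ℓ e < ℓ j → v j < v e → v e < v (y j) → False := by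
    have := V2 (y j); rwa [hy] at this
  have hIj : y i ≠ j := by rintro e; rw [e] at hI; omega
  have hIJ : y i ≠ y j := by rintro e; rw [e] at hJI; omega
  have hpq' : p ≠ q := by rintro rfl; omega
  -- In `w` the letters `j`, `i`, `y j` stand in this order although `y j < i < j`, which `W2`
  -- forbids in `z`. Hence `p` or `q` is one of these three letters, and the cases run over the
  -- possibilities.
  by_cases c1 : q = j
  · subst c1
    have hpi : p ≠ i := fun e => hne ⟨e, rfl⟩
    have hpJ : p ≠ y q := by rintro rfl; omega
    have z1 : z (y q) = v (y q) := by rw [hz _ hpJ.symm hJj, hwJ]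
    have z2 : z i = v q := by rw [hz _ hpi.symm hij', hwi]
    have w1 : w p = v p := hw _ hpi hpq'
    have := W2 i (by omega) (by omega)
    have := hadj i
    have := hVJ p
    have := hinj p i hpi
    have := hinj p q hpq'
    clear V1 V2 V3 W2 hw hz hinj hℓ hv hfy hy
    grind (splits := 40)
  by_cases c2 : p = j
  · subst c2
    have hqi : q ≠ i := by rintro rfl; omega
    have hqJ : q ≠ y p := by rintro rfl; omega
    have z1 : z (y p) = v (y p) := by rw [hz _ hJj hqJ.symm, hwJ]
    have z2 : z i = v p := by rw [hz _ hij' hqi.symm, hwi]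
    have := W2 i (by omega) (by omega)
    clear V1 V2 V3 W2 hw hz hinj hℓ hv hfy hy
    grind (splits := 40)
  have zj : z j = v i := by rw [hz _ (Ne.symm c2) (Ne.symm c1), hwj]
  by_cases c3 : p = i
  · subst c3
    have hqJ : q ≠ y j := by rintro rfl; omega
    have z1 : z (y j) = v (y j) := by rw [hz _ hJi hqJ.symm, hwJ]
    have w1 : w q = v q := hw _ hpq'.symm c1
    have := W2 p (by omega) (by omega)
    have := W2 q
    have := hadj j
    have := hinj q j c1
    have := hinj q p hpq'.symm
    clear V1 V2 V3 W2 hw hz hinj hℓ hv hfy hy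
    grind (splits := 40)
  by_cases c4 : q = i
  · subst c4
    by_cases hpJ : p = y j
    · left
      refine ⟨hpJ, rfl, ?_⟩
      rintro ⟨h1, h2⟩
      have hIi : y q ≠ q := by rintro e; rw [e] at h1; omega
      have z1 : z (y q) = v (y q) := by rw [hz _ (by rw [hpJ]; exact hIJ) hIi, hw _ hIi hIj]
      have z2 : z (y j) = v j := by rw [← hpJ, hp, hwi]
      have := W2 (y q) (by omega) (by omega)
      have := V1 (y q)
      rw [hy] at this
      have := hVJ (y q)
      have := hinj _ _ hIj
      clear V1 V2 V3 W2 hw hz hinj hℓ hv hfy hy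
      grind (splits := 40)
    · have z1 : z (y j) = v (y j) := by rw [hz _ (Ne.symm hpJ) hJi, hwJ]
      have w1 : w p = v p := hw _ c3 c2
      have := W2 q (by omega) (by omega)
      have := W2 p
      have := hadj (y j)
      have := hinj p _ hpJ
      clear V1 V2 V3 W2 hw hz hinj hℓ hv hfy hy
      grind (splits := 40)
  have zi : z i = v j := by rw [hz _ (Ne.symm c3) (Ne.symm c4), hwi]
  have hWi := W2 i (by omega) (by omega)
  by_cases c5 : q = y j
  · subst c5
    have w1 : w p = v p := hw _ c3 c2
    clear V1 V2 V3 W2 hw hz hinj hℓ hv hfy hy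
    grind (splits := 40)
  by_cases c6 : p = y j
  swap
  · have z1 : z (y j) = v (y j) := by rw [hz _ (Ne.symm c6) (Ne.symm c5), hwJ]
    clear V1 V2 V3 W2 hw hz hinj hℓ hv hfy hy
    grind (splits := 40)
  subst c6
  have wq : w q = v q := hw _ c4 c1
  have hqi : ℓ q < ℓ i := by
    have := hadj i
    have := hinj q i c4
    have := hinj q j c1
    clear V1 V2 V3 W2 hw hz hinj hℓ hv hfy hy
    grind (splits := 40)
  by_cases c7 : q = y i
  · subst c7
    exact Or.inr ⟨rfl, rfl, hqi, by omega⟩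
  -- What remains is `p = y j` exchanged with a letter `q < i` outside the cycles of `i` and `j`.
  -- The relations of the cycle of `q` with these two cycles in `v`, together with `W2`, rule this
  -- out.
  exfalso
  have hQi : y q ≠ i := by rintro e; rw [← e, hy] at c7; exact c7 rfl
  have hQj : y q ≠ j := by rintro e; rw [← e, hy] at c5; exact c5 rfl
  have hQJ : y q ≠ y j := by rintro e; apply c1; rw [← hy q, e, hy]
  have hQI : y q ≠ y i := by rintro e; apply c4; rw [← hy q, e, hy]
  have fq : f q = f i := by rw [← hfpq, hfy, hf]
  have zQ : y q ≠ q → z (y q) = v (y q) := fun h => by rw [hz _ hQJ h, hw _ hQi hQj]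
  have zI : y i ≠ i → z (y i) = v (y i) := fun h => by rw [hz _ hIJ (Ne.symm c7), hw _ h hIj]
  have a1 := hinj _ _ c4
  have a2 := hinj _ _ c7
  have a3 := hinj _ _ hQi
  have a4 := hinj _ _ hQI
  have a5 := hinj _ _ hQj
  have b1 := V1 q
  have b2 := V1 (y q)
  have b3 := V1 i
  have b4 := V1 (y i)
  rw [hy] at b2 b4
  have d1 := W2 (y q)
  have d2 := W2 (y i)
  have d3 := V2 q i
  have d4 := V2 (y i) q
  have g1 := V3 q i fq
  have g2 := V3 (y q) i (by rw [hfy, fq])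
  have g3 := V3 q (y i) (by rw [hfy, fq])
  have g4 := V3 (y q) (y i) (by rw [hfy, hfy, fq])
  have g5 := V3 (y j) q (by rw [hfy, fq, hf])
  simp only [hy] at d4 g1 g2 g3 g4 g5
  have k1 : y q = q ∨ (ℓ (y q) ≠ ℓ q ∧ z (y q) = v (y q)) := by
    by_cases e : y q = q; exacts [Or.inl e, Or.inr ⟨(hinj _ _ e).2, zQ e⟩]
  have k2 : y i = i ∨ (ℓ (y i) ≠ ℓ i ∧ z (y i) = v (y i)) := by
    by_cases e : y i = i; exacts [Or.inl e, Or.inr ⟨(hinj _ _ e).2, zI e⟩]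
  clear V1 V2 V3 W2 hVJ hadj hw hz hinj hℓ hv hfy hy zQ zI
  grind (splits := 40)
end MuInv

/-! ### Which Bruhat covers of an atom are atoms -/

namespace MuInv
open Equiv
variable {n : ℕ} {μ : Composition n} {τ v w : Perm (Fin n)} {i j : Fin n}

namespace Good

theorem lt_of_lt_assoc (h : Good μ τ v) {a : Fin n} (ha : a < assocInvolution μ τ a) :
    v (assocInvolution μ τ a) < v a := by
  have := h.pat.cyc (v a)
  simp only [Perm.inv_def, symm_apply_apply, Cyc, Fin.val_fin_lt, Fin.val_fin_le] at this
  rcases this ha.le with h' | h'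
  · exact absurd (Fin.ext h'.1) ha.ne
  · exact h'.2

theorem index_apply_assoc (h : Good μ τ v) (a : Fin n) :
    μ.index (v (assocInvolution μ τ a)) = μ.index (v a) := by
  rw [h.idx, h.idx, index_assoc]

/-- No block hypothesis on `e` is needed: a position between two positions of one block lies in that
block. -/
theorem not_between (h : Good μ τ v) (hτ : τ ∈ muInvolutions μ) {a e : Fin n} (h1 : a < e)
    (h2 : e < assocInvolution μ τ a) (h3 : v (assocInvolution μ τ a) < v e)
    (h4 : v e < v a) : False := by
  have hb : μ.index (v a) = μ.index (v e) :=
    le_antisymm (h.index_apply_assoc a ▸ monotone_index μ h3.le) (monotone_index μ h4.le)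
  have hl := (h1.trans h2).le
  have o := fun hl' hne => h.pat.ok (v a) (v e) hb (by simpa using hl) hl' hne
  have o' := fun hl' hne => h.pat.ok_lu (p := v a) (q := v e) hb (by simpa using hl) hl' hne
  simp only [Perm.inv_def, symm_apply_apply, Ok, Half] at o o'
  rcases le_total e (assocInvolution μ τ e) with he | he
  · have := (o he h4.ne').1.2.1
    exact this h1 h2 h3 h4
  · have := (o' he (fun e' => h3.ne (by rw [v.injective e', assoc_assoc hτ]))).1.2.2
    exact this h1 h2 h3 h4

theorem lt_of_lt_of_assoc_lt (h : Good μ τ v) {a b : Fin n} (hb : μ.index (τ⁻¹ a) = μ.index (τ⁻¹ b))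
    (h1 : a ≤ assocInvolution μ τ a) (h2 : b ≤ assocInvolution μ τ b) (h3 : a < b)
    (h4 : assocInvolution μ τ a < assocInvolution μ τ b) : v a < v (assocInvolution μ τ b) := by
  have o := h.pat.ok (v a) (v b) (by rw [h.idx, h.idx, hb]) (by simpa using h1) (by simpa using h2)
    (fun e => h3.ne (v.injective e))
  simp only [Perm.inv_def, symm_apply_apply, Ok, Half] at o
  exact o.1.1 h3 h4

theorem of_pat (h : Good μ τ v) (hidx : ∀ z, μ.index (w z) = μ.index (v z)) {η' : Fin n → Fin n}
    (hp : Pat μ.index η' (fun p => (w⁻¹ p : ℕ)))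
    (hY : ∀ Y : ℕ → ℕ, (∀ p, Y (v⁻¹ p : ℕ) = (v⁻¹ (v (assocInvolution μ τ (v⁻¹ p))) : ℕ)) →
      ∀ p, Y (w⁻¹ p : ℕ) = (w⁻¹ (η' p) : ℕ)) : Good μ τ w := by
  refine ⟨fun z => by rw [hidx, h.idx], ?_⟩
  convert hp using 1
  funext p
  -- The value 0 is never reached, because all letters are below `n`.
  have := hY (fun m => if hm : m < n then assocInvolution μ τ ⟨m, hm⟩ else 0) (fun p => by simp) p
  simp only [Fin.is_lt, dite_true, Fin.eta] at this
  rw [Fin.ext this]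
  simp

end Good

/-- A Bruhat cover of an atom is an atom unless the two letters lie in one block, the cycle of the
larger letter starts below that of the smaller one, and the two cycles do not interleave. -/
theorem Good.isMuAtom_or (h : Good μ τ v) (hτ : τ ∈ muInvolutions μ) (hij : i < j) (hlt : v i < v j)
    (hc : ∀ e, i < e → e < j → v i < v e → v e < v j → False) : IsMuAtom μ (v * swap i j) ∨
      (μ.index (τ⁻¹ i) = μ.index (τ⁻¹ j) ∧ assocInvolution μ τ j < assocInvolution μ τ i ∧
        ((assocInvolution μ τ j < i ∧ assocInvolution μ τ i < j) ∨
        (i < assocInvolution μ τ j ∧ j < assocInvolution μ τ i))) := by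
  set y := assocInvolution μ τ with hy
  have hyy : ∀ a, y (y a) = a := assoc_assoc hτ
  have hP := h.pat
  rw [← hy] at hP
  obtain ⟨u, hu⟩ : ∃ u : Fin n → ℕ, u = fun p => (v⁻¹ p : ℕ) := ⟨_, rfl⟩
  obtain ⟨η, hη⟩ : ∃ η : Fin n → Fin n, η = fun p => v (y (v⁻¹ p)) := ⟨_, rfl⟩
  obtain ⟨u', hu'⟩ : ∃ u' : Fin n → ℕ, u' = fun p => ((v * swap i j)⁻¹ p : ℕ) := ⟨_, rfl⟩
  rw [← hu, ← hη] at hP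
  have uv : ∀ a, u (v a) = a := fun a => by simp [hu]
  have ηv : ∀ a, η (v a) = v (y a) := fun a => by simp [hη]
  have uv' : ∀ a, u' (v a) = swap i j a := fun a => by simp [hu', mul_inv_rev]
  have hs : ∀ p, ∃ a, v a = p := v.surjective
  have hne : ∀ p, p ≠ v i → p ≠ v j → u' p = u p := fun p h1 h2 => by
    obtain ⟨a, rfl⟩ := hs p
    rw [uv, uv', swap_apply_of_ne_of_ne (by rintro rfl; exact h1 rfl) (by rintro rfl; exact h2 rfl)]
  have e1 : u' (v i) = j := by rw [uv', swap_apply_left]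
  have e2 : u' (v j) = i := by rw [uv', swap_apply_right]
  have at_of : (∃ η', Pat μ.index η' u') → IsMuAtom μ (v * swap i j) := by
    rintro ⟨η', h'⟩
    rw [hu'] at h'
    exact isMuAtom_of_pat h'
  have hinj : ∀ a b : Fin n, (a : ℕ) = b → a = b := fun a b => Fin.ext
  by_cases hb : μ.index (v i) = μ.index (v j)
  swap
  · left
    apply at_of
    have hblt : μ.index (v i) < μ.index (v j) := lt_of_le_of_ne (monotone_index μ hlt.le) hb
    -- The letter `i` is raised to `j` in its block, and then `j` is lowered to `i` in the other. In
    -- between, `j` occurs twice, but in different blocks. As one block lies entirely to the left of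
    -- the other, the cover condition gives what `raise` and `lower` require.
    obtain ⟨η1, h1⟩ := hP.raise (r := v i) (u' := Function.update u (v i) j)
      (fun p hp => Function.update_of_ne hp _ _) (by rw [Function.update_self, uv]; exact hij)
      (fun t ht _ e => by
        obtain ⟨a, rfl⟩ := hs t
        rw [Function.update_self, uv] at e
        rw [Fin.ext e] at ht
        exact hb ht.symm)
      (fun t ht k1 k2 k3 => by
        obtain ⟨a, rfl⟩ := hs t
        rw [Function.update_self, uv] at k2
        rw [uv, uv] at k1
        exact hc a k1 k2 k3 (lt_of_index_lt (by rwa [ht])))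
    refine h1.lower (r := v j) (u' := u') (fun p hp => ?_) ?_ (fun t ht _ e =>
        ?_) fun t ht k1 k2 k3 => ?_
    · by_cases hp' : p = v i
      · rw [hp', Function.update_self, e1]
      · rw [Function.update_of_ne hp', hne p hp' hp]
    · rw [Function.update_of_ne (fun e => hlt.ne' e), e2, uv]; exact hij
    · obtain ⟨a, rfl⟩ := hs t
      have hai : v a ≠ v i := fun e' => hb (by rw [← e', ht])
      rw [Function.update_of_ne hai, e2, uv] at e
      exact hai (by rw [Fin.ext e])
    · obtain ⟨a, rfl⟩ := hs t
      have hai : v a ≠ v i := fun e' => hb (by rw [← e', ht])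
      rw [Function.update_of_ne hai, e2, uv] at k1
      rw [Function.update_of_ne hai, Function.update_of_ne (fun e => hlt.ne' e), uv, uv] at k2
      exact hc a k1 k2 (lt_of_index_lt (by rwa [ht])) k3
  rw [or_iff_not_imp_left]
  intro hna
  refine ⟨by rwa [h.idx, h.idx] at hb, ?_⟩
  have hc' : ∀ t, μ.index t = μ.index (v i) → u (v i) < u t → u t < u (v j) → v i < t → t < v j →
      False := by
    intro t _ k1 k2 k3 k4
    obtain ⟨a, rfl⟩ := hs t
    rw [uv, uv] at k1 k2
    exact hc a k1 k2 k3 k4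
  have hg : ∀ p, p ≠ v i → p ≠ v j → p ≠ η (v i) → p ≠ η (v j) → u' p = u p := fun p a b _ _ =>
      hne p a b
  -- These three facts exclude `y j < i < j < y i`, since there `v j < v (y j) < v (y i) < v i`.
  have v1 := h.lt_of_lt_assoc (a := i)
  have v2 := h.lt_of_lt_assoc (a := y j)
  have v3 := h.lt_of_lt_of_assoc_lt (a := y j) (b := i)
      (by rw [hy, index_assoc]; rwa [h.idx, h.idx, eq_comm] at hb)
  rw [← hy] at v1 v2 v3
  rw [hyy] at v2 v3
  have n1 : y i ≠ y j := fun e => hij.ne (y.injective e)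
  by_cases c0 : y i = j
  · exfalso
    rw [c0] at v1
    exact (v1 hij).not_gt hlt
  have c0' : y j ≠ i := fun e => c0 (by rw [← e, hyy])
  have k1 : η (v i) ≠ v i → u' (η (v i)) = u (η (v i)) := fun e =>
      hne _ e (by rw [ηv]; exact fun e => c0 (v.injective e))
  have k2 : η (v j) ≠ v j → u' (η (v j)) = u (η (v j)) := fun e =>
      hne _ (by rw [ηv]; exact fun e => c0' (v.injective e)) e
  have f1 : u' (v i) = u (v j) := by rw [e1, uv]
  have f2 : u' (v j) = u (v i) := by rw [e2, uv]
  -- Each of the seven shapes that yield an atom is negated. Of the relative orders of `i, j, y i, y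
  -- j`, only the exceptional ones then survive.
  have s1 :=
      mt (fun hh =>
      at_of ((hP.swap_link hb hlt hg f1 f2 k1 k2 hc' hh.1 hh.2.1 hh.2.2).imp fun _ h => h.1))
    hna (a := u (v i) ≤ u (η (v i)) ∧ u (η (v i)) < u (η (v j)) ∧ u (η (v j)) ≤ u (v j))
  have s2 :=
      mt (fun hh => at_of (hP.swap_unlink_right hb hlt hg f1 f2 k1 k2 hc' hh.1 hh.2.1 hh.2.2))
    hna (a := u (η (v i)) < u (v i) ∧ u (v i) < u (η (v j)) ∧ u (η (v j)) < u (v j))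
  have s3 := mt (fun hh => at_of (hP.swap_unlink_left hb hlt hg f1 f2 k1 k2 hc' hh.1 hh.2.1 hh.2.2))
    hna (a := u (v i) < u (η (v i)) ∧ u (η (v i)) < u (v j) ∧ u (v j) < u (η (v j)))
  have s4 := mt (fun hh => at_of (hP.swap_relink hb hlt hg f1 f2 k1 k2 hc' hh.1 hh.2.1 hh.2.2))
    hna (a := u (v i) < u (η (v j)) ∧ u (η (v j)) < u (η (v i)) ∧ u (η (v i)) < u (v j))
  have s5 :=
      mt (fun hh =>
      at_of ⟨_, hP.swap_conj_far hb hlt hg f1 f2 k1 k2 hc' hh.1 hh.2.1 hh.2.2.1 hh.2.2.2⟩)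
    hna (a := u (η (v i)) ≤ u (v i) ∧ u (v i) < u (v j) ∧ u (v j) ≤ u (η (v j)) ∧
        (u (η (v i)) < u (v i) ∨ u (v j) < u (η (v j))))
  have s6 := mt (fun hh => at_of ⟨_, hP.swap_conj_low hb hlt hg f1 f2 k1 k2 hc' hh.1 hh.2.1 hh.2.2⟩)
    hna (a := u (η (v i)) < u (η (v j)) ∧ u (η (v j)) < u (v i) ∧ u (v i) < u (v j))
  have s7 :=
      mt (fun hh => at_of ⟨_, hP.swap_conj_high hb hlt hg f1 f2 k1 k2 hc' hh.1 hh.2.1 hh.2.2⟩)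
    hna (a := u (v i) < u (v j) ∧ u (v j) < u (η (v i)) ∧ u (η (v i)) < u (η (v j)))
  simp only [ηv, uv] at s1 s2 s3 s4 s5 s6 s7
  have n2 : (y i : ℕ) ≠ j := fun e => c0 (Fin.ext e)
  have n3 : (y j : ℕ) ≠ i := fun e => c0' (Fin.ext e)
  have n4 : (y i : ℕ) ≠ y j := fun e => n1 (Fin.ext e)
  simp only [Fin.lt_def, Fin.le_def] at *
  clear hc hc' hg hne at_of hP uv ηv uv' hinj hyy k1 k2
  lia

end MuInv

/-! ### Existence of the second exchange -/

namespace MuInv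
open Equiv
variable {n : ℕ} {μ : Composition n} {τ v w : Perm (Fin n)} {i j : Fin n}

/-- A Bruhat cover of an atom that is not an atom has a second transposition leading back to an atom. -/
theorem Good.exists_swap (h : Good μ τ v) (hτ : τ ∈ muInvolutions μ) (hij : i < j) (hlt : v i < v j)
    (hc : ∀ e, i < e → e < j → v i < v e → v e < v j → False)
    (hb : μ.index (τ⁻¹ i) = μ.index (τ⁻¹ j)) (hJI : assocInvolution μ τ j < assocInvolution μ τ i)
    (hcase : (assocInvolution μ τ j < i ∧ assocInvolution μ τ i < j) ∨
      (i < assocInvolution μ τ j ∧ j < assocInvolution μ τ i)) :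
    ∃ i' j', i' < j' ∧ (i', j') ≠ (i, j) ∧ Good μ τ (v * swap i j * swap i' j') ∧
      (i' = j ∨ i' = assocInvolution μ τ j) ∧ (j' = i ∨ j' = assocInvolution μ τ i) := by
  have hwb : μ.index (v i) = μ.index (v j) := by rw [h.idx, h.idx, hb]
  have yb := h.index_apply_assoc
  have hG := fun (w : Perm (Fin n)) (hidx : ∀ z, μ.index (w z) = μ.index (v z)) η' =>
      h.of_pat hidx (η' := η')
  have hyy := assoc_assoc (μ := μ) hτ
  have v1 := h.lt_of_lt_assoc (a := i)
  have v2 := h.lt_of_lt_assoc (a := assocInvolution μ τ j)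
  rw [hyy] at v2
  have hP := h.pat
  set y := assocInvolution μ τ with hy
  obtain ⟨u, hu⟩ : ∃ u : Fin n → ℕ, u = fun p => (v⁻¹ p : ℕ) := ⟨_, rfl⟩
  obtain ⟨η, hη⟩ : ∃ η : Fin n → Fin n, η = fun p => v (y (v⁻¹ p)) := ⟨_, rfl⟩
  rw [← hu, ← hη] at hP
  have uv : ∀ a, u (v a) = a := fun a => by simp [hu]
  have ηv : ∀ a, η (v a) = v (y a) := fun a => by simp [hη]
  have hs : ∀ p, ∃ a, v a = p := v.surjective
  have n0 : i ≠ j := hij.ne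
  have n1 : y i ≠ y j := fun e => hij.ne (y.injective e)
  have c0 : y i ≠ j := fun e => (v1 (e ▸ hij)).not_gt (e ▸ hlt)
  have c0' : y j ≠ i := fun e => c0 (by rw [← e, hyy])
  have hc' : ∀ t, μ.index t = μ.index (v i) → u (v i) < u t → u t < u (v j) → v i < t → t < v j →
      False := by
    intro t _ k1 k2 k3 k4
    obtain ⟨a, rfl⟩ := hs t
    rw [uv, uv] at k1 k2
    exact hc a k1 k2 k3 k4
  have hidx : ∀ p q, μ.index (v p) = μ.index (v q) → ∀ z,
      μ.index ((v * swap i j * swap p q) z) = μ.index (v z) := fun p q hpq z => by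
    have key : ∀ a b, μ.index (v a) = μ.index (v b) → ∀ z,
        μ.index (v (swap a b z)) = μ.index (v z) := by
      intro a b hab z
      rw [swap_apply_def]; split_ifs with k1 k2 <;> simp [*]
    rw [Perm.mul_apply, Perm.mul_apply, key i j hwb, key p q hpq]
  have u'v : ∀ p q a, ((v * swap i j * swap p q)⁻¹ (v a) : ℕ) = swap p q (swap i j a) :=
      fun p q a => by
    simp [mul_inv_rev]
  have hgen : ∀ p q : Fin n, (p = y i ∨ p = y j ∨ p = i ∨ p = j) → (q = y i ∨ q = y j ∨ q = i ∨
      q = j) →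
      ∀ t, t ≠ v i → t ≠ v j → t ≠ η (v i) → t ≠ η (v j) →
          ((v * swap i j * swap p q)⁻¹ t : ℕ) = u t := by
    intro p q hp hq t
    obtain ⟨a, rfl⟩ := hs t
    rw [u'v, uv, ηv, ηv]
    intro k1 k2 k3 k4
    have := fun e : a = i => k1 (by rw [e])
    have := fun e : a = j => k2 (by rw [e])
    have := fun e : a = y i => k3 (by rw [e])
    have := fun e : a = y j => k4 (by rw [e])
    rw [swap_apply_of_ne_of_ne (a := i) (b := j) (by assumption) (by assumption),
        swap_apply_of_ne_of_ne]
    all_goals rintro rfl; simp_all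
  have hfin : ∀ p q, μ.index (v p) = μ.index (v q) →
      (∃ η', Pat μ.index η' (fun t => ((v * swap i j * swap p q)⁻¹ t : ℕ)) ∧
        ∀ Y : ℕ → ℕ, (∀ t, Y (u t) = u (η t)) → ∀ t, Y ((v * swap i j * swap p q)⁻¹ t : ℕ) =
          ((v * swap i j * swap p q)⁻¹ (η' t) : ℕ)) → Good μ τ (v * swap i j * swap p q) := by
    rintro p q hpq ⟨η', a, b⟩
    rw [hu, hη] at b
    exact hG _ (hidx p q hpq) _ a b
  have m1 : v i ≠ v j := fun e => n0 (v.injective e)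
  -- The first family is repaired by `(y j, i)`, a rotation, unless `y i < i` and `y i` stands
  -- before `y j`. In that situation the partners are exchanged as well, by `(y j, y i)`. The second
  -- family is the mirror image, with `(j, y i)` for the rotation.
  rcases hcase with ⟨h1, h2⟩ | ⟨h1, h2⟩
  · by_cases h3 : i ≤ y i
    · refine ⟨y j, i, h1, fun e => n0 (Prod.ext_iff.1 e).2, hfin _ _ (by rw [yb, hwb]) ?_,
        Or.inr rfl, Or.inl rfl⟩
      refine hP.rotate_inner hwb hlt (hgen _ _ (by simp) (by simp)) ?_ ?_ ?_ ?_ hc' ?_ ?_ ?_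
      all_goals
        simp only [u'v, uv, ηv, swap_apply_def, Fin.val_fin_lt, Fin.val_fin_le]
        clear hP hfin hgen u'v hidx hc' hs uv ηv hη hu hyy hG hc yb v1 v2
        grind
    rw [not_le] at h3
    by_cases h4 : v (y j) < v (y i)
    · refine ⟨y j, i, h1, fun e => n0 (Prod.ext_iff.1 e).2, hfin _ _ (by rw [yb, hwb]) ?_,
        Or.inr rfl, Or.inl rfl⟩
      refine hP.rotate_below hwb hlt (hgen _ _ (by simp) (by simp)) ?_ ?_ ?_ ?_ hc' ?_ ?_ ?_ ?_
      all_goals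
        simp only [u'v, uv, ηv, swap_apply_def, Fin.val_fin_lt]
        clear hP hfin hgen u'v hidx hc' hs uv ηv hη hu hyy hG hc yb v1 v2
        grind
    · have h4' : v (y i) < v (y j) := lt_of_le_of_ne (not_lt.1 h4) fun e => n1 (v.injective e)
      refine ⟨y j, y i, hJI, fun e => c0 (Prod.ext_iff.1 e).2, hfin _ _ (by rw [yb, yb, hwb])
          ⟨η, ?_⟩, Or.inr rfl, Or.inr rfl⟩
      refine hP.exchange_below hwb hlt (hgen _ _ (by simp) (by simp)) ?_ ?_ ?_ ?_ hc' ?_ ?_ ?_ ?_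
      all_goals
        simp only [u'v, uv, ηv, swap_apply_def, Fin.val_fin_lt]
        clear hP hfin hgen u'v hidx hc' hs uv ηv hη hu hyy hG hc yb v1 v2
        grind
  · by_cases h3 : y j ≤ j
    · refine ⟨j, y i, h2, fun e => n0 (Prod.ext_iff.1 e).1.symm, hfin _ _ (by rw [yb, hwb]) ?_,
        Or.inl rfl, Or.inr rfl⟩
      refine hP.rotate_outer hwb hlt (hgen _ _ (by simp) (by simp)) ?_ ?_ ?_ ?_ hc' ?_ ?_ ?_
      all_goals
        simp only [u'v, uv, ηv, swap_apply_def, Fin.val_fin_lt, Fin.val_fin_le]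
        clear hP hfin hgen u'v hidx hc' hs uv ηv hη hu hyy hG hc yb v1 v2
        grind
    rw [not_le] at h3
    by_cases h4 : v (y j) < v (y i)
    · refine ⟨j, y i, h2, fun e => n0 (Prod.ext_iff.1 e).1.symm, hfin _ _ (by rw [yb, hwb]) ?_,
        Or.inl rfl, Or.inr rfl⟩
      refine hP.rotate_above hwb hlt (hgen _ _ (by simp) (by simp)) ?_ ?_ ?_ ?_ hc' ?_ ?_ ?_ ?_
      all_goals
        simp only [u'v, uv, ηv, swap_apply_def, Fin.val_fin_lt]
        clear hP hfin hgen u'v hidx hc' hs uv ηv hη hu hyy hG hc yb v1 v2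
        grind
    · have h4' : v (y i) < v (y j) := lt_of_le_of_ne (not_lt.1 h4) fun e => n1 (v.injective e)
      refine ⟨y j, y i, hJI, fun e => c0 (Prod.ext_iff.1 e).2, hfin _ _ (by rw [yb, yb, hwb])
          ⟨η, ?_⟩, Or.inr rfl, Or.inr rfl⟩
      refine hP.exchange_above hwb hlt (hgen _ _ (by simp) (by simp)) ?_ ?_ ?_ ?_ hc' ?_ ?_ ?_ ?_
      all_goals
        simp only [u'v, uv, ηv, swap_apply_def, Fin.val_fin_lt]
        clear hP hfin hgen u'v hidx hc' hs uv ηv hη hu hyy hG hc yb v1 v2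
        grind

end MuInv

/-! ### Uniqueness and the exchange properties -/

namespace MuInv
open Equiv
variable {n : ℕ} {μ : Composition n} {τ v w : Perm (Fin n)} {i j : Fin n}

/-- There is only one way back to an atom besides the original one. -/
theorem Good.swap_unique (h : Good μ τ v) (hτ : τ ∈ muInvolutions μ) (hij : i < j) (hlt : v i < v j)
    (hlen : len (v * swap i j) = len v + 1)
    (hb : μ.index (τ⁻¹ i) = μ.index (τ⁻¹ j)) (hJI : assocInvolution μ τ j < assocInvolution μ τ i)
    (hcase : (assocInvolution μ τ j < i ∧ assocInvolution μ τ i < j) ∨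
      (i < assocInvolution μ τ j ∧ j < assocInvolution μ τ i))
    {p q p' q' : Fin n} (hpq : p < q) (hne : (p, q) ≠ (i, j))
        (hw : Good μ τ (v * swap i j * swap p q))
    (hpq' : p' < q') (hne' : (p', q') ≠ (i, j)) (hw' : Good μ τ (v * swap i j * swap p' q')) :
    p = p' ∧ q = q' := by
  have hyy := assoc_assoc (μ := μ) hτ
  have hyb := fun a => index_assoc (μ := μ) (π := τ) a
  have V1 := fun a => h.lt_of_lt_assoc (a := a)
  have V2 := fun a e => h.not_between hτ (a := a) (e := e)
  have V3 := fun a b => h.lt_of_lt_of_assoc_lt (a := a) (b := b)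
  have hne_yij : assocInvolution μ τ i ≠ j := fun e => (V1 i (e ▸ hij)).not_gt (e ▸ hlt)
  have hwb : μ.index (v i) = μ.index (v j) := by rw [h.idx, h.idx, hb]
  have hinj : Function.Injective fun a : Fin n => (a : ℤ) := fun a b e => Fin.ext (by simpa using e)
  have hvinj : Function.Injective fun a : Fin n => (v a : ℤ) := hinj.comp v.injective
  have key : ∀ {p q : Fin n}, p < q → (p, q) ≠ (i, j) → Good μ τ (v * swap i j * swap p q) →
      (assocInvolution μ τ j < i → assocInvolution μ τ i < j →
        (p = assocInvolution μ τ j ∧ q = i ∧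
          ¬ (((assocInvolution μ τ i : ℕ) : ℤ) < (i : ℕ) ∧
            ((v (assocInvolution μ τ i) : ℕ) : ℤ) < (v (assocInvolution μ τ j) : ℕ))) ∨
        (p = assocInvolution μ τ j ∧ q = assocInvolution μ τ i ∧
          ((assocInvolution μ τ i : ℕ) : ℤ) < (i : ℕ) ∧
            ((v (assocInvolution μ τ i) : ℕ) : ℤ) < (v (assocInvolution μ τ j) : ℕ))) ∧
      (i < assocInvolution μ τ j → j < assocInvolution μ τ i →
        (q = assocInvolution μ τ i ∧ p = j ∧
          ¬ (-((assocInvolution μ τ j : ℕ) : ℤ) < -(j : ℕ) ∧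
            -((v (assocInvolution μ τ j) : ℕ) : ℤ) < -(v (assocInvolution μ τ i) : ℕ))) ∨
        (q = assocInvolution μ τ i ∧ p = assocInvolution μ τ j ∧
          -((assocInvolution μ τ j : ℕ) : ℤ) < -(j : ℕ) ∧
            -((v (assocInvolution μ τ j) : ℕ) : ℤ) < -(v (assocInvolution μ τ i) : ℕ))) := by
    intro p q hpq hne hw
    have W1 := fun a => hw.lt_of_lt_assoc (a := a)
    have W2 := fun a e => hw.not_between hτ (a := a) (e := e)
    have hl := hw.four_mul_len hτ
    rw [← h.four_mul_len hτ] at hl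
    -- All atoms of `τ` have the same length, so `(p, q)` is an inversion of `v * swap i j`, and
    -- removing it is again a cover.
    have hd : (v * swap i j) q < (v * swap i j) p := (len_mul_swap_lt_iff hpq).1 (by omega)
    have hback : v * swap i j * swap p q * swap p q = v * swap i j := by
      rw [mul_assoc, swap_mul_self, mul_one]
    have hadj : ∀ e, p < e → e < q → (v * swap i j) q < (v * swap i j) e →
        (v * swap i j) e < (v * swap i j) p → False := fun e h1 h2 h3 h4 => by
      have := not_between_of_len (v := v * swap i j * swap p q) h1 h2
        (by rwa [Perm.mul_apply, Perm.mul_apply _ (swap p q) e, swap_apply_left,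
          swap_apply_of_ne_of_ne h1.ne' h2.ne])
        (by rwa [Perm.mul_apply, Perm.mul_apply _ (swap p q) q, swap_apply_right,
          swap_apply_of_ne_of_ne h1.ne' h2.ne])
      rw [hback] at this
      omega
    have hidx : ∀ z, μ.index ((v * swap i j) z) = μ.index (τ⁻¹ z) := fun z => by
      rw [← h.idx, Perm.mul_apply, swap_apply_def]
      split_ifs with h1 h2 <;> simp [*]
    have hf : μ.index (τ⁻¹ p) = μ.index (τ⁻¹ q) := by
      rw [← hw.idx p, Perm.mul_apply, swap_apply_left, hidx]
    have wi : (v * swap i j) i = v j := by rw [Perm.mul_apply, swap_apply_left]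
    have wj : (v * swap i j) j = v i := by rw [Perm.mul_apply, swap_apply_right]
    have wo : ∀ e, e ≠ i → e ≠ j → (v * swap i j) e = v e := fun e h1 h2 => by
      rw [Perm.mul_apply, swap_apply_of_ne_of_ne h1 h2]
    have zp : (v * swap i j * swap p q) p = (v * swap i j) q :=
        by rw [Perm.mul_apply, swap_apply_left]
    have zq : (v * swap i j * swap p q) q = (v * swap i j) p :=
        by rw [Perm.mul_apply, swap_apply_right]
    have zo : ∀ e, e ≠ p → e ≠ q → (v * swap i j * swap p q) e = (v * swap i j) e := fun e h1 h2 =>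
        by
      rw [Perm.mul_apply, swap_apply_of_ne_of_ne h1 h2]
    have hne1 : ¬ (p = i ∧ q = j) := fun e => hne (Prod.ext e.1 e.2)
    generalize v * swap i j * swap p q = z at *
    generalize v * swap i j = w at *
    refine ⟨fun hJ hI => ?_, fun hJ hI => ?_⟩
    · have W2' := W2 (assocInvolution μ τ j)
      have W1' := W1 (assocInvolution μ τ j)
      rw [hyy] at W1' W2'
      exact unique_pair (ℓ := fun a : Fin n => ((a : ℕ) : ℤ)) (v := fun a => ((v a : ℕ) : ℤ))
        (w := fun a => ((w a : ℕ) : ℤ)) (z := fun a => ((z a : ℕ) : ℤ)) (y := assocInvolution μ τ)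
        (f := fun a => μ.index (τ⁻¹ a)) hinj hvinj hyy
        (by simpa using V1) (by simpa using V2) (by simpa using V3)
        (by simp [wi]) (by simp [wj]) (fun e h1 h2 => by simp [wo e h1 h2])
        (by simp [zp]) (by simp [zq]) (fun e h1 h2 => by simp [zo e h1 h2])
        (by simpa using hpq) (by simpa using hd) (by simpa using hadj)
        (by simpa using W1' (hJ.trans hij)) (by simpa using W2')
        (by simpa using hij) (by simpa using hlt) (by simpa using hJ) (by simpa using hI)
        (by simpa using hJI) hne1 hb hyb hf
    -- The second family reduces to the first by negating letters and positions, which exchanges the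
    -- roles of `i` and `j` and of `p` and `q`.
    · have W2' := fun e => W2 i e
      have V1' := fun a => V1 (assocInvolution μ τ a)
      have V2' := fun a => V2 (assocInvolution μ τ a)
      have V3' := fun a b => V3 (assocInvolution μ τ b) (assocInvolution μ τ a)
      simp only [hyy, hyb] at V1' V2' V3'
      exact unique_pair (ℓ := fun a : Fin n => -((a : ℕ) : ℤ)) (v := fun a => -((v a : ℕ) : ℤ))
        (w := fun a => -((w a : ℕ) : ℤ)) (z := fun a => -((z a : ℕ) : ℤ)) (y := assocInvolution μ τ)
        (f := fun a => μ.index (τ⁻¹ a)) (neg_injective.comp hinj) (neg_injective.comp hvinj) hyy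
        (by simpa using V1') (fun a e h1 h2 h3 h4 => V2' a e (by simpa using h2)
        (by simpa using h1) (by simpa using h4) (by simpa using h3))
        (fun a b e h1 h2 h3 h4 => by
          simpa using V3' a b e.symm (by simpa using h2) (by simpa using h1) (by simpa using h4)
              (by simpa using h3))
        (by simp [wj]) (by simp [wi]) (fun e h1 h2 => by simp [wo e h2 h1])
        (by simp [zq]) (by simp [zp]) (fun e h1 h2 => by simp [zo e h2 h1])
        (by simpa using hpq) (by simpa using hd) (fun e h1 h2 h3 h4 => hadj e (by simpa using h2)
        (by simpa using h1)
          (by simpa using h4) (by simpa using h3))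
        (by simpa using W1 i (hij.trans hI)) (fun e h1 h2 h3 h4 => W2' e (by simpa using h2)
        (by simpa using h1)
          (by simpa using h4) (by simpa using h3))
        (by simpa using hij) (by simpa using hlt) (by simpa using hI) (by simpa using hJ)
        (by simpa using hJI) (fun e => hne1 ⟨e.2, e.1⟩) hb.symm hyb hf.symm
  have k1 := key hpq hne hw
  have k2 := key hpq' hne' hw'
  rcases hcase with ⟨a, b⟩ | ⟨a, b⟩
  · have k1 := k1.1 a b
    have k2 := k2.1 a b
    grind
  · have k1 := k1.2 a b
    have k2 := k2.2 a b
    grind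

/-- The exchange property of Bruhat covers of atoms. -/
theorem Good.existsUnique_swap (h : Good μ τ v) (hτ : τ ∈ muInvolutions μ) (hij : i < j)
    (hlen : len (v * swap i j) = len v + 1) (hna : ¬ IsMuAtom μ (v * swap i j)) :
    μ.index (τ⁻¹ i) = μ.index (τ⁻¹ j) ∧ ∃ i' j' : Fin n, i' < j' ∧ (i', j') ≠ (i, j) ∧
      Good μ τ (v * swap i j * swap i' j') ∧
      (i' = j ∨ i' = assocInvolution μ τ j) ∧ (j' = i ∨ j' = assocInvolution μ τ i) ∧
      (∀ p q : Fin n, p < q → (p, q) ≠ (i, j) → Good μ τ (v * swap i j * swap p q) → p = i' ∧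
      q = j') ∧
      (∀ p q : Fin n, p < q → Good μ τ (v * swap i j * swap p q) →
        (p = j ∨ p = assocInvolution μ τ j) → (q = i ∨ q = assocInvolution μ τ i) → p = i' ∧
        q = j') := by
  have hlt : v i < v j := by
    have := mt (len_mul_swap_lt (w := v) hij) (by omega)
    exact lt_of_le_of_ne (not_lt.1 this) fun e => hij.ne (v.injective e)
  have hc : ∀ e, i < e → e < j → v i < v e → v e < v j → False := fun e h1 h2 h3 h4 => by
    have := not_between_of_len h1 h2 h3 h4
    omega
  obtain ⟨hb, hJI, hcase⟩ := (h.isMuAtom_or hτ hij hlt hc).resolve_left hna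
  obtain ⟨i', j', h1, h2, h3, h4, h5⟩ := h.exists_swap hτ hij hlt hc hb hJI hcase
  have huniq : ∀ p q : Fin n, p < q → (p, q) ≠ (i, j) → Good μ τ (v * swap i j * swap p q) →
      p = i' ∧ q = j' := fun p q hpq hne hw =>
    h.swap_unique hτ hij hlt hlen hb hJI hcase hpq hne hw h1 h2 h3
  refine ⟨hb, i', j', h1, h2, h3, h4, h5, huniq, fun p q hpq hw hp hq => huniq p q hpq (fun e =>
      ?_) hw⟩
  -- The pair `(i, j)` itself fails the membership conditions: they would make `i` and `j` partners,
  -- and then `j` would precede `i` in the word of `v`.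
  obtain ⟨rfl, rfl⟩ := Prod.ext_iff.1 e
  have hp := hp.resolve_left hpq.ne
  have hyy := assoc_assoc (μ := μ) hτ q
  have hq : q = assocInvolution μ τ p := by rw [hp, hyy]
  have := h.lt_of_lt_assoc (a := p) (by rwa [← hq])
  rw [← hq] at this
  exact this.not_gt hlt

theorem wordProd_swap_comm {w w' : Perm (Fin n)} {i j : Fin n}
    (h : w' = w * swap i j) : w = w' * swap i j := by
  rw [h, mul_assoc, swap_mul_self, mul_one]

theorem isMuReduced_iff {a : Word n} : IsMuReduced μ a ↔ ∃ π, a ∈ muReducedWords μ π :=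
  ⟨fun h => ⟨_, h⟩, fun ⟨_, h⟩ => by rw [IsMuReduced, (mem_muReducedWords.1 h).1]; exact h⟩

theorem exists_lt_swap_eraseIdx (a : Word n) (m : Fin a.length) :
    ∃ i j : Fin n, i < j ∧ wordProd (a.eraseIdx m) = wordProd a * swap i j := by
  obtain ⟨i, j, hne, e⟩ := exists_swap_eraseIdx a m
  rcases lt_or_gt_of_ne hne with h | h
  · exact ⟨i, j, h, e⟩
  · exact ⟨j, i, h, by rw [e, swap_comm]⟩

/-- The exchange property of reduced `μ`-words. -/
theorem existsUnique_nearlyMuReduced (hτ : τ ∈ muInvolutions μ) {a : Word n} {m : Fin a.length}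
    (h : NearlyMuReduced μ τ a m) : ∃! k : Fin a.length, k ≠ m ∧ NearlyMuReduced μ τ a k := by
  obtain ⟨hna, hm⟩ := h
  obtain ⟨-, hg, hr⟩ := good_of_mem hm
  have hlen := fun k : Fin a.length => length_eraseIdx' k
  -- If `a` is reduced in the symmetric group, its product covers the atom `wordProd (a.eraseIdx m)`
  -- without being an atom itself.
  by_cases ha : Reduced a
  · obtain ⟨i, j, hij, e⟩ := exists_lt_swap_eraseIdx a m
    have e' := wordProd_swap_comm e
    have hat : ¬ IsMuAtom μ (wordProd (a.eraseIdx m) * swap i j) := by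
      rw [← e', isMuAtom_iff]
      rintro ⟨π, hπ, hgπ⟩
      exact hna (isMuReduced_iff.2 ⟨π, mem_of_good hπ hgπ ha⟩)
    have hl : len (wordProd (a.eraseIdx m) * swap i j) = len (wordProd (a.eraseIdx m)) + 1 := by
      rw [← e', ha, hr, hlen]
    obtain ⟨-, i', j', h1, h2, h3, -, -, huniq, -⟩ := hg.existsUnique_swap hτ hij hl hat
    rw [← e'] at h3 huniq
    have hlen3 := (h3.four_mul_len hτ).trans (hg.four_mul_len hτ).symm
    -- The second pair is an inversion of the product, again because atoms of `τ` have equal length.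
    -- Strong exchange turns it into a letter to delete.
    obtain ⟨k, hk⟩ := exists_eraseIdx (a := a) h1 ((len_mul_swap_lt_iff h1).1 (by
      rw [ha]; rw [hr] at hlen3; have := hlen m; omega))
    refine ⟨k, ⟨?_, hna, mem_of_good hτ (by rwa [hk]) ?_⟩, fun l hl => ?_⟩
    · rintro rfl
      rw [hk] at e
      have hs := mul_left_cancel e
      apply h2
      have f1 := congrArg (fun σ : Perm (Fin n) => σ i') hs
      have f2 := congrArg (fun σ : Perm (Fin n) => σ j') hs
      simp only [swap_apply_left, swap_apply_right, swap_apply_def] at f1 f2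
      ext <;> simp <;> grind
    · rw [Reduced, hk]; rw [hr] at hlen3
      have := hlen m; have := hlen k; omega
    · obtain ⟨hlm, -, hl⟩ := hl
      obtain ⟨-, hgl, -⟩ := good_of_mem hl
      obtain ⟨p, q, hpq, epq⟩ := exists_lt_swap_eraseIdx a l
      -- In a reduced word the product after a deletion determines the deleted letter, so uniqueness
      -- of the pair becomes uniqueness of the position.
      refine ha.eraseIdx_injective ?_
      rw [epq] at hgl
      have hne : (p, q) ≠ (i, j) := fun ee => hlm (ha.eraseIdx_injective (by
        obtain ⟨rfl, rfl⟩ := Prod.ext_iff.1 ee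
        rw [epq, e]))
      obtain ⟨rfl, rfl⟩ := huniq p q hpq hne hgl
      rw [epq, hk]
  -- Here both deletions represent the same atom, and reduced `μ`-words are reduced in the symmetric
  -- group, so uniqueness there suffices.
  · obtain ⟨k, hkm, hk, huniq⟩ := existsUnique_eraseIdx ha m hr
    refine ⟨k, ⟨hkm, hna, mem_of_good hτ (by rwa [hk]) ?_⟩, fun l hl =>
        huniq l hl.1 (good_of_mem hl.2.2).2.2⟩
    rw [Reduced, hk, hr]
    have := hlen m; have := hlen k; omega

end MuInv

theorem theorem3p13 {n : ℕ} (μ : Composition n) (τ : Equiv.Perm (Fin n))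
    (hτ : τ ∈ MuInv.muInvolutions μ) :
    (∀ (a : MuInv.Word n) (m : Fin a.length), MuInv.NearlyMuReduced μ τ a m →
      ∃! k : Fin a.length, k ≠ m ∧ MuInv.NearlyMuReduced μ τ a k) ∧
    (∀ v ∈ MuInv.muAtoms μ τ, ∀ i j : Fin n, i < j →
      MuInv.BruhatCover v (v * Equiv.swap i j) →
      ¬ MuInv.IsMuAtom μ (v * Equiv.swap i j) →
        MuInv.blockOf μ τ i = MuInv.blockOf μ τ j ∧
        ∃ i' j' : Fin n, i' < j' ∧ (i', j') ≠ (i, j) ∧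
          v * Equiv.swap i j * Equiv.swap i' j' ∈ MuInv.muAtoms μ τ ∧
          (i' = j ∨ i' = MuInv.assocInvolution μ τ j) ∧
          (j' = i ∨ j' = MuInv.assocInvolution μ τ i) ∧
          -- unique among the pairs other than `(i, j)`, which gives back `v`
          (∀ p q : Fin n, p < q → (p, q) ≠ (i, j) →
            v * Equiv.swap i j * Equiv.swap p q ∈ MuInv.muAtoms μ τ → p = i' ∧ q = j') ∧
          -- unique among all pairs that satisfy the two membership conditions
          (∀ p q : Fin n, p < q →
            v * Equiv.swap i j * Equiv.swap p q ∈ MuInv.muAtoms μ τ →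
            (p = j ∨ p = MuInv.assocInvolution μ τ j) →
            (q = i ∨ q = MuInv.assocInvolution μ τ i) → p = i' ∧ q = j')) := by
  refine ⟨fun a m h => MuInv.existsUnique_nearlyMuReduced hτ h, fun v hv i j hij hcov hna => ?_⟩
  simp only [MuInv.mem_muAtoms hτ] at hv ⊢
  exact hv.existsUnique_swap hτ hij hcov.2 hna
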